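/- Let $(X_i,D_i,Y_i(0),Y_i(1))$, $i=1,2,\ldots$, be i.i.d. copies of $(X,D,Y(0),Y(1))$, where $X\in\mathcal X\subset\mathbb R^p$ is a covariate vector with support $\mathcal X$ and distribution $F_X$, $D\in\{0,1\}$ is a treatment, and $Y(0),Y(1)$ are real potential outcomes. The observed data are $(X_i,D_i,Y_i)$ with $Y_i=Y_i(D_i)$. Fix a batch size $B\ge 1$, let $\mathcal B_t=\{(t-1)B+1,\ldots,tB\}$ be the index set of the $t$-th batch, and let $\mathcal H_t$ be the observed data in the batches $\mathcal B_1,\ldots,\mathcal B_t$. A policy is a (measurable) function $\pi:\mathcal X\to[0,1]$. Let $\pi_0$ be a fixed baseline policy, let $\mathcal A$ be a learning algorithm (a measurable map from data sets to policies), and put $\hat\pi_0=\pi_0$ and $\hat\pi_t=\mathcal A(\mathcal H_t)$ for $t\ge1$. Let $e(x)=\mathbb P(D=1\mid X=x)$ be the known propensity score, $V(\pi)=\mathbb E[Y(1)\pi(X)+Y(0)(1-\pi(X))]$, and $\Delta(\pi;\pi')=V(\pi)-V(\pi')$. For random policies, $\Delta$ and $\mathbb E_X$ are evaluated with the policies held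 fixed, i.e. the expectation is over a fresh draw only. Let $$\hat\Gamma_{tj}=\frac1B\sum_{i\in\mathcal B_j}\left\{\frac{Y_iD_i}{e(X_i)}-\frac{Y_i(1-D_i)}{1-e(X_i)}\right\}\bigl(\hat\pi_t(X_i)-\hat\pi_{t-1}(X_i)\bigr),\qquad \hat\Gamma_j(T)=\sum_{t=1}^{j-1}\frac{\hat\Gamma_{tj}}{T-t},$$ $$\hat\Delta(\hat\pi_T;\pi_0)=\sum_{t=1}^{T-1}\frac1{T-t}\sum_{j=t+1}^{T}\hat\Gamma_{tj}.$$ Assume the following. 1. (Strong ignorability) $\{Y(0),Y(1)\}\perp\!\!\!\perp D\mid X$, and there is $c>0$ with $c\le e(x)\le 1-c$ for all $x\in\mathcal X$. 2. (Stabilization) With $Q_t=\mathbb E_X\bigl[|\hat\pi_t(X)-\hat\pi_{t-1}(X)|\bigr]=\int|\hat\pi_t(x)-\hat\pi_{t-1}(x)|\,dF_X(x)$, there are constants $\delta>0$, $R_1>0$, $K_0>0$ such that for all $t\ge R_1$, $t^{1+\delta}Q_t\le K_0$ almost surely. 3. (The limit policy differs from the baseline) There is a constant $M_1>0$ such that $\mathbb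 E_X\bigl[|\pi_0(X)-\hat\pi_\infty(X)|\bigr]>M_1$ almost surely, where $\hat\pi_\infty$ is the limit policy of $(\hat\pi_t)$, i.e. the policy with $\lim_{t\to\infty}\mathbb E_X[|\hat\pi_\infty(X)-\hat\pi_t(X)|]=0$; under Assumption 2 it exists almost surely and is unique up to $F_X$-null sets, and it may depend on the data. 4. (Bounded conditional moments) For $d=0,1$, $\mu_d(x)=\mathbb E[Y(d)\mid X=x]$ and $\sigma_d^2(x)=\mathrm{Var}(Y(d)\mid X=x)$ satisfy $\sup_{x\in\mathcal X}|\mu_d(x)|<\infty$ and $0<\inf_{x\in\mathcal X}\sigma_d^2(x)\le\sup_{x\in\mathcal X}\sigma_d^2(x)<\infty$. 5. (Fourth moments) $\mathbb E[Y(d)^4]<\infty$ for $d=0,1$. Then, as $T\to\infty$ with $B$ fixed, $$\sqrt T\cdot\frac{\hat\Delta(\hat\pi_T;\pi_0)-\Delta(\hat\pi_T;\pi_0)}{v_T}\ \xrightarrow{\ d\ }\ N(0,1),\qquad v_T^2=T\sum_{j=2}^T\mathrm{Var}\bigl(\hat\Gamma_j(T)\mid\mathcal H_{j-1}\bigr).$$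 Both the estimand $\Delta(\hat\pi_T;\pi_0)$ and $v_T$ are random variables that depend on the observed data. -/

import Mathlib

open MeasureTheory ProbabilityTheory Filter Topology

namespace Cram

/-- Covariate vectors. -/
abbrev Covariate (p : ℕ) := EuclideanSpace ℝ (Fin p)

/-- The full record `(X, D, (Y(0), Y(1)))` of one unit: covariates, treatment (`true` is treated),
potential outcomes. -/
abbrev Record (p : ℕ) := Covariate p × Bool × (Bool → ℝ)

/-- The observed part `(X, D, Y)` of a unit. -/
abbrev Obs (p : ℕ) := Covariate p × Bool × ℝ

/-- A (deterministic or stochastic) policy: the probability of treatment given the covariates. -/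
abbrev Policy (p : ℕ) := Covariate p → unitInterval

/-- A learning algorithm maps a data set of any size to a policy. -/
abbrev LearningAlgorithm (p : ℕ) := (n : ℕ) → (Fin n → Obs p) → Policy p

noncomputable section

variable {p : ℕ}

/-- Consistency: the observed outcome is `Y = Y(D)`. -/
def observe (w : Record p) : Obs p := (w.1, w.2.1, w.2.2 w.2.1)

/-- The potential outcome `Y(d)`. -/
def outcome (d : Bool) (w : Record p) : ℝ := w.2.2 d

/-- The σ-algebra generated by the covariates. -/
abbrev covSigma (p : ℕ) : MeasurableSpace (Record p) :=
  MeasurableSpace.comap Prod.fst inferInstance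

lemma covSigma_le (p : ℕ) : covSigma p ≤ (inferInstance : MeasurableSpace (Record p)) :=
  measurable_fst.comap_le

/-- The distribution of the covariates. -/
def covLaw (P : Measure (Record p)) : Measure (Covariate p) := P.map Prod.fst

/-! ### Assumptions on the population -/

/-- The indicator of treatment, as a real number. -/
def treated (d : Bool) : ℝ := if d then 1 else 0

/-- `e` is (a version of) the propensity score, `e(X) = ℙ(D = 1 ∣ X)`. -/
def IsPropensityScore (P : Measure (Record p)) (e : Covariate p → ℝ) : Prop :=
  Measurable e ∧ (fun w => e w.1) =ᵐ[P] P[fun w => treated w.2.1 | covSigma p]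

/-- Unconfoundedness and overlap. -/
structure StrongIgnorability (P : Measure (Record p)) [IsProbabilityMeasure P]
    (e : Covariate p → ℝ) : Prop where
  unconfounded : CondIndepFun (covSigma p) (covSigma_le p)
    (fun w : Record p => w.2.2) (fun w : Record p => w.2.1) P
  overlap : ∃ c : ℝ, 0 < c ∧ ∀ᵐ x ∂(covLaw P), c ≤ e x ∧ e x ≤ 1 - c

/-- The conditional mean `μ_d(X)` is uniformly bounded and the conditional variance `σ_d²(X)` is
uniformly bounded, and bounded away from zero, for `d = 0, 1`. -/
def BoundedConditionalMoments (P : Measure (Record p)) : Prop :=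
  ∀ d : Bool,
    (∃ C : ℝ, ∀ᵐ w ∂P, |(P[outcome d | covSigma p]) w| ≤ C) ∧
    (∃ s : ℝ, 0 < s ∧ ∀ᵐ w ∂P, s ≤ condVar (covSigma p) (outcome d) P w) ∧
    (∃ S : ℝ, ∀ᵐ w ∂P, condVar (covSigma p) (outcome d) P w ≤ S)

/-- The potential outcomes have finite fourth moments. -/
def FiniteFourthMoments (P : Measure (Record p)) : Prop :=
  ∀ d : Bool, MemLp (outcome d) 4 P

/-! ### Policies and their values -/

/-- The value `V(π) = 𝔼[Y(1) π(X) + Y(0) (1 - π(X))]`. -/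
def value (P : Measure (Record p)) (π : Policy p) : ℝ :=
  ∫ w, (outcome true w * (π w.1 : ℝ) + outcome false w * (1 - (π w.1 : ℝ))) ∂P

/-- The policy value difference `Δ(π; π') = V(π) - V(π')`. -/
def valueDiff (P : Measure (Record p)) (π π' : Policy p) : ℝ := value P π - value P π'

/-- The `L¹` distance `𝔼_X |π(X) - π'(X)|` of two fixed policies. -/
def policyDist (P : Measure (Record p)) (π π' : Policy p) : ℝ :=
  ∫ x, |(π x : ℝ) - (π' x : ℝ)| ∂(covLaw P)

/-- `πlim` is the limit policy of the sequence `π` of policies. -/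
def IsLimitPolicy (P : Measure (Record p)) (π : ℕ → Policy p) (πlim : Policy p) : Prop :=
  Measurable πlim ∧ Tendsto (fun t => policyDist P πlim (π t)) atTop (𝓝 0)

/-! ### Cramming

The units are `Z 0, Z 1, …`; the batch `t = 1, 2, …` of size `B` consists of the units `i` with
`(t - 1) * B ≤ i < t * B`. -/

variable {Ω : Type*}

/-- The observed data of the first `n` units. -/
def dataset (Z : ℕ → Ω → Record p) (n : ℕ) (ω : Ω) : Fin n → Obs p :=
  fun i => observe (Z i ω)

/-- The index set of the batch `j ≥ 1`. -/
def batch (B j : ℕ) : Finset ℕ := Finset.Ico ((j - 1) * B) (j * B)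

/-- The σ-algebra generated by the observed data in the first `j` batches. -/
abbrev history (B : ℕ) (Z : ℕ → Ω → Record p) (j : ℕ) : MeasurableSpace Ω :=
  MeasurableSpace.comap (dataset Z (j * B)) inferInstance

/-- The policy learned from the first `t` batches; the policy at time `0` is the baseline. -/
def learned (A : LearningAlgorithm p) (π0 : Policy p) (B : ℕ) (Z : ℕ → Ω → Record p)
    (t : ℕ) (ω : Ω) : Policy p :=
  if t = 0 then π0 else A (t * B) (dataset Z (t * B) ω)

/-- The inverse probability weighted outcome `Y D / e(X) - Y (1 - D) / (1 - e(X))`. -/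
def ipw (e : Covariate p → ℝ) (z : Obs p) : ℝ :=
  z.2.2 * treated z.2.1 / e z.1 - z.2.2 * (1 - treated z.2.1) / (1 - e z.1)

/-- `Γ̂_{tj}`, the estimate of `Δ(π̂_t; π̂_{t-1})` from the batch `j`. -/
def gammaTJ (e : Covariate p → ℝ) (A : LearningAlgorithm p) (π0 : Policy p) (B : ℕ)
    (Z : ℕ → Ω → Record p) (t j : ℕ) (ω : Ω) : ℝ :=
  (1 / (B : ℝ)) * ∑ i ∈ batch B j, ipw e (observe (Z i ω)) *
    ((learned A π0 B Z t ω (Z i ω).1 : ℝ) - (learned A π0 B Z (t - 1) ω (Z i ω).1 : ℝ))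

/-- The estimate of `Δ(π̂_t; π̂_{t-1})` from the batches `t + 1, …, T`. -/
def deltaHatStep (e : Covariate p → ℝ) (A : LearningAlgorithm p) (π0 : Policy p) (B : ℕ)
    (Z : ℕ → Ω → Record p) (T t : ℕ) (ω : Ω) : ℝ :=
  (1 / ((T : ℝ) - (t : ℝ))) * ∑ j ∈ Finset.Icc (t + 1) T, gammaTJ e A π0 B Z t j ω

/-- The crammed IPW policy evaluation estimator of `Δ(π̂_T; π_0)`. -/
def deltaHat (e : Covariate p → ℝ) (A : LearningAlgorithm p) (π0 : Policy p) (B : ℕ)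
    (Z : ℕ → Ω → Record p) (T : ℕ) (ω : Ω) : ℝ :=
  ∑ t ∈ Finset.Icc 1 (T - 1), deltaHatStep e A π0 B Z T t ω

/-- `Γ̂_j(T) = ∑_{t=1}^{j-1} Γ̂_{tj} / (T - t)`. -/
def gammaJ (e : Covariate p → ℝ) (A : LearningAlgorithm p) (π0 : Policy p) (B : ℕ)
    (Z : ℕ → Ω → Record p) (T j : ℕ) (ω : Ω) : ℝ :=
  ∑ t ∈ Finset.Icc 1 (j - 1), (1 / ((T : ℝ) - (t : ℝ))) * gammaTJ e A π0 B Z t j ω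

/-- The random variable `v_T`, the square root of `T ∑_{j=2}^T Var(Γ̂_j(T) ∣ H_{j-1})`. -/
def asympSD [MeasurableSpace Ω] (μ : Measure Ω) (e : Covariate p → ℝ)
    (A : LearningAlgorithm p) (π0 : Policy p) (B : ℕ) (Z : ℕ → Ω → Record p) (T : ℕ)
    (ω : Ω) : ℝ :=
  Real.sqrt ((T : ℝ) * ∑ j ∈ Finset.Icc 2 T,
    condVar (history B Z (j - 1)) (gammaJ e A π0 B Z T j) μ ω)

/-- Stabilization: `t^{1+δ} Q_t ≤ K₀` almost surely for all `t ≥ R₁`, where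
`Q_t = 𝔼_X |π̂_t(X) - π̂_{t-1}(X)|`. -/
def Stabilizes [MeasurableSpace Ω] (P : Measure (Record p)) (μ : Measure Ω)
    (π : ℕ → Ω → Policy p) : Prop :=
  ∃ δ : ℝ, 0 < δ ∧ ∃ R₁ : ℕ, 0 < R₁ ∧ ∃ K₀ : ℝ, 0 < K₀ ∧ ∀ t : ℕ, R₁ ≤ t →
    ∀ᵐ ω ∂μ, (t : ℝ) ^ (1 + δ) * policyDist P (π t ω) (π (t - 1) ω) ≤ K₀

/-- The (random) limit policy has an `L¹` distance to the baseline policy that is almost surely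
larger than a positive constant. That the limit policy exists almost surely is a consequence of
stabilization; it is unique up to null sets of the covariate distribution. -/
def LimitDiffers [MeasurableSpace Ω] (P : Measure (Record p)) (μ : Measure Ω)
    (π0 : Policy p) (π : ℕ → Ω → Policy p) : Prop :=
  ∃ M₁ : ℝ, 0 < M₁ ∧ ∀ᵐ ω ∂μ, ∀ πlim : Policy p,
    IsLimitPolicy P (fun t => π t ω) πlim → M₁ < policyDist P π0 πlim

end

end Cram

open MeasureTheory ProbabilityTheory Filter Topology

namespace Cram

/-! ### Harmonic sums and summation by parts. -/

noncomputable section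

/-! Exchanging the two sums writes the estimator as `∑_j Γ̂_j(T)`, where the units of batch `j`
carry the weight function `w_j = ∑_{t<j} (π̂_t - π̂_{t-1})/(T - t)`. It is known before batch `j` is
drawn, so the centred terms are martingale differences. The weights add up to `π̂_{T-1} - π_0`
(`sum_weight`) and IPW outcomes have the right mean (`valueDiff_eq_ipwMean`). Hence the numerator is
a normalized sum of centred outcomes with weights `T w_j`, minus the last step `√T Δ(π̂_T;
π̂_{T-1})`, which stabilization makes `O(T^{-δ/2})` (`Design.numerator_eq`,
`Design.abs_last_step_le`).

No martingale central limit theorem is needed, because stabilization almost freezes the weights.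
Since `T/(T - t) = 1 + t/(T - t)`, the weight `T w_j` is `π̂_{j-1} - π_0` plus a remainder that is
small in mean square, averaged over `j`. For fixed `J`, replace `T w_j` by `1_{j>J} (π̂_J - π_0)`.
The averaged squared distance is at most `distBound`, which tends to `2 * tailRate K δ J` as `T → ∞`
(`sum_integral_sq_le_distBound`), and this vanishes as `J → ∞`. By orthogonality
(`integral_sum_centered_sq`) the same distance controls the error in the numerator, and it controls
the gap between `v_T²` and the variance `σ_J²` that belongs to the frozen weight
(`Design.abs_variance_sub_le`).

Given the first `J` batches, the frozen sum is a sum of i.i.d. terms. The classical theorem applies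
conditionally, and its limit does not depend on the conditioning, so it holds unconditionally by
dominated convergence (`tendsto_charFun_standardizedSum`). Dividing is harmless: `σ_J²` is bounded
below because the limit policy is far from the baseline and the outcomes have conditional variance
bounded below (`exists_le_ipwVar`, `Design.le_ipwVar_gap`). Finally, characteristic functions are
Lipschitz in `L¹` distance, so `J` is chosen large first and then `T`
(`Design.tendsto_charFun_studentized`). -/

/-- The partial sums of the harmonic series, as real numbers. -/
def harm (T : ℕ) : ℝ := (harmonic T : ℝ)

lemma harm_eq (T : ℕ) : harm T = ∑ k ∈ Finset.Icc 1 T, 1 / (k : ℝ) := by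
  simp [harm, harmonic_eq_sum_Icc]

lemma harm_nonneg (T : ℕ) : 0 ≤ harm T := by
  rw [harm_eq]; exact Finset.sum_nonneg fun _ _ => by positivity

lemma harm_le (T : ℕ) : harm T ≤ 1 + Real.log T := harmonic_le_one_add_log T

lemma sum_inv_sub (T : ℕ) : ∑ t ∈ Finset.Icc 1 (T - 1), 1 / ((T : ℝ) - t) ≤ harm T := by
  rw [harm_eq]
  calc ∑ t ∈ Finset.Icc 1 (T - 1), 1 / ((T : ℝ) - t)
      = ∑ k ∈ Finset.Icc 1 (T - 1), 1 / (k : ℝ) := by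
        refine Finset.sum_nbij' (fun t => T - t) (fun t => T - t) ?_ ?_ ?_ ?_ ?_
        · intro t ht; simp only [Finset.mem_Icc] at *; omega
        · intro t ht; simp only [Finset.mem_Icc] at *; omega
        · intro t ht; simp only [Finset.mem_Icc] at *; omega
        · intro t ht; simp only [Finset.mem_Icc] at *; omega
        · intro t ht
          simp only [Finset.mem_Icc] at ht
          rw [Nat.cast_sub (by omega)]
    _ ≤ _ := Finset.sum_le_sum_of_subset_of_nonneg
        (Finset.Icc_subset_Icc_right (Nat.sub_le _ _)) fun _ _ _ => by positivity

lemma sum_inv_sub_add_one (T : ℕ) :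
    ∑ j ∈ Finset.Icc 1 T, 1 / ((T : ℝ) - j + 1) = harm T := by
  rw [harm_eq]
  refine Finset.sum_nbij' (fun t => T + 1 - t) (fun t => T + 1 - t) ?_ ?_ ?_ ?_ ?_
  · intro t ht; simp only [Finset.mem_Icc] at *; omega
  · intro t ht; simp only [Finset.mem_Icc] at *; omega
  · intro t ht; simp only [Finset.mem_Icc] at *; omega
  · intro t ht; simp only [Finset.mem_Icc] at *; omega
  · intro t ht
    simp only [Finset.mem_Icc] at ht
    rw [Nat.cast_sub (by omega)]
    push_cast; ring

/-- `∑_{t<T} t^{-δ}/(T-t)` is of order `T^{-δ} log T`. -/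
lemma sum_rpow_div_sub_le {δ : ℝ} (hδ1 : δ ≤ 1) {T : ℕ} (hT : 1 ≤ T) :
    ∑ t ∈ Finset.Icc 1 (T - 1), (t : ℝ) ^ (-δ) / ((T : ℝ) - t)
      ≤ 2 * (T : ℝ) ^ (-δ) * harm T := by
  have hT0 : (0 : ℝ) < T := by exact_mod_cast hT
  -- Partial fractions `T / (t (T - t)) = 1/t + 1/(T - t)`, after `t^{1-δ} ≤ T^{1-δ}`; the latter is
  -- where `δ ≤ 1` enters.
  have key : ∀ t ∈ Finset.Icc 1 (T - 1), (t : ℝ) ^ (-δ) / ((T : ℝ) - t)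
      ≤ (T : ℝ) ^ (-δ) * (1 / (t : ℝ) + 1 / ((T : ℝ) - t)) := by
    intro t ht
    simp only [Finset.mem_Icc] at ht
    have h0 : (0 : ℝ) < t := by exact_mod_cast ht.1
    have h1 : (t : ℝ) < T := by exact_mod_cast (by omega : t < T)
    have h2 : (0 : ℝ) < T - t := by linarith
    have h3 : (t : ℝ) ^ (1 - δ) ≤ (T : ℝ) ^ (1 - δ) :=
      Real.rpow_le_rpow h0.le h1.le (by linarith)
    have e1 : (t : ℝ) ^ (-δ) = (t : ℝ) ^ (1 - δ) / t := by
      rw [show -δ = (1 - δ) - 1 by ring, Real.rpow_sub_one h0.ne']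
    have e2 : (T : ℝ) ^ (-δ) = (T : ℝ) ^ (1 - δ) / T := by
      rw [show -δ = (1 - δ) - 1 by ring, Real.rpow_sub_one hT0.ne']
    rw [e1, e2]
    calc (t : ℝ) ^ (1 - δ) / t / ((T : ℝ) - t) ≤ (T : ℝ) ^ (1 - δ) / t / ((T : ℝ) - t) := by
          gcongr
      _ = _ := by field_simp; ring
  calc _ ≤ ∑ t ∈ Finset.Icc 1 (T - 1), (T : ℝ) ^ (-δ) * (1 / (t : ℝ) + 1 / ((T : ℝ) - t)) :=
        Finset.sum_le_sum key
    _ = (T : ℝ) ^ (-δ) * (∑ t ∈ Finset.Icc 1 (T - 1), 1 / (t : ℝ)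
          + ∑ t ∈ Finset.Icc 1 (T - 1), 1 / ((T : ℝ) - t)) := by
        rw [← Finset.mul_sum, Finset.sum_add_distrib]
    _ ≤ (T : ℝ) ^ (-δ) * (harm T + harm T) := by
        gcongr
        · rw [harm_eq]
          exact Finset.sum_le_sum_of_subset_of_nonneg
            (Finset.Icc_subset_Icc_right (Nat.sub_le _ _)) fun _ _ _ => by positivity
        · exact sum_inv_sub T
    _ = _ := by ring

/-- Summation by parts with increasing weights. -/
lemma abs_sum_mul_sub_le {b p : ℕ → ℝ} {n : ℕ} (hb0 : b 0 = 0)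
    (hb : ∀ t < n, b t ≤ b (t + 1)) (hp : ∀ t, p t ∈ Set.Icc (0 : ℝ) 1) :
    |∑ t ∈ Finset.Icc 1 n, b t * (p t - p (t - 1))| ≤ 2 * b n := by
  -- Passing from `m` to `m + 1` changes the quantity inside the absolute value by `-(b (m + 1) - b
  -- m) * p m`, at most the increment of `b`.
  have key : ∀ m ≤ n, 0 ≤ b m ∧
      |∑ t ∈ Finset.Icc 1 m, b t * (p t - p (t - 1)) - b m * p m| ≤ b m := by
    intro m
    induction m with
    | zero => intro _; simp [hb0]
    | succ m ih =>
      intro hm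
      obtain ⟨h0, h1⟩ := ih (by omega)
      have h2 := hb m (by omega)
      refine ⟨h0.trans h2, ?_⟩
      rw [Finset.sum_Icc_succ_top (by omega), Nat.add_sub_cancel]
      obtain ⟨hp0, hp1⟩ := hp m
      rw [abs_le] at h1 ⊢
      constructor <;> nlinarith
  obtain ⟨h0, h1⟩ := key n le_rfl
  obtain ⟨hp0, hp1⟩ := hp n
  rw [abs_le] at h1 ⊢
  constructor <;> nlinarith

/-! ### Weights of the batches, pointwise in the covariate. -/

/-- The weight `∑_{t<j} (p_t - p_{t-1}) / (T - t)` of the batch `j`. -/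
def weight (q : ℕ → ℝ) (T j : ℕ) : ℝ :=
  ∑ t ∈ Finset.Icc 1 (j - 1), (1 / ((T : ℝ) - t)) * (q t - q (t - 1))

/-- The difference of the rescaled weight and of `p_{j-1} - p_0`. -/
def weightRem (q : ℕ → ℝ) (T j : ℕ) : ℝ :=
  ∑ t ∈ Finset.Icc 1 (j - 1), ((t : ℝ) / ((T : ℝ) - t)) * (q t - q (t - 1))

lemma sum_Icc_sub (q : ℕ → ℝ) (n : ℕ) : ∑ t ∈ Finset.Icc 1 n, (q t - q (t - 1)) = q n - q 0 := by
  induction n with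
  | zero => simp
  | succ n ih => rw [Finset.sum_Icc_succ_top (by omega), ih]; simp

/-- From `T/(T - t) = 1 + t/(T - t)`; the constant part telescopes. -/
lemma mul_weight (q : ℕ → ℝ) {T j : ℕ} (hj : 1 ≤ j) (hjT : j ≤ T) :
    (T : ℝ) * weight q T j = weightRem q T j + (q (j - 1) - q 0) := by
  rw [← sum_Icc_sub, weight, weightRem, Finset.mul_sum, ← Finset.sum_add_distrib]
  refine Finset.sum_congr rfl fun t ht => ?_
  simp only [Finset.mem_Icc] at ht
  have h1 : (t : ℝ) < T := by exact_mod_cast (by omega : t < T)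
  have h2 : (T : ℝ) - t ≠ 0 := by linarith
  field_simp
  ring

/-- The step at time `t` is evaluated on the `T - t` later batches with weight `1/(T - t)` each, so
it counts exactly once. The step at time `T` has no later batch, whence `T - 1`. -/
lemma sum_weight (q : ℕ → ℝ) (T : ℕ) :
    ∑ j ∈ Finset.Icc 1 T, weight q T j = q (T - 1) - q 0 := by
  rw [← sum_Icc_sub]
  simp only [weight]
  rw [Finset.sum_comm' (t' := Finset.Icc 1 (T - 1)) (s' := fun t => Finset.Icc (t + 1) T)]
  · refine Finset.sum_congr rfl fun t ht => ?_
    simp only [Finset.mem_Icc] at ht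
    have h1 : (t : ℝ) < T := by exact_mod_cast (by omega : t < T)
    have h2 : (T : ℝ) - t ≠ 0 := by linarith
    rw [Finset.sum_const, Nat.card_Icc, nsmul_eq_mul,
      show T + 1 - (t + 1) = T - t by omega, Nat.cast_sub (by omega)]
    field_simp
  · intro j t; simp only [Finset.mem_Icc]; omega

/-- The coefficients `t/(T - t)` increase in `t`, so summation by parts leaves twice the largest
one, at `t = j - 1`. No stabilization is used here. -/
lemma abs_weightRem_le {q : ℕ → ℝ} (hq : ∀ t, q t ∈ Set.Icc (0 : ℝ) 1) {T j : ℕ} (hj : 1 ≤ j)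
    (hjT : j ≤ T) : |weightRem q T j| ≤ 2 * T * (1 / ((T : ℝ) - j + 1)) := by
  have h := abs_sum_mul_sub_le (b := fun t => (t : ℝ) / ((T : ℝ) - t)) (p := q) (n := j - 1)
    (by simp) (fun t ht => by
      have h1 : ((t + 1 : ℕ) : ℝ) < T := by exact_mod_cast (by omega : t + 1 < T)
      push_cast at h1 ⊢
      rw [div_le_div_iff₀ (by linarith) (by linarith)]
      have : (0 : ℝ) ≤ t := by positivity
      nlinarith) hq
  refine h.trans ?_
  have h1 : (j : ℝ) ≤ T := by exact_mod_cast hjT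
  rw [Nat.cast_sub hj]
  push_cast
  rw [show (T : ℝ) - (j - 1) = T - j + 1 by ring, mul_assoc, mul_one_div]
  gcongr
  linarith

/-! ### The tail of the stabilization rate and the resulting error bound. -/

/-- The tail of the stabilization rate. -/
def tailRate (K δ : ℝ) (J : ℕ) : ℝ := ∑' t : ℕ, K * ((t + (J + 1) : ℕ) : ℝ) ^ (-(1 + δ))

lemma summable_rate (K : ℝ) {δ : ℝ} (hδ : 0 < δ) :
    Summable fun t : ℕ => K * (t : ℝ) ^ (-(1 + δ)) :=
  (Real.summable_nat_rpow.2 (by linarith)).mul_left K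

lemma tendsto_tailRate (K : ℝ) {δ : ℝ} : Tendsto (tailRate K δ) atTop (𝓝 0) :=
  (tendsto_sum_nat_add fun t : ℕ => K * (t : ℝ) ^ (-(1 + δ))).comp (tendsto_add_atTop_nat 1)

lemma sum_le_tailRate {K δ : ℝ} (hK : 0 ≤ K) (hδ : 0 < δ) (J n : ℕ) :
    ∑ t ∈ Finset.Icc (J + 1) n, K * (t : ℝ) ^ (-(1 + δ)) ≤ tailRate K δ J := by
  have h := (summable_nat_add_iff (J + 1)).2 (summable_rate K hδ)
  have h2 := h.sum_le_tsum (Finset.range (n - J)) (fun t _ => by positivity)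
  refine le_trans (le_of_eq ?_) h2
  refine Finset.sum_nbij' (fun t => t - (J + 1)) (fun t => t + (J + 1)) ?_ ?_ ?_ ?_ ?_
  · intro t ht; simp only [Finset.mem_Icc, Finset.mem_range] at *; omega
  · intro t ht; simp only [Finset.mem_Icc, Finset.mem_range] at *; omega
  · intro t ht; simp only [Finset.mem_Icc] at *; omega
  · intro t ht; simp only [Finset.mem_range] at *; omega
  · intro t ht
    simp only [Finset.mem_Icc] at ht
    simp only [Nat.sub_add_cancel ht.1]

lemma tailRate_nonneg {K δ : ℝ} (hK : 0 ≤ K) (J : ℕ) : 0 ≤ tailRate K δ J :=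
  tsum_nonneg fun _ => by positivity

/-- The bound on the mean square distance of the rescaled weights to `1_{j>J}(p_J - p_0)`. -/
def distBound (K δ : ℝ) (J T : ℕ) : ℝ :=
  8 * K * ((T : ℝ) ^ (-δ) * harm T ^ 2) + 2 * (tailRate K δ J + J / T)

lemma distBound_nonneg {K δ : ℝ} (hK : 0 ≤ K) (J T : ℕ) : 0 ≤ distBound K δ J T := by
  have := tailRate_nonneg (δ := δ) hK J
  have := harm_nonneg T
  unfold distBound
  positivity

lemma tendsto_rpow_mul_harm_sq {δ : ℝ} (hδ : 0 < δ) :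
    Tendsto (fun T : ℕ => (T : ℝ) ^ (-δ) * harm T ^ 2) atTop (𝓝 0) := by
  have h1 : Tendsto (fun x : ℝ => x ^ (-(δ / 2)) * (1 + Real.log x)) atTop (𝓝 0) := by
    have ha : Tendsto (fun x : ℝ => x ^ (-(δ / 2))) atTop (𝓝 0) :=
      tendsto_rpow_neg_atTop (by linarith)
    have hb : Tendsto (fun x : ℝ => Real.log x / x ^ (δ / 2)) atTop (𝓝 0) :=
      (isLittleO_log_rpow_atTop (by linarith)).tendsto_div_nhds_zero
    refine (show (0 : ℝ) + 0 = 0 by simp) ▸ (ha.add hb).congr' ?_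
    filter_upwards [eventually_gt_atTop 0] with x hx
    rw [Real.rpow_neg hx.le]; ring
  have h2 := (h1.comp tendsto_natCast_atTop_atTop).pow 2
  rw [zero_pow two_ne_zero] at h2
  refine squeeze_zero (fun T => mul_nonneg (by positivity) (sq_nonneg _)) (fun T => ?_) h2
  have h3 : ((T : ℝ) ^ (-(δ / 2))) ^ 2 = (T : ℝ) ^ (-δ) := by
    rw [← Real.rpow_natCast, ← Real.rpow_mul (by positivity)]; congr 1; push_cast; ring
  simp only [Function.comp, mul_pow, h3]
  gcongr
  · exact harm_nonneg T
  · exact harm_le T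

lemma tendsto_distBound (K : ℝ) {δ : ℝ} (hδ : 0 < δ) (J : ℕ) :
    Tendsto (distBound K δ J) atTop (𝓝 (2 * tailRate K δ J)) := by
  have h := ((tendsto_rpow_mul_harm_sq hδ).const_mul (8 * K)).add
    (((tendsto_const_nhds (x := tailRate K δ J)).add
      (tendsto_const_div_atTop_nhds_zero_nat (J : ℝ))).const_mul 2)
  simp only [mul_zero, add_zero, zero_add] at h
  exact h

/-! ### Stable sequences of policies: mean square error of the weights, and the limit policy. -/

section Policies

variable {𝓧 : Type*} [MeasurableSpace 𝓧] {ν : Measure 𝓧} [IsProbabilityMeasure ν]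
  {q : ℕ → 𝓧 → ℝ} {K δ : ℝ}

lemma integrable_of_bounded {f : 𝓧 → ℝ} (hf : Measurable f) (C : ℝ) (h : ∀ x, |f x| ≤ C) :
    Integrable f ν :=
  Integrable.of_bound hf.aestronglyMeasurable C (ae_of_all _ h)

lemma abs_sub_le_one {a b : ℝ} (ha : a ∈ Set.Icc (0 : ℝ) 1) (hb : b ∈ Set.Icc (0 : ℝ) 1) :
    |a - b| ≤ 1 := by
  rw [abs_le]; constructor <;> linarith [ha.1, ha.2, hb.1, hb.2]

lemma measurable_weightRem (hqm : ∀ t, Measurable (q t)) (T j : ℕ) :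
    Measurable fun x => weightRem (fun t => q t x) T j := by
  unfold weightRem; fun_prop

lemma integrable_abs_sub (hqm : ∀ t, Measurable (q t)) (hq : ∀ t x, q t x ∈ Set.Icc (0 : ℝ) 1)
    (s t : ℕ) : Integrable (fun x => |q s x - q t x|) ν :=
  integrable_of_bounded (by fun_prop) 1 fun x => by
    rw [abs_abs]; exact abs_sub_le_one (hq s x) (hq t x)

/-- The distance of the policies at times `J ≤ n`. -/
lemma integral_abs_sub_le_tailRate (hqm : ∀ t, Measurable (q t))
    (hq : ∀ t x, q t x ∈ Set.Icc (0 : ℝ) 1) (hK : 0 ≤ K) (hδ : 0 < δ)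
    (hstab : ∀ t, 1 ≤ t → ∫ x, |q t x - q (t - 1) x| ∂ν ≤ K * (t : ℝ) ^ (-(1 + δ)))
    {J n : ℕ} (hJn : J ≤ n) : ∫ x, |q n x - q J x| ∂ν ≤ tailRate K δ J := by
  refine le_trans ?_ (sum_le_tailRate hK hδ J n)
  induction n, hJn using Nat.le_induction with
  | base => simp
  | succ n hn ih =>
    rw [Finset.sum_Icc_succ_top (by omega)]
    calc ∫ x, |q (n + 1) x - q J x| ∂ν
        ≤ ∫ x, (|q n x - q J x| + |q (n + 1) x - q n x|) ∂ν := by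
          refine integral_mono (integrable_abs_sub hqm hq _ _)
            ((integrable_abs_sub hqm hq _ _).add (integrable_abs_sub hqm hq _ _)) fun x => ?_
          have := abs_sub_le (q (n + 1) x) (q n x) (q J x)
          simp only; linarith
      _ = ∫ x, |q n x - q J x| ∂ν + ∫ x, |q (n + 1) x - q n x| ∂ν :=
          integral_add (integrable_abs_sub hqm hq _ _) (integrable_abs_sub hqm hq _ _)
      _ ≤ _ := add_le_add ih (by simpa using hstab (n + 1) (by omega))

/-- Interpolation: the square integral is at most the sup norm times the `L¹` norm. The sup norm
comes from `abs_weightRem_le`, the `L¹` norm from stabilization. The sup bound is of order `T` for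
`j` near `T`, but summed over `j` it only yields a harmonic number. -/
lemma integral_weightRem_sq_le (hqm : ∀ t, Measurable (q t))
    (hq : ∀ t x, q t x ∈ Set.Icc (0 : ℝ) 1) (hK : 0 ≤ K) (hδ1 : δ ≤ 1)
    (hstab : ∀ t, 1 ≤ t → ∫ x, |q t x - q (t - 1) x| ∂ν ≤ K * (t : ℝ) ^ (-(1 + δ)))
    {T j : ℕ} (hj : 1 ≤ j) (hjT : j ≤ T) :
    ∫ x, weightRem (fun t => q t x) T j ^ 2 ∂ν
      ≤ 2 * T * (1 / ((T : ℝ) - j + 1)) * (K * (2 * (T : ℝ) ^ (-δ) * harm T)) := by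
  have hjT' : (j : ℝ) ≤ T := by exact_mod_cast hjT
  set c : ℝ := 2 * T * (1 / ((T : ℝ) - j + 1)) with hc
  have hc0 : 0 ≤ c := by
    have : 0 < (T : ℝ) - j + 1 := by linarith
    positivity
  have hb : ∀ x, |weightRem (fun t => q t x) T j| ≤ c := fun x =>
    abs_weightRem_le (fun t => hq t x) hj hjT
  have hm := measurable_weightRem hqm T j
  have hint : ∀ t ∈ Finset.Icc 1 (j - 1),
      Integrable (fun x => (t : ℝ) / ((T : ℝ) - t) * |q t x - q (t - 1) x|) ν :=
    fun t _ => (integrable_abs_sub hqm hq _ _).const_mul _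
  have hpos : ∀ t ∈ Finset.Icc 1 (T - 1), 0 < (t : ℝ) ∧ 0 < (T : ℝ) - t := by
    intro t ht
    simp only [Finset.mem_Icc] at ht
    refine ⟨by exact_mod_cast ht.1, ?_⟩
    have h1 : (t : ℝ) < T := by exact_mod_cast (by omega : t < T)
    linarith
  have hsub : Finset.Icc 1 (j - 1) ⊆ Finset.Icc 1 (T - 1) :=
    Finset.Icc_subset_Icc_right (by omega)
  calc ∫ x, weightRem (fun t => q t x) T j ^ 2 ∂ν
      ≤ ∫ x, c * ∑ t ∈ Finset.Icc 1 (j - 1),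
          (t : ℝ) / ((T : ℝ) - t) * |q t x - q (t - 1) x| ∂ν := by
        refine integral_mono ?_ ((integrable_finsetSum _ hint).const_mul c) fun x => ?_
        · refine integrable_of_bounded (by fun_prop) (c ^ 2) fun x => ?_
          rw [abs_pow]; exact pow_le_pow_left₀ (abs_nonneg _) (hb x) 2
        · simp only
          rw [← sq_abs, sq]
          refine mul_le_mul (hb x) ?_ (abs_nonneg _) hc0
          refine (Finset.abs_sum_le_sum_abs _ _).trans (Finset.sum_le_sum fun t ht => ?_)
          obtain ⟨h1, h2⟩ := hpos t (hsub ht)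
          rw [abs_mul, abs_of_nonneg (by positivity)]
    _ = c * ∑ t ∈ Finset.Icc 1 (j - 1), (t : ℝ) / ((T : ℝ) - t) *
          ∫ x, |q t x - q (t - 1) x| ∂ν := by
        rw [integral_const_mul, integral_finsetSum _ hint]
        simp_rw [integral_const_mul]
    _ ≤ c * ∑ t ∈ Finset.Icc 1 (T - 1), K * ((t : ℝ) ^ (-δ) / ((T : ℝ) - t)) := by
        gcongr
        refine (Finset.sum_le_sum fun t ht => ?_).trans
          (Finset.sum_le_sum_of_subset_of_nonneg hsub fun t ht _ => ?_)
        · obtain ⟨h1, h2⟩ := hpos t (hsub ht)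
          simp only [Finset.mem_Icc] at ht
          calc (t : ℝ) / ((T : ℝ) - t) * ∫ x, |q t x - q (t - 1) x| ∂ν
              ≤ (t : ℝ) / ((T : ℝ) - t) * (K * (t : ℝ) ^ (-(1 + δ))) := by
                gcongr; exact hstab t ht.1
            _ = K * ((t : ℝ) ^ (-δ) / ((T : ℝ) - t)) := by
                rw [show -(1 + δ) = -δ - 1 by ring, Real.rpow_sub_one h1.ne']
                field_simp
        · obtain ⟨h1, h2⟩ := hpos t ht
          positivity
    _ ≤ _ := by
        rw [← Finset.mul_sum]
        gcongr
        exact sum_rpow_div_sub_le hδ1 (by omega)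

/-- The reference weight `1_{j>J} (p_J - p_0)`. -/
def refWeight (q : ℕ → ℝ) (J j : ℕ) : ℝ := if J < j then q J - q 0 else 0

lemma abs_refWeight_le {q : ℕ → ℝ} (hq : ∀ t, q t ∈ Set.Icc (0 : ℝ) 1) (J j : ℕ) :
    |refWeight q J j| ≤ 1 := by
  unfold refWeight; split_ifs
  · exact abs_sub_le_one (hq _) (hq _)
  · simp

lemma measurable_refWeight (hqm : ∀ t, Measurable (q t)) (J j : ℕ) :
    Measurable fun x => refWeight (fun t => q t x) J j := by
  unfold refWeight; split_ifs <;> fun_prop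

lemma sum_ite_le_le (T J : ℕ) : ∑ j ∈ Finset.Icc 1 T, (if j ≤ J then (1 : ℝ) else 0) ≤ J := by
  rw [Finset.sum_ite, Finset.sum_const_zero, add_zero, Finset.sum_const, nsmul_eq_mul, mul_one]
  have : (Finset.Icc 1 T).filter (· ≤ J) ⊆ Finset.Icc 1 J := by
    intro j; simp only [Finset.mem_filter, Finset.mem_Icc]; omega
  exact_mod_cast (Finset.card_le_card this).trans (by simp)

/-- Use `(a + b)² ≤ 2a² + 2b²` with `a` the remainder of `mul_weight` and `b = (q (j - 1) - q 0) -
refWeight`. Since `|b| ≤ 1`, its square is at most `|b|`. For `j > J` this is `|q (j - 1) - q J|`,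
controlled by the tail of the rate; for the at most `J` other batches it is at most one. -/
theorem sum_integral_sq_le_distBound (hqm : ∀ t, Measurable (q t))
    (hq : ∀ t x, q t x ∈ Set.Icc (0 : ℝ) 1) (hK : 0 ≤ K) (hδ : 0 < δ) (hδ1 : δ ≤ 1)
    (hstab : ∀ t, 1 ≤ t → ∫ x, |q t x - q (t - 1) x| ∂ν ≤ K * (t : ℝ) ^ (-(1 + δ)))
    {T : ℕ} (hT : 1 ≤ T) (J : ℕ) :
    (1 / (T : ℝ)) * ∑ j ∈ Finset.Icc 1 T,
      ∫ x, (T * weight (fun t => q t x) T j - refWeight (fun t => q t x) J j) ^ 2 ∂ν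
      ≤ distBound K δ J T := by
  have hT0 : (0 : ℝ) < T := by exact_mod_cast hT
  set ρ : ℝ := K * (2 * (T : ℝ) ^ (-δ) * harm T) with hρ
  have hmain : ∀ j ∈ Finset.Icc 1 T,
      ∫ x, (T * weight (fun t => q t x) T j - refWeight (fun t => q t x) J j) ^ 2 ∂ν
        ≤ 2 * (2 * T * ρ * (1 / ((T : ℝ) - j + 1)))
          + 2 * (tailRate K δ J + if j ≤ J then 1 else 0) := by
    intro j hj
    simp only [Finset.mem_Icc] at hj
    obtain ⟨hj1, hjT⟩ := hj
    have hR := integral_weightRem_sq_le hqm hq hK hδ1 hstab hj1 hjT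
    have hmR := measurable_weightRem hqm T j
    have hmr := measurable_refWeight hqm J j
    have hiR : Integrable (fun x => 2 * weightRem (fun t => q t x) T j ^ 2) ν :=
      (integrable_of_bounded (by fun_prop) ((2 * T * (1 / ((T : ℝ) - j + 1))) ^ 2) fun x => by
        rw [abs_pow]
        exact pow_le_pow_left₀ (abs_nonneg _) (abs_weightRem_le (fun t => hq t x) hj1 hjT) 2
        ).const_mul 2
    have hbr : ∀ x, |q (j - 1) x - q 0 x - refWeight (fun t => q t x) J j| ≤ 1 := fun x => by
      unfold refWeight
      split_ifs
      · rw [sub_sub_sub_cancel_right]; exact abs_sub_le_one (hq _ _) (hq _ _)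
      · rw [sub_zero]; exact abs_sub_le_one (hq _ _) (hq _ _)
    have hi2 : Integrable (fun x =>
        2 * (q (j - 1) x - q 0 x - refWeight (fun t => q t x) J j) ^ 2) ν :=
      (integrable_of_bounded (by fun_prop) 1 fun x => by
        rw [abs_pow]; exact pow_le_one₀ (abs_nonneg _) (hbr x)).const_mul 2
    have h2 : ∫ x, (q (j - 1) x - q 0 x - refWeight (fun t => q t x) J j) ^ 2 ∂ν
        ≤ tailRate K δ J + if j ≤ J then 1 else 0 := by
      have hsq : ∀ x, (q (j - 1) x - q 0 x - refWeight (fun t => q t x) J j) ^ 2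
          ≤ |q (j - 1) x - q 0 x - refWeight (fun t => q t x) J j| := fun x => by
        rw [← sq_abs, sq]
        exact mul_le_of_le_one_left (abs_nonneg _) (hbr x)
      have hia : Integrable (fun x => |q (j - 1) x - q 0 x - refWeight (fun t => q t x) J j|) ν :=
        integrable_of_bounded (by fun_prop) 1 fun x => by rw [abs_abs]; exact hbr x
      refine (integral_mono ((hi2.const_mul (1 / 2)).congr (ae_of_all _ fun x => ?_)) hia
        hsq).trans ?_
      · simp only; ring
      · split_ifs with h
        · have h3 : ∫ x, |q (j - 1) x - q 0 x - refWeight (fun t => q t x) J j| ∂ν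
              ≤ ∫ _, (1 : ℝ) ∂ν := integral_mono hia (integrable_const _) hbr
          have := tailRate_nonneg (δ := δ) hK J
          simp only [integral_const, probReal_univ, smul_eq_mul, mul_one] at h3
          linarith
        · rw [add_zero]
          refine le_trans (le_of_eq ?_)
            (integral_abs_sub_le_tailRate hqm hq hK hδ hstab (show J ≤ j - 1 by omega))
          refine integral_congr_ae (ae_of_all _ fun x => ?_)
          simp only [refWeight, if_pos (show J < j by omega), sub_sub_sub_cancel_right]
    calc _ ≤ ∫ x, (2 * weightRem (fun t => q t x) T j ^ 2
            + 2 * (q (j - 1) x - q 0 x - refWeight (fun t => q t x) J j) ^ 2) ∂ν := by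
          refine integral_mono_of_nonneg (ae_of_all _ fun x => sq_nonneg _) (hiR.add hi2)
            (ae_of_all _ fun x => ?_)
          simp only
          rw [mul_weight _ hj1 hjT]
          nlinarith [sq_nonneg (weightRem (fun t => q t x) T j
            - (q (j - 1) x - q 0 x - refWeight (fun t => q t x) J j))]
      _ = 2 * ∫ x, weightRem (fun t => q t x) T j ^ 2 ∂ν
            + 2 * ∫ x, (q (j - 1) x - q 0 x - refWeight (fun t => q t x) J j) ^ 2 ∂ν := by
          rw [integral_add hiR hi2, integral_const_mul, integral_const_mul]
      _ ≤ _ := by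
          gcongr
          exact hR.trans (le_of_eq (by rw [hρ]; ring))
  have hcount := sum_ite_le_le T J
  calc _ ≤ (1 / (T : ℝ)) * ∑ j ∈ Finset.Icc 1 T, (2 * (2 * T * ρ * (1 / ((T : ℝ) - j + 1)))
          + 2 * (tailRate K δ J + if j ≤ J then 1 else 0)) := by
        gcongr with j hj; exact hmain j hj
    _ = (1 / (T : ℝ)) * (4 * T * ρ * harm T + 2 * (T * tailRate K δ J
          + ∑ j ∈ Finset.Icc 1 T, (if j ≤ J then (1 : ℝ) else 0))) := by
        rw [Finset.sum_add_distrib, ← Finset.mul_sum, ← Finset.mul_sum, ← Finset.mul_sum,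
          sum_inv_sub_add_one, Finset.sum_add_distrib, Finset.sum_const, Nat.card_Icc,
          nsmul_eq_mul, Nat.add_sub_cancel]
        ring
    _ ≤ (1 / (T : ℝ)) * (4 * T * ρ * harm T + 2 * (T * tailRate K δ J + J)) := by gcongr
    _ = distBound K δ J T := by
        rw [hρ, distBound]; field_simp; ring

/-- A sequence of policies with summable increments has a limit policy. -/
theorem exists_limit (hqm : ∀ t, Measurable (q t))
    (hq : ∀ t x, q t x ∈ Set.Icc (0 : ℝ) 1) (hδ : 0 < δ)
    (hstab : ∀ t, 1 ≤ t → ∫ x, |q t x - q (t - 1) x| ∂ν ≤ K * (t : ℝ) ^ (-(1 + δ))) :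
    ∃ f : 𝓧 → ℝ, Measurable f ∧ (∀ x, f x ∈ Set.Icc (0 : ℝ) 1) ∧
      Tendsto (fun t => ∫ x, |f x - q t x| ∂ν) atTop (𝓝 0) := by
  -- The `L¹` norms of the increments are summable, so the increments are absolutely summable at
  -- almost every point.
  have hae : ∀ᵐ x ∂ν, ∃ l, Tendsto (fun t => q t x) atTop (𝓝 l) := by
    have hsum : Summable fun t : ℕ => ∫ x, ‖q (t + 1) x - q t x‖ ∂ν := by
      refine Summable.of_nonneg_of_le (fun t => integral_nonneg fun x => norm_nonneg _)
        (fun t => ?_) ((summable_nat_add_iff 1).2 (summable_rate K hδ))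
      simpa using hstab (t + 1) (by omega)
    have h2 : ∑' t, ∫⁻ x, ‖q (t + 1) x - q t x‖ₑ ∂ν ≠ ⊤ := by
      have : ∀ t, ∫⁻ x, ‖q (t + 1) x - q t x‖ₑ ∂ν
          = ENNReal.ofReal (∫ x, ‖q (t + 1) x - q t x‖ ∂ν) := fun t => by
        rw [ofReal_integral_norm_eq_lintegral_enorm]
        exact integrable_of_bounded (by fun_prop) 1 fun x => abs_sub_le_one (hq _ _) (hq _ _)
      simp_rw [this]
      exact hsum.tsum_ofReal_ne_top
    rw [← lintegral_tsum (fun t => by fun_prop)] at h2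
    filter_upwards [ae_lt_top' (AEMeasurable.tsum fun t => by fun_prop) h2] with x hx
    refine cauchySeq_tendsto_of_complete (cauchySeq_of_summable_dist (f := fun t => q t x) ?_)
    have h3 : Summable fun t => ‖q (t + 1) x - q t x‖₊ := by
      rw [← ENNReal.tsum_coe_ne_top_iff_summable]
      simpa [enorm_eq_nnnorm] using hx.ne
    have h4 : Summable fun t => ‖q (t + 1) x - q t x‖ := NNReal.summable_coe.2 h3
    simpa [Real.dist_eq, abs_sub_comm] using h4
  obtain ⟨g, hg, hgl⟩ := measurable_limit_of_tendsto_metrizable_ae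
    (fun t => (hqm t).aemeasurable) hae
  -- Truncation makes the limit a policy everywhere, also on the null set where `g` is arbitrary.
  refine ⟨fun x => max 0 (min 1 (g x)), by fun_prop, fun x => ⟨le_max_left _ _,
    max_le zero_le_one (min_le_left _ _)⟩, ?_⟩
  have h := tendsto_integral_of_dominated_convergence (μ := ν)
    (F := fun t x => |max 0 (min 1 (g x)) - q t x|) (f := fun _ => 0) (fun _ => (1 : ℝ))
    (fun t => by fun_prop) (integrable_const _)
    (fun t => ae_of_all _ fun x => by
      rw [Real.norm_eq_abs, abs_abs]
      exact abs_sub_le_one ⟨le_max_left _ _, max_le zero_le_one (min_le_left _ _)⟩ (hq t x)) ?_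
  · simpa using h
  · filter_upwards [hgl] with x hx
    have h0 : g x ∈ Set.Icc (0 : ℝ) 1 := isClosed_Icc.mem_of_tendsto hx
      (Eventually.of_forall fun t => hq t x)
    have : max 0 (min 1 (g x)) = g x := by rw [min_eq_right h0.2, max_eq_right h0.1]
    rw [this]
    have h1 := ((tendsto_const_nhds (x := g x)).sub hx).abs
    simpa using h1

end Policies

end

end Cram

namespace Cram

noncomputable section

/-! ### Moments of IPW outcomes under strong ignorability. -/

section Population

variable {p : ℕ} {P : Measure (Record p)} {e : Covariate p → ℝ}

lemma treated_eq_indicator :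
    (fun w : Record p => treated w.2.1)
      = ((fun w : Record p => w.2.1) ⁻¹' {true}).indicator fun _ => (1 : ℝ) := by
  ext w
  cases h : w.2.1 <;> simp [treated, h]

lemma measurable_treated : Measurable treated := measurable_of_countable _

lemma measurable_outcome (d : Bool) : Measurable (outcome (p := p) d) :=
  (measurable_pi_apply d).comp (measurable_snd.comp measurable_snd)

lemma measurable_observe : Measurable (observe (p := p)) := by
  refine measurable_fst.prodMk ((measurable_fst.comp measurable_snd).prodMk ?_)
  have : (fun w : Record p => w.2.2 w.2.1)
      = fun w => if w.2.1 = true then outcome true w else outcome false w := by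
    ext w; cases h : w.2.1 <;> simp [outcome]
  rw [this]
  exact Measurable.ite ((measurable_fst.comp measurable_snd) (measurableSet_singleton true))
    (measurable_outcome true) (measurable_outcome false)

lemma measurable_ipw (he : Measurable e) : Measurable (ipw (p := p) e) := by
  have h1 : Measurable fun z : Obs p => treated z.2.1 :=
    measurable_treated.comp (measurable_fst.comp measurable_snd)
  have h2 : Measurable fun z : Obs p => e z.1 := he.comp measurable_fst
  unfold ipw
  fun_prop

lemma stronglyMeasurable_covSigma {g : Covariate p → ℝ} (hg : Measurable g) :
    StronglyMeasurable[covSigma p] fun w : Record p => g w.1 :=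
  (hg.comp (comap_measurable (Prod.fst : Record p → Covariate p))).stronglyMeasurable

lemma integral_mul_condExp [IsProbabilityMeasure P] {f g : Record p → ℝ} (hf : Integrable f P)
    (hg : StronglyMeasurable[covSigma p] g) (hfg : Integrable (fun w => f w * g w) P) :
    ∫ w, (P[f | covSigma p]) w * g w ∂P = ∫ w, f w * g w ∂P := by
  rw [← integral_condExp (covSigma_le p) (f := fun w => f w * g w)]
  exact integral_congr_ae (condExp_mul_of_stronglyMeasurable_right hg hfg hf).symm

lemma ae_overlap {c : ℝ} (h : ∀ᵐ x ∂(covLaw P), c ≤ e x ∧ e x ≤ 1 - c) :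
    ∀ᵐ w ∂P, c ≤ e w.1 ∧ e w.1 ≤ 1 - c :=
  ae_of_ae_map measurable_fst.aemeasurable h

/-- It suffices to test rectangles `A ×ˢ E`. Given the covariates, the probability of potential
outcomes in `E` together with treatment factors, and the second factor is `e`. As an identity of
measures it transfers to integrals of measurable functions without integrability conditions. -/
lemma map_restrict_treated [IsProbabilityMeasure P] (he : IsPropensityScore P e)
    (hign : StrongIgnorability P e) :
    (P.restrict ((fun w : Record p => w.2.1) ⁻¹' {true})).map (fun w => (w.1, w.2.2))
      = (P.withDensity fun w => ENNReal.ofReal (e w.1)).map (fun w => (w.1, w.2.2)) := by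
  obtain ⟨c, hc, hover⟩ := hign.overlap
  have hov := ae_overlap hover
  have hm : Measurable fun w : Record p => (w.1, w.2.2) := by fun_prop
  have hD : MeasurableSet ((fun w : Record p => w.2.1) ⁻¹' {true}) :=
    (measurable_fst.comp measurable_snd) (measurableSet_singleton true)
  refine Measure.ext_prod fun {A E} hA hE => ?_
  have hA' : MeasurableSet[covSigma p] (Prod.fst ⁻¹' A : Set (Record p)) := ⟨A, hA, rfl⟩
  have hAm : MeasurableSet (Prod.fst ⁻¹' A : Set (Record p)) := measurable_fst hA
  set E' : Set (Record p) := (fun w : Record p => w.2.2) ⁻¹' E with hE'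
  set D' : Set (Record p) := (fun w : Record p => w.2.1) ⁻¹' {true} with hD'
  have hEm : MeasurableSet E' := (measurable_snd.comp measurable_snd) hE
  have hpre : (fun w : Record p => (w.1, w.2.2)) ⁻¹' (A ×ˢ E) = Prod.fst ⁻¹' A ∩ E' := by
    ext w; simp [hE']
  rw [Measure.map_apply hm (hA.prod hE), Measure.map_apply hm (hA.prod hE), hpre,
    Measure.restrict_apply (hAm.inter hEm), withDensity_apply _ (hAm.inter hEm)]
  have hind := (condIndepFun_iff_condExp_inter_preimage_eq_mul
    (measurable_snd.comp measurable_snd) (measurable_fst.comp measurable_snd)).1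
    hign.unconfounded E {true} hE (measurableSet_singleton true)
  have hesm : StronglyMeasurable[covSigma p] fun w : Record p => e w.1 :=
    stronglyMeasurable_covSigma he.1
  have hemeas : Measurable fun w : Record p => e w.1 := he.1.comp measurable_fst
  have hebd : ∀ᵐ w ∂P, ‖e w.1‖ ≤ 1 := by
    filter_upwards [hov] with w hw
    rw [Real.norm_eq_abs, abs_le]; constructor <;> linarith [hw.1, hw.2]
  have hint1 : Integrable (E'.indicator fun _ => (1 : ℝ)) P :=
    (integrable_const 1).indicator hEm
  have hinte : Integrable (fun w => E'.indicator (fun _ => (1 : ℝ)) w * e w.1) P :=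
    hint1.mul_bdd hemeas.aestronglyMeasurable hebd
  have key : ∫ w in Prod.fst ⁻¹' A, (E' ∩ D').indicator (fun _ => (1 : ℝ)) w ∂P
      = ∫ w in Prod.fst ⁻¹' A, E'.indicator (fun _ => (1 : ℝ)) w * e w.1 ∂P := by
    rw [← setIntegral_condExp (covSigma_le p)
        ((integrable_const (1 : ℝ)).indicator (hEm.inter hD)) hA',
      ← setIntegral_condExp (covSigma_le p) hinte hA']
    refine integral_congr_ae (ae_restrict_of_ae ?_)
    have h1 := condExp_mul_of_stronglyMeasurable_right (μ := P) hesm hinte hint1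
    filter_upwards [hind, h1, treated_eq_indicator (p := p) ▸ he.2] with w hw h1w hew
    have h2 : (P[fun w => E'.indicator (fun _ => (1 : ℝ)) w * e w.1 | covSigma p]) w
      = (P[E'.indicator (fun _ => (1 : ℝ)) | covSigma p]) w * e w.1 := h1w
    rw [h2, hew]
    exact hw
  rw [setIntegral_indicator (hEm.inter hD), setIntegral_const, smul_eq_mul, mul_one] at key
  have e1 : ∫ w in Prod.fst ⁻¹' A, E'.indicator (fun _ => (1 : ℝ)) w * e w.1 ∂P
      = ∫ w in Prod.fst ⁻¹' A ∩ E', e w.1 ∂P := by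
    rw [← setIntegral_indicator hEm]
    refine integral_congr_ae (ae_of_all _ fun w => ?_)
    by_cases hw : w ∈ E' <;> simp [hw]
  rw [e1] at key
  rw [← ofReal_integral_eq_lintegral_ofReal
    (Integrable.of_bound hemeas.aestronglyMeasurable 1 (ae_restrict_of_ae hebd))
    (ae_restrict_of_ae (by filter_upwards [hov] with w hw; exact (hc.le.trans hw.1))), ← key,
    measureReal_def, ENNReal.ofReal_toReal (measure_ne_top _ _), Set.inter_assoc]

/-- Under unconfoundedness, the treatment indicator integrates to the propensity score against
functions of the covariates and of the potential outcomes. -/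
lemma integral_mul_treated [IsProbabilityMeasure P] (he : IsPropensityScore P e)
    (hign : StrongIgnorability P e)
    {F : Record p → ℝ} {F' : Covariate p × (Bool → ℝ) → ℝ} (hF' : Measurable F')
    (hF : ∀ w, F w = F' (w.1, w.2.2)) :
    ∫ w, F w * treated w.2.1 ∂P = ∫ w, F w * e w.1 ∂P := by
  obtain ⟨c, hc, hover⟩ := hign.overlap
  have hov := ae_overlap hover
  have hm : Measurable fun w : Record p => (w.1, w.2.2) := by fun_prop
  have hD : MeasurableSet ((fun w : Record p => w.2.1) ⁻¹' {true}) :=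
    (measurable_fst.comp measurable_snd) (measurableSet_singleton true)
  have h1 : ∫ w, F w * treated w.2.1 ∂P
      = ∫ w in (fun w : Record p => w.2.1) ⁻¹' {true}, F' (w.1, w.2.2) ∂P := by
    rw [← integral_indicator hD]
    refine integral_congr_ae (ae_of_all _ fun w => ?_)
    simp only
    rw [hF]
    cases h : w.2.1 <;> simp [treated, h, Set.indicator]
  have hemeas : Measurable fun w : Record p => e w.1 := he.1.comp measurable_fst
  rw [h1, ← integral_map (f := F') hm.aemeasurable hF'.aestronglyMeasurable,
    map_restrict_treated he hign, integral_map hm.aemeasurable hF'.aestronglyMeasurable,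
    integral_withDensity_eq_integral_toReal_smul hemeas.ennreal_ofReal
      (ae_of_all _ fun _ => ENNReal.ofReal_lt_top)]
  refine integral_congr_ae ?_
  filter_upwards [hov] with w hw
  rw [ENNReal.toReal_ofReal (hc.le.trans hw.1), smul_eq_mul, mul_comm, hF]

/-- Trading the observed outcome for potential outcomes leaves the treatment only in the indicator,
the form to which `integral_mul_treated` applies. -/
lemma ipw_observe (w : Record p) :
    ipw e (observe w) = outcome true w / e w.1 * treated w.2.1
      - outcome false w / (1 - e w.1) * (1 - treated w.2.1) := by
  cases h : w.2.1 <;> simp [ipw, observe, treated, outcome, h]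

lemma abs_ipw_le {c : ℝ} (hc : 0 < c) {w : Record p} (hw : c ≤ e w.1 ∧ e w.1 ≤ 1 - c) :
    |ipw e (observe w)| ≤ c⁻¹ * (|outcome true w| + |outcome false w|) := by
  have h1 : 0 < e w.1 := hc.trans_le hw.1
  have h2 : c ≤ 1 - e w.1 := by linarith [hw.2]
  have h3 : 0 < 1 - e w.1 := hc.trans_le h2
  have ha := abs_nonneg (outcome true w)
  have hb := abs_nonneg (outcome false w)
  have hc' : 0 < c⁻¹ := by positivity
  rw [ipw_observe]
  cases h : w.2.1
  · simp only [treated, Bool.false_eq_true, if_false, mul_zero, sub_zero, mul_one, zero_sub,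
      abs_neg, abs_div, abs_of_pos h3]
    rw [div_eq_inv_mul]
    have := inv_anti₀ hc h2
    nlinarith
  · simp only [treated, if_true, mul_one, sub_self, mul_zero, sub_zero, abs_div, abs_of_pos h1]
    rw [div_eq_inv_mul]
    have := inv_anti₀ hc hw.1
    nlinarith

lemma memLp_outcome [IsProbabilityMeasure P] (hmom : FiniteFourthMoments P) (d : Bool) : MemLp
    (outcome d) 2 P :=
  (hmom d).mono_exponent (by norm_num)

lemma memLp_ipw [IsProbabilityMeasure P] (he : IsPropensityScore P e)
    (hign : StrongIgnorability P e)
    (hmom : FiniteFourthMoments P) : MemLp (fun w => ipw e (observe w)) 2 P := by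
  obtain ⟨c, hc, hover⟩ := hign.overlap
  have h1 := ((memLp_outcome hmom true).abs.add (memLp_outcome hmom false).abs).const_mul c⁻¹
  refine h1.of_le ((measurable_ipw he.1).comp measurable_observe).aestronglyMeasurable ?_
  filter_upwards [ae_overlap hover] with w hw
  exact (abs_ipw_le hc hw).trans (le_abs_self _)

/-- The mean of `ipw * g`. -/
def ipwMean (P : Measure (Record p)) (e : Covariate p → ℝ) (g : Covariate p → ℝ) : ℝ :=
  ∫ w, ipw e (observe w) * g w.1 ∂P

/-- The variance of `ipw * g`. -/
def ipwVar (P : Measure (Record p)) (e : Covariate p → ℝ) (g : Covariate p → ℝ) : ℝ :=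
  ∫ w, (ipw e (observe w) * g w.1 - ipwMean P e g) ^ 2 ∂P

/-- Bounded measurable functions of the covariates. -/
def BddMeas (g : Covariate p → ℝ) : Prop := Measurable g ∧ ∃ M, ∀ x, |g x| ≤ M

lemma BddMeas.sub {g h : Covariate p → ℝ} (hg : BddMeas g) (hh : BddMeas h) :
    BddMeas fun x => g x - h x := by
  obtain ⟨hg, M, hM⟩ := hg
  obtain ⟨hh, N, hN⟩ := hh
  exact ⟨hg.sub hh, M + N, fun x => (abs_sub _ _).trans (add_le_add (hM x) (hN x))⟩

lemma BddMeas.const_mul {g : Covariate p → ℝ} (hg : BddMeas g) (c : ℝ) :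
    BddMeas fun x => c * g x := by
  obtain ⟨hg, M, hM⟩ := hg
  exact ⟨hg.const_mul c, |c| * M, fun x => by rw [abs_mul]; gcongr; exact hM x⟩

lemma BddMeas.memLp_mul {f : Record p → ℝ} {g : Covariate p → ℝ} (hg : BddMeas g)
    (hf : MemLp f 2 P) : MemLp (fun w => f w * g w.1) 2 P := by
  obtain ⟨hgm, M, hM⟩ := hg
  refine (hf.norm.const_mul M).of_le
    (hf.1.mul (hgm.comp measurable_fst).aestronglyMeasurable) (ae_of_all _ fun w => ?_)
  have hM0 : 0 ≤ M := (abs_nonneg _).trans (hM w.1)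
  rw [norm_mul, norm_mul, norm_norm, mul_comm]
  gcongr
  rw [Real.norm_of_nonneg hM0]
  exact hM w.1

lemma BddMeas.memLp [IsProbabilityMeasure P] {g : Covariate p → ℝ} (hg : BddMeas g) :
    MemLp (fun w : Record p => g w.1) 2 P := by
  simpa using hg.memLp_mul (P := P) (memLp_const (1 : ℝ))

lemma integral_covLaw {g : Covariate p → ℝ} (hg : Measurable g) :
    ∫ x, g x ∂(covLaw P) = ∫ w, g w.1 ∂P :=
  integral_map measurable_fst.aemeasurable hg.aestronglyMeasurable

instance [IsProbabilityMeasure P] : IsProbabilityMeasure (covLaw P) :=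
  Measure.isProbabilityMeasure_map measurable_fst.aemeasurable

/-- Given the covariates, the second moment is `σ_d² + μ_d²`, which is bounded, and `g` can be
pulled out. The bound is in terms of the `L²` norm of `g`, not its sup norm: stabilization only
makes policies close in mean. -/
lemma exists_integral_outcome_sq_le [IsProbabilityMeasure P] (hbdd : BoundedConditionalMoments P)
    (hmom : FiniteFourthMoments P) (d : Bool) :
    ∃ C : ℝ, 0 ≤ C ∧ ∀ g : Covariate p → ℝ, BddMeas g →
      ∫ w, (outcome d w * g w.1) ^ 2 ∂P ≤ C * ∫ x, g x ^ 2 ∂(covLaw P) := by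
  obtain ⟨⟨M, hM⟩, -, ⟨S, hS⟩⟩ := hbdd d
  refine ⟨|S| + M ^ 2, by positivity, fun g hg => ?_⟩
  have hY := memLp_outcome hmom d
  have hint : Integrable (fun w => outcome d w ^ 2 * g w.1 ^ 2) P := by
    have := (hg.memLp_mul hY).integrable_sq
    simpa only [mul_pow] using this
  simp_rw [mul_pow]
  rw [integral_covLaw (by have := hg.1; fun_prop), ← integral_const_mul,
    ← integral_mul_condExp hY.integrable_sq (stronglyMeasurable_covSigma (hg.1.pow_const 2)) hint]
  refine integral_mono_ae ?_ (hg.memLp.integrable_sq.const_mul _) ?_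
  · exact (integrable_condExp (f := fun w => outcome d w ^ 2 * g w.1 ^ 2)).congr
      (condExp_mul_of_stronglyMeasurable_right (stronglyMeasurable_covSigma (hg.1.pow_const 2))
        hint hY.integrable_sq)
  · filter_upwards [hM, hS, condVar_ae_eq_condExp_sq_sub_sq_condExp (covSigma_le p) hY]
      with w h1 h2 h3
    simp only [Pi.sub_apply, Pi.pow_apply] at h3
    have h4 : (P[fun w => outcome d w ^ 2 | covSigma p]) w
        = condVar (covSigma p) (outcome d) P w + (P[outcome d | covSigma p]) w ^ 2 := by
      rw [h3]; simp only [sub_add_cancel]; rfl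
    rw [h4]
    have h5 : (P[outcome d | covSigma p]) w ^ 2 ≤ M ^ 2 := by
      rw [← sq_abs]; exact pow_le_pow_left₀ (abs_nonneg _) h1 2
    gcongr
    exact h2.trans (le_abs_self S)

theorem exists_integral_ipw_sq_le [IsProbabilityMeasure P] (hign : StrongIgnorability P e)
    (hbdd : BoundedConditionalMoments P) (hmom : FiniteFourthMoments P) :
    ∃ C : ℝ, 0 ≤ C ∧ ∀ g : Covariate p → ℝ, BddMeas g →
      ∫ w, (ipw e (observe w) * g w.1) ^ 2 ∂P ≤ C * ∫ x, g x ^ 2 ∂(covLaw P) := by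
  obtain ⟨c, hc, hover⟩ := hign.overlap
  obtain ⟨C1, hC1, h1⟩ := exists_integral_outcome_sq_le hbdd hmom true
  obtain ⟨C0, hC0, h0⟩ := exists_integral_outcome_sq_le hbdd hmom false
  refine ⟨2 * (c⁻¹) ^ 2 * (C1 + C0), by positivity, fun g hg => ?_⟩
  have i1 := (hg.memLp_mul (memLp_outcome hmom true)).integrable_sq
  have i0 := (hg.memLp_mul (memLp_outcome hmom false)).integrable_sq
  calc ∫ w, (ipw e (observe w) * g w.1) ^ 2 ∂P
      ≤ ∫ w, 2 * (c⁻¹) ^ 2 * ((outcome true w * g w.1) ^ 2 + (outcome false w * g w.1) ^ 2) ∂P := by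
        refine integral_mono_of_nonneg (ae_of_all _ fun w => sq_nonneg _)
          ((i1.add i0).const_mul _) ?_
        filter_upwards [ae_overlap hover] with w hw
        have h := pow_le_pow_left₀ (abs_nonneg _) (abs_ipw_le hc hw) 2
        rw [sq_abs] at h
        have h2 : (|outcome true w| + |outcome false w|) ^ 2
            ≤ 2 * (outcome true w ^ 2 + outcome false w ^ 2) := by
          nlinarith [sq_nonneg (|outcome true w| - |outcome false w|), sq_abs (outcome true w),
            sq_abs (outcome false w)]
        simp only [mul_pow] at h ⊢
        calc ipw e (observe w) ^ 2 * g w.1 ^ 2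
            ≤ (c⁻¹ ^ 2 * (2 * (outcome true w ^ 2 + outcome false w ^ 2))) * g w.1 ^ 2 := by
              gcongr
              exact h.trans (by gcongr)
          _ = _ := by ring
    _ = 2 * (c⁻¹) ^ 2 * (∫ w, (outcome true w * g w.1) ^ 2 ∂P
          + ∫ w, (outcome false w * g w.1) ^ 2 ∂P) := by
        rw [integral_const_mul, integral_add i1 i0]
    _ ≤ 2 * (c⁻¹) ^ 2 * (C1 * ∫ x, g x ^ 2 ∂(covLaw P) + C0 * ∫ x, g x ^ 2 ∂(covLaw P)) := by
        gcongr
        · exact h1 g hg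
        · exact h0 g hg
    _ = _ := by ring

/-- With `m = 𝔼[Y(d) ∣ X]`, write `Y(d) g - k = (Y(d) - m) g + (m g - k)`. The second part is a
function of the covariates, hence orthogonal to the first, and dropping its square leaves `𝔼[σ_d²
g²]`. The freedom in `k` absorbs the centring in `exists_le_ipwVar`. -/
lemma exists_le_integral_outcome_sub_sq [IsProbabilityMeasure P]
    (hbdd : BoundedConditionalMoments P)
    (hmom : FiniteFourthMoments P) (d : Bool) :
    ∃ s : ℝ, 0 < s ∧ ∀ g k : Covariate p → ℝ, BddMeas g → Measurable k →
      MemLp (fun w : Record p => k w.1) 2 P →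
      s * ∫ x, g x ^ 2 ∂(covLaw P) ≤ ∫ w, (outcome d w * g w.1 - k w.1) ^ 2 ∂P := by
  obtain ⟨-, ⟨s, hs, hsv⟩, -⟩ := hbdd d
  refine ⟨s, hs, fun g k hg hk hk2 => ?_⟩
  have hY := memLp_outcome hmom d
  set m := P[outcome d | covSigma p] with hm
  have hm2 : MemLp m 2 P := hY.condExp (by norm_num)
  have hR : MemLp (fun w => outcome d w - m w) 2 P := hY.sub hm2
  have hRg := hg.memLp_mul hR
  have hmg := hg.memLp_mul hm2
  have hH : MemLp (fun w : Record p => m w * g w.1 - k w.1) 2 P := hmg.sub hk2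
  have hgm := stronglyMeasurable_covSigma hg.1
  have hHm : StronglyMeasurable[covSigma p]
      fun w : Record p => g w.1 * (m w * g w.1 - k w.1) :=
    hgm.mul ((stronglyMeasurable_condExp.mul hgm).sub (stronglyMeasurable_covSigma hk))
  have hcross : Integrable (fun w => (outcome d w - m w) * (g w.1 * (m w * g w.1 - k w.1))) P := by
    refine (hRg.integrable_mul hH).congr (ae_of_all _ fun w => ?_)
    simp only [Pi.mul_apply]; ring
  have hcross0 : ∫ w, (outcome d w - m w) * (g w.1 * (m w * g w.1 - k w.1)) ∂P = 0 := by
    rw [← integral_mul_condExp (hR.integrable one_le_two) hHm hcross]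
    have h0 : P[fun w => outcome d w - m w | covSigma p] =ᵐ[P] 0 := by
      have h1 := condExp_sub (hY.integrable one_le_two) (hm2.integrable one_le_two) (covSigma p)
      have h2 : P[m | covSigma p] = m := condExp_of_stronglyMeasurable (covSigma_le p)
        stronglyMeasurable_condExp (hm2.integrable one_le_two)
      filter_upwards [h1] with w hw
      rw [h2] at hw
      refine Eq.trans hw ?_
      simp [hm]
    rw [integral_congr_ae (g := fun _ => (0 : ℝ))]
    · simp
    · filter_upwards [h0] with w hw
      rw [hw]; simp
  have hsq : Integrable (fun w => (outcome d w - m w) ^ 2 * g w.1 ^ 2) P := by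
    simpa only [mul_pow] using hRg.integrable_sq
  calc s * ∫ x, g x ^ 2 ∂(covLaw P)
      = ∫ w, s * g w.1 ^ 2 ∂P := by
        rw [integral_covLaw (by have := hg.1; fun_prop), integral_const_mul]
    _ ≤ ∫ w, condVar (covSigma p) (outcome d) P w * g w.1 ^ 2 ∂P := by
        refine integral_mono_ae (hg.memLp.integrable_sq.const_mul _) ?_ ?_
        · exact (integrable_condExp (f := fun w => (outcome d w - m w) ^ 2 * g w.1 ^ 2)).congr
            (condExp_mul_of_stronglyMeasurable_right
              (stronglyMeasurable_covSigma (hg.1.pow_const 2)) hsq hR.integrable_sq)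
        · filter_upwards [hsv] with w hw
          gcongr
    _ = ∫ w, (outcome d w - m w) ^ 2 * g w.1 ^ 2 ∂P :=
        integral_mul_condExp hR.integrable_sq
          (stronglyMeasurable_covSigma (hg.1.pow_const 2)) hsq
    _ ≤ ∫ w, ((outcome d w - m w) ^ 2 * g w.1 ^ 2
          + (2 * ((outcome d w - m w) * (g w.1 * (m w * g w.1 - k w.1)))
            + (m w * g w.1 - k w.1) ^ 2)) ∂P := by
        have i3 : Integrable (fun w => 2 * ((outcome d w - m w) * (g w.1 * (m w * g w.1 - k w.1)))
            + (m w * g w.1 - k w.1) ^ 2) P := (hcross.const_mul 2).add hH.integrable_sq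
        rw [integral_add hsq i3, integral_add (hcross.const_mul 2) hH.integrable_sq,
          integral_const_mul, hcross0]
        have : 0 ≤ ∫ w, (m w * g w.1 - k w.1) ^ 2 ∂P := integral_nonneg fun w => sq_nonneg _
        linarith
    _ = _ := by
        refine integral_congr_ae (ae_of_all _ fun w => ?_)
        simp only; ring

/-- The treated units alone give enough variance: on them the IPW outcome is `Y(1)/e`, and the
indicator integrates to `e`. The previous lemma then applies with `k = e * m`, where `m` is the mean
being subtracted. -/
theorem exists_le_ipwVar [IsProbabilityMeasure P] (he : IsPropensityScore P e)
    (hign : StrongIgnorability P e)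
    (hbdd : BoundedConditionalMoments P) (hmom : FiniteFourthMoments P) :
    ∃ s : ℝ, 0 < s ∧ ∀ g : Covariate p → ℝ, BddMeas g →
      s * ∫ x, g x ^ 2 ∂(covLaw P) ≤ ipwVar P e g := by
  obtain ⟨c, hc, hover⟩ := hign.overlap
  have hov := ae_overlap hover
  obtain ⟨s, hs, h⟩ := exists_le_integral_outcome_sub_sq hbdd hmom true
  refine ⟨s, hs, fun g hg => ?_⟩
  set m := ipwMean P e g with hm
  have hem : Measurable fun w : Record p => e w.1 := he.1.comp measurable_fst
  have hgm : Measurable fun w : Record p => g w.1 := hg.1.comp measurable_fst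
  have hk2 : MemLp (fun w : Record p => e w.1 * m) 2 P := by
    refine MemLp.of_bound (hem.mul_const m).aestronglyMeasurable |m| ?_
    filter_upwards [hov] with w hw
    rw [norm_mul, Real.norm_eq_abs, Real.norm_eq_abs]
    exact mul_le_of_le_one_left (abs_nonneg _) (by rw [abs_le]; constructor <;> linarith)
  have hipw := hg.memLp_mul (memLp_ipw he hign hmom)
  have hiv : Integrable (fun w => (ipw e (observe w) * g w.1 - m) ^ 2) P :=
    (hipw.sub (memLp_const m)).integrable_sq
  have htr : Measurable fun w : Record p => treated w.2.1 :=
    measurable_treated.comp (measurable_fst.comp measurable_snd)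
  have hle : ∀ w : Record p, (outcome true w * g w.1 / e w.1 - m) ^ 2 * treated w.2.1
      ≤ (ipw e (observe w) * g w.1 - m) ^ 2 := by
    intro w
    rw [ipw_observe]
    cases h : w.2.1
    · simp only [treated, Bool.false_eq_true, if_false, mul_zero]; positivity
    · simp only [treated, if_true, mul_one, sub_self, mul_zero, sub_zero]
      rw [div_mul_eq_mul_div]
  have hY := measurable_outcome (p := p) true
  calc s * ∫ x, g x ^ 2 ∂(covLaw P)
      ≤ ∫ w, (outcome true w * g w.1 - e w.1 * m) ^ 2 ∂P :=
        h g (fun x => e x * m) hg (he.1.mul_const m) hk2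
    _ ≤ ∫ w, (outcome true w * g w.1 / e w.1 - m) ^ 2 * e w.1 ∂P := by
        have i1 : Integrable (fun w => (outcome true w * g w.1 / e w.1 - m) ^ 2 * e w.1) P := by
          have i2 := ((((hg.memLp_mul (memLp_outcome hmom true)).norm.const_mul c⁻¹).add
            (memLp_const |m|)).integrable_sq)
          refine i2.mono'
            ((((hY.mul hgm).div hem).sub_const m).pow_const 2 |>.mul hem).aestronglyMeasurable ?_
          filter_upwards [hov] with w hw
          have h0 : 0 < e w.1 := hc.trans_le hw.1
          rw [Real.norm_of_nonneg (by positivity)]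
          calc _ ≤ (outcome true w * g w.1 / e w.1 - m) ^ 2 * 1 := by
                gcongr; linarith [hw.2]
            _ ≤ _ := by
                rw [mul_one, ← sq_abs]
                refine pow_le_pow_left₀ (abs_nonneg _) ((abs_sub _ _).trans ?_) 2
                rw [abs_div, abs_of_pos h0, div_eq_inv_mul]
                simp only [Pi.add_apply, Real.norm_eq_abs]
                gcongr
                exact hw.1
        refine integral_mono_ae ((hg.memLp_mul (memLp_outcome hmom true)).sub hk2).integrable_sq
          i1 ?_
        filter_upwards [hov] with w hw
        have h0 : 0 < e w.1 := hc.trans_le hw.1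
        have h1 : e w.1 ≤ 1 := by linarith [hw.2]
        -- One factor `e ≤ 1` is dropped; the other becomes the treatment indicator in the next
        -- step.
        have e1 : (outcome true w * g w.1 - e w.1 * m) ^ 2
            = (outcome true w * g w.1 / e w.1 - m) ^ 2 * e w.1 * e w.1 := by
          field_simp
        simp only [e1]
        exact mul_le_of_le_one_right (by positivity) h1
    _ = ∫ w, (outcome true w * g w.1 / e w.1 - m) ^ 2 * treated w.2.1 ∂P := by
        have hg1 := hg.1
        have he1 := he.1
        refine (integral_mul_treated he hign
          (F' := fun z => (z.2 true * g z.1 / e z.1 - m) ^ 2) (by fun_prop) fun w => rfl).symm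
    _ ≤ _ := by
        refine integral_mono_of_nonneg (ae_of_all _ fun w => ?_) hiv (ae_of_all _ hle)
        refine mul_nonneg (sq_nonneg _) ?_
        unfold treated; split_ifs <;> norm_num

/-- By unconfoundedness the treatment indicator may be replaced by `e`, which cancels the inverse
weights. -/
lemma ipwMean_eq [IsProbabilityMeasure P] (he : IsPropensityScore P e)
    (hign : StrongIgnorability P e)
    (hmom : FiniteFourthMoments P) {g : Covariate p → ℝ} (hg : BddMeas g) :
    ipwMean P e g = ∫ w, (outcome true w - outcome false w) * g w.1 ∂P := by
  obtain ⟨c, hc, hover⟩ := hign.overlap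
  have hov := ae_overlap hover
  have hg1 := hg.1
  have he1 := he.1
  have hem : Measurable fun w : Record p => e w.1 := he.1.comp measurable_fst
  have hgm : Measurable fun w : Record p => g w.1 := hg.1.comp measurable_fst
  have hY1 := measurable_outcome (p := p) true
  have hY0 := measurable_outcome (p := p) false
  have htr : Measurable fun w : Record p => treated w.2.1 :=
    measurable_treated.comp (measurable_fst.comp measurable_snd)
  have htrb : ∀ w : Record p, ‖treated w.2.1‖ ≤ 1 := fun w => by
    unfold treated; split_ifs <;> simp
  have i1 := (hg.memLp_mul (memLp_outcome hmom true)).integrable one_le_two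
  have i0 := (hg.memLp_mul (memLp_outcome hmom false)).integrable one_le_two
  have j1 : Integrable (fun w => outcome true w * g w.1 / e w.1) P := by
    refine (i1.norm.const_mul c⁻¹).mono' (Measurable.aestronglyMeasurable (by fun_prop)) ?_
    filter_upwards [hov] with w hw
    rw [norm_div, Real.norm_of_nonneg (hc.le.trans hw.1), div_eq_inv_mul]
    gcongr
    exact hw.1
  have j0 : Integrable (fun w => outcome false w * g w.1 / (1 - e w.1)) P := by
    refine (i0.norm.const_mul c⁻¹).mono' (Measurable.aestronglyMeasurable (by fun_prop)) ?_
    filter_upwards [hov] with w hw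
    have : c ≤ 1 - e w.1 := by linarith [hw.2]
    rw [norm_div, Real.norm_of_nonneg (hc.le.trans this), div_eq_inv_mul]
    gcongr
  have k1 := j1.mul_bdd htr.aestronglyMeasurable (ae_of_all _ htrb)
  have k0 := j0.mul_bdd htr.aestronglyMeasurable (ae_of_all _ htrb)
  have heb : ∀ᵐ w ∂P, ‖e w.1‖ ≤ 1 := by
    filter_upwards [hov] with w hw
    rw [Real.norm_eq_abs, abs_le]; constructor <;> linarith [hw.1, hw.2]
  have l1 := j1.mul_bdd hem.aestronglyMeasurable heb
  have l0 := j0.mul_bdd hem.aestronglyMeasurable heb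
  have hA := integral_mul_treated he hign (F := fun w => outcome true w * g w.1 / e w.1)
    (F' := fun z => z.2 true * g z.1 / e z.1) (by fun_prop) fun w => rfl
  have hB := integral_mul_treated he hign (F := fun w => outcome false w * g w.1 / (1 - e w.1))
    (F' := fun z => z.2 false * g z.1 / (1 - e z.1)) (by fun_prop) fun w => rfl
  have jk : Integrable (fun w => outcome false w * g w.1 / (1 - e w.1)
      - outcome false w * g w.1 / (1 - e w.1) * treated w.2.1) P := j0.sub k0
  have jl : Integrable (fun w => outcome false w * g w.1 / (1 - e w.1)
      - outcome false w * g w.1 / (1 - e w.1) * e w.1) P := j0.sub l0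
  calc ipwMean P e g
      = ∫ w, (outcome true w * g w.1 / e w.1 * treated w.2.1
          - (outcome false w * g w.1 / (1 - e w.1)
            - outcome false w * g w.1 / (1 - e w.1) * treated w.2.1)) ∂P := by
        refine integral_congr_ae (ae_of_all _ fun w => ?_)
        simp only [ipw_observe]; ring
    _ = ∫ w, (outcome true w * g w.1 / e w.1 * e w.1
          - (outcome false w * g w.1 / (1 - e w.1)
            - outcome false w * g w.1 / (1 - e w.1) * e w.1)) ∂P := by
        rw [integral_sub k1 jk, integral_sub j0 k0, hA, hB,
          integral_sub l1 jl, integral_sub j0 l0]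
    _ = _ := by
        refine integral_congr_ae ?_
        filter_upwards [hov] with w hw
        have h1 : e w.1 ≠ 0 := (hc.trans_le hw.1).ne'
        have h2 : 1 - e w.1 ≠ 0 := by linarith [hw.2]
        field_simp

lemma Policy.bddMeas {π : Policy p} (hπ : Measurable π) : BddMeas fun x => (π x : ℝ) :=
  ⟨measurable_subtype_coe.comp hπ, 1, fun x => by rw [abs_of_nonneg (π x).2.1]; exact (π x).2.2⟩

theorem valueDiff_eq_ipwMean [IsProbabilityMeasure P] (he : IsPropensityScore P e)
    (hign : StrongIgnorability P e)
    (hmom : FiniteFourthMoments P) {π π' : Policy p} (hπ : Measurable π) (hπ' : Measurable π') :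
    valueDiff P π π' = ipwMean P e fun x => (π x : ℝ) - π' x := by
  rw [ipwMean_eq he hign hmom ((Policy.bddMeas hπ).sub (Policy.bddMeas hπ')), valueDiff, value,
    value, ← integral_sub]
  · refine integral_congr_ae (ae_of_all _ fun w => ?_)
    simp only; ring
  all_goals
    refine (((Policy.bddMeas (by assumption)).memLp_mul (memLp_outcome hmom true)).add
      (((Policy.bddMeas (measurable_const (a := (1 : unitInterval)))).sub
        (Policy.bddMeas (by assumption))).memLp_mul
          (memLp_outcome hmom false))).integrable one_le_two

end Population

end

end Cram

namespace Cram

noncomputable section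

/-! ### The mean and variance of IPW outcomes as functionals of the weight function. -/

section Variance

variable {p : ℕ} {P : Measure (Record p)} {e : Covariate p → ℝ}

lemma ipwVar_eq_variance {g : Covariate p → ℝ} (hg : BddMeas g)
    (hI : MemLp (fun w => ipw e (observe w)) 2 P) :
    ipwVar P e g = Var[fun w => ipw e (observe w) * g w.1; P] :=
  (variance_eq_integral (hg.memLp_mul hI).1.aemeasurable).symm

lemma ipwVar_le [IsProbabilityMeasure P] {g : Covariate p → ℝ} (hg : BddMeas g)
    (hI : MemLp (fun w => ipw e (observe w)) 2 P) :
    ipwVar P e g ≤ ∫ w, (ipw e (observe w) * g w.1) ^ 2 ∂P := by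
  rw [ipwVar_eq_variance hg hI]
  exact variance_le_expectation_sq (hg.memLp_mul hI).1

lemma ipwVar_nonneg (g : Covariate p → ℝ) : 0 ≤ ipwVar P e g :=
  integral_nonneg fun _ => sq_nonneg _

lemma ipwMean_const_mul (c : ℝ) (g : Covariate p → ℝ) :
    ipwMean P e (fun x => c * g x) = c * ipwMean P e g := by
  simp only [ipwMean]
  rw [← integral_const_mul]
  exact integral_congr_ae (ae_of_all _ fun w => by simp only; ring)

lemma ipwVar_const_mul (c : ℝ) (g : Covariate p → ℝ) :
    ipwVar P e (fun x => c * g x) = c ^ 2 * ipwVar P e g := by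
  simp only [ipwVar, ipwMean_const_mul]
  rw [← integral_const_mul]
  exact integral_congr_ae (ae_of_all _ fun w => by simp only; ring)

variable [IsProbabilityMeasure P]

lemma ipwMean_sub {g h : Covariate p → ℝ} (hg : BddMeas g) (hh : BddMeas h)
    (hI : MemLp (fun w => ipw e (observe w)) 2 P) :
    ipwMean P e (fun x => g x - h x) = ipwMean P e g - ipwMean P e h := by
  simp only [ipwMean]
  rw [← integral_sub ((hg.memLp_mul hI).integrable one_le_two)
    ((hh.memLp_mul hI).integrable one_le_two)]
  exact integral_congr_ae (ae_of_all _ fun w => by simp only; ring)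

lemma ipwMean_sum {ι : Type*} (s : Finset ι) {g : ι → Covariate p → ℝ}
    (hg : ∀ i ∈ s, BddMeas (g i)) (hI : MemLp (fun w => ipw e (observe w)) 2 P) :
    ipwMean P e (fun x => ∑ i ∈ s, g i x) = ∑ i ∈ s, ipwMean P e (g i) := by
  simp only [ipwMean]
  rw [← integral_finsetSum _ fun i hi => ((hg i hi).memLp_mul hI).integrable one_le_two]
  exact integral_congr_ae (ae_of_all _ fun w => by simp only [Finset.mul_sum])

lemma abs_ipwMean_le {g : Covariate p → ℝ} (hg : BddMeas g)
    (hI : MemLp (fun w => ipw e (observe w)) 2 P) :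
    |ipwMean P e g| ≤ √(∫ w, (ipw e (observe w) * g w.1) ^ 2 ∂P) := by
  apply Real.abs_le_sqrt
  have h := variance_nonneg (fun w => ipw e (observe w) * g w.1) P
  rw [variance_eq_sub (hg.memLp_mul hI)] at h
  simp only [Pi.pow_apply] at h
  unfold ipwMean
  linarith

lemma abs_ipwMean_le_of_bound (hI : MemLp (fun w => ipw e (observe w)) 2 P) {g : Covariate p → ℝ}
    {M : ℝ} (hM : ∀ x, |g x| ≤ M) : |ipwMean P e g| ≤ M * ∫ w, ‖ipw e (observe w)‖ ∂P := by
  rw [← Real.norm_eq_abs]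
  unfold ipwMean
  refine (norm_integral_le_integral_norm _).trans ?_
  rw [← integral_const_mul]
  refine integral_mono_of_nonneg (ae_of_all _ fun _ => norm_nonneg _)
    ((hI.integrable one_le_two).norm.const_mul M) (ae_of_all _ fun w => ?_)
  simp only
  rw [norm_mul, mul_comm]
  gcongr
  exact hM _

/-- For the centred outcomes `a`, `b` with weights `g`, `h`, use `a² - b² = (a - b)² + 2(a - b)b`
and a weighted AM-GM inequality on the cross term; `a - b` is the centred outcome with weight `g -
h`. The parameter `θ` stays free, since only it makes the second term small. -/
lemma abs_ipwVar_sub_le {C θ : ℝ} (hθ : 0 < θ) {g h : Covariate p → ℝ} (hg : BddMeas g)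
    (hh : BddMeas h) (hI : MemLp (fun w => ipw e (observe w)) 2 P)
    (hC : ∀ g : Covariate p → ℝ, BddMeas g →
      ∫ w, (ipw e (observe w) * g w.1) ^ 2 ∂P ≤ C * ∫ x, g x ^ 2 ∂(covLaw P)) :
    |ipwVar P e g - ipwVar P e h|
      ≤ (1 + 1 / θ) * (C * ∫ x, (g x - h x) ^ 2 ∂(covLaw P))
        + θ * (C * ∫ x, h x ^ 2 ∂(covLaw P)) := by
  have hgh := hg.sub hh
  have i1 := ((hg.memLp_mul hI).sub (memLp_const (ipwMean P e g))).integrable_sq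
  have i2 := ((hh.memLp_mul hI).sub (memLp_const (ipwMean P e h))).integrable_sq
  have i3 := ((hgh.memLp_mul hI).sub
    (memLp_const (ipwMean P e fun x => g x - h x))).integrable_sq
  simp only [Pi.sub_apply] at i1 i2 i3
  have key : ∀ a b : ℝ, |a ^ 2 - b ^ 2| ≤ (1 + 1 / θ) * (a - b) ^ 2 + θ * b ^ 2 := by
    intro a b
    have h1 : a ^ 2 - b ^ 2 = (a - b) ^ 2 + 2 * ((a - b) * b) := by ring
    have h2 : |2 * ((a - b) * b)| ≤ 1 / θ * (a - b) ^ 2 + θ * b ^ 2 := by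
      have hθ' : θ * (1 / θ) = 1 := by field_simp
      have e1 : 1 / θ * (a - b) ^ 2 + θ * b ^ 2 - 2 * ((a - b) * b)
          = 1 / θ * ((a - b) - θ * b) ^ 2 := by field_simp; ring
      have e2 : 1 / θ * (a - b) ^ 2 + θ * b ^ 2 + 2 * ((a - b) * b)
          = 1 / θ * ((a - b) + θ * b) ^ 2 := by field_simp; ring
      have p1 : 0 ≤ 1 / θ * ((a - b) - θ * b) ^ 2 := by positivity
      have p2 : 0 ≤ 1 / θ * ((a - b) + θ * b) ^ 2 := by positivity
      rw [abs_le]; constructor <;> linarith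
    rw [h1]
    refine (abs_add_le _ _).trans ?_
    rw [abs_of_nonneg (sq_nonneg _)]
    linarith
  calc |ipwVar P e g - ipwVar P e h|
      ≤ (1 + 1 / θ) * ipwVar P e (fun x => g x - h x) + θ * ipwVar P e h := by
        simp only [ipwVar]
        rw [← integral_sub i1 i2, ← integral_const_mul, ← integral_const_mul,
          ← integral_add (i3.const_mul _) (i2.const_mul _)]
        refine abs_integral_le_integral_abs.trans
          (integral_mono (i1.sub i2).abs ((i3.const_mul _).add (i2.const_mul _)) fun w => ?_)
        refine (key _ _).trans (le_of_eq ?_)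
        simp only [ipwMean_sub hg hh hI]
        ring
    _ ≤ _ := by
        gcongr
        · exact (ipwVar_le hgh hI).trans (hC _ hgh)
        · exact (ipwVar_le hh hI).trans (hC _ hh)

end Variance

/-! ### Fubini and conditioning for functions of two independent variables. -/

section Independence

variable {Ω α β : Type*} [MeasurableSpace Ω] [MeasurableSpace α] [MeasurableSpace β]
  {μ : Measure Ω} [IsProbabilityMeasure μ] {U : Ω → α} {W : Ω → β}

lemma integrable_prod_of_indepFun {E : Type*} [NormedAddCommGroup E]
    (hU : Measurable U) (hW : Measurable W) (h : IndepFun U W μ) {F : α × β → E}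
    (hF : StronglyMeasurable F) (hint : Integrable (fun ω => F (U ω, W ω)) μ) :
    Integrable F ((μ.map U).prod (μ.map W)) := by
  rw [← (indepFun_iff_map_prod_eq_prod_map_map hU.aemeasurable hW.aemeasurable).1 h]
  exact (integrable_map_measure hF.aestronglyMeasurable (hU.prodMk hW).aemeasurable).2 hint

/-- Fubini's theorem for a function of two independent random variables. -/
lemma integral_indepFun {E : Type*} [NormedAddCommGroup E] [NormedSpace ℝ E] [CompleteSpace E]
    (hU : Measurable U) (hW : Measurable W) (h : IndepFun U W μ) {F : α × β → E}
    (hF : StronglyMeasurable F) (hint : Integrable (fun ω => F (U ω, W ω)) μ) :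
    ∫ ω, F (U ω, W ω) ∂μ = ∫ ω, ∫ ω', F (U ω, W ω') ∂μ ∂μ := by
  have hp := integrable_prod_of_indepFun hU hW h hF hint
  have := Measure.isProbabilityMeasure_map (μ := μ) hU.aemeasurable
  have := Measure.isProbabilityMeasure_map (μ := μ) hW.aemeasurable
  rw [← integral_map (f := F) (hU.prodMk hW).aemeasurable hF.aestronglyMeasurable,
    (indepFun_iff_map_prod_eq_prod_map_map hU.aemeasurable hW.aemeasurable).1 h,
    integral_prod _ hp, integral_map hU.aemeasurable
      (hF.integral_prod_right').aestronglyMeasurable]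
  refine integral_congr_ae (ae_of_all _ fun ω => ?_)
  exact integral_map hW.aemeasurable (hF.comp_measurable measurable_prodMk_left).aestronglyMeasurable

/-- Conditioning a function of two independent random variables on the first one. -/
lemma condExp_indepFun (hU : Measurable U) (hW : Measurable W) (h : IndepFun U W μ)
    {F : α × β → ℝ} (hF : StronglyMeasurable F) (hint : Integrable (fun ω => F (U ω, W ω)) μ) :
    μ[fun ω => F (U ω, W ω) | MeasurableSpace.comap U inferInstance]
      =ᵐ[μ] fun ω => ∫ ω', F (U ω, W ω') ∂μ := by
  have hp := integrable_prod_of_indepFun hU hW h hF hint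
  have := Measure.isProbabilityMeasure_map (μ := μ) hU.aemeasurable
  have := Measure.isProbabilityMeasure_map (μ := μ) hW.aemeasurable
  have hcongr : ∀ u, ∫ ω', F (u, W ω') ∂μ = ∫ b, F (u, b) ∂(μ.map W) := fun u =>
    (integral_map hW.aemeasurable
      (hF.comp_measurable measurable_prodMk_left).aestronglyMeasurable).symm
  have hsm : StronglyMeasurable fun u => ∫ ω', F (u, W ω') ∂μ := by
    simp_rw [hcongr]; exact hF.integral_prod_right'
  have hi : Integrable (fun ω => ∫ ω', F (U ω, W ω') ∂μ) μ := by
    have h1 := hp.integral_prod_left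
    simp_rw [← hcongr] at h1
    exact (integrable_map_measure hsm.aestronglyMeasurable hU.aemeasurable).1 h1
  refine (ae_eq_condExp_of_forall_setIntegral_eq hU.comap_le hint (fun s _ _ => hi.integrableOn)
    ?_ ?_).symm
  · rintro s ⟨t, ht, rfl⟩ -
    rw [← integral_indicator (hU ht), ← integral_indicator (hU ht)]
    -- The conditioning event concerns the first variable only, so it can be absorbed into `F`
    -- before applying Fubini.
    have hF2 : StronglyMeasurable ((Prod.fst ⁻¹' t).indicator F) :=
      hF.indicator (measurable_fst ht)
    have hi2 : Integrable (fun ω => (Prod.fst ⁻¹' t).indicator F (U ω, W ω)) μ :=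
      (hint.indicator (hU ht)).congr (ae_of_all _ fun ω => rfl)
    have h2 := integral_indepFun hU hW h hF2 hi2
    rw [show (∫ ω, (U ⁻¹' t).indicator (fun x => F (U x, W x)) ω ∂μ)
      = ∫ ω, (Prod.fst ⁻¹' t).indicator F (U ω, W ω) ∂μ from rfl, h2]
    refine integral_congr_ae (ae_of_all _ fun ω => ?_)
    by_cases hω : U ω ∈ t
    · simp [Set.indicator, hω]
    · simp [Set.indicator, hω]
  · exact (hsm.comp_measurable (comap_measurable U)).aestronglyMeasurable

end Independence

/-! ### Weights learned from past data, and orthogonality of the centred outcomes. -/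

section Data

variable {p : ℕ} {Ω : Type*} {Z : ℕ → Ω → Record p}

/-- A record with a given observed part. -/
def liftObs (o : Obs p) : Record p := (o.1, o.2.1, fun _ => o.2.2)

@[simp] lemma observe_liftObs (o : Obs p) : observe (liftObs o) = o := rfl

lemma measurable_liftObs : Measurable (liftObs (p := p)) :=
  measurable_fst.prodMk ((measurable_fst.comp measurable_snd).prodMk
    (measurable_pi_lambda _ fun _ => measurable_snd.comp measurable_snd))

/-- A sequence of units on the space of data sets of size `n`, whose first `n` units have the
observations of the data set. -/
def unitsOf (n k : ℕ) (u : Fin n → Obs p) : Record p :=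
  if h : k < n then liftObs (u ⟨k, h⟩) else liftObs (0, true, 0)

lemma measurable_unitsOf (n k : ℕ) : Measurable (unitsOf (p := p) n k) := by
  unfold unitsOf
  split_ifs with h
  · exact measurable_liftObs.comp (measurable_pi_apply _)
  · exact measurable_const

lemma observe_unitsOf {n k : ℕ} (h : k < n) (ω : Ω) :
    observe (unitsOf n k (dataset Z n ω)) = observe (Z k ω) := by
  simp [unitsOf, h, dataset]

lemma dataset_unitsOf {n k : ℕ} (h : k ≤ n) (ω : Ω) :
    dataset (unitsOf n) k (dataset Z n ω) = dataset Z k ω := by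
  ext1 i
  exact observe_unitsOf (by omega) ω

variable {A : LearningAlgorithm p} {π0 : Policy p} {B : ℕ}

/-- Running the learning scheme with the space of data sets as sample space exhibits the policy as a
function of the data set. This is the factorization that `DependsOnData` asks for. -/
lemma learned_unitsOf {n t : ℕ} (h : t * B ≤ n) (ω : Ω) :
    learned A π0 B (unitsOf n) t (dataset Z n ω) = learned A π0 B Z t ω := by
  unfold learned
  rw [dataset_unitsOf h]

variable [MeasurableSpace Ω]

lemma measurable_dataset (hZm : ∀ i, Measurable (Z i)) (n : ℕ) : Measurable (dataset Z n) :=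
  measurable_pi_lambda _ fun i => measurable_observe.comp (hZm i)

lemma measurable_learned (hZm : ∀ i, Measurable (Z i)) (hπ0 : Measurable π0)
    (hA : ∀ n, Measurable (fun q : (Fin n → Obs p) × Covariate p => A n q.1 q.2)) (t : ℕ) :
    Measurable fun q : Ω × Covariate p => (learned A π0 B Z t q.1 q.2 : ℝ) := by
  refine measurable_subtype_coe.comp ?_
  unfold learned
  split_ifs
  · exact hπ0.comp measurable_snd
  · exact (hA (t * B)).comp
      (((measurable_dataset hZm _).comp measurable_fst).prodMk measurable_snd)

omit [MeasurableSpace Ω] in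
lemma measurable_learned_apply (hπ0 : Measurable π0)
    (hA : ∀ n, Measurable (fun q : (Fin n → Obs p) × Covariate p => A n q.1 q.2)) (t : ℕ) (ω : Ω) :
    Measurable fun x => (learned A π0 B Z t ω x : ℝ) := by
  refine measurable_subtype_coe.comp ?_
  unfold learned
  split_ifs
  · exact hπ0
  · exact (hA (t * B)).comp measurable_prodMk_left

variable {μ : Measure Ω}

lemma indepFun_dataset_Ico (hZm : ∀ i, Measurable (Z i)) (hZind : iIndepFun Z μ) (n N : ℕ) :
    IndepFun (dataset Z n) (fun ω (i : Finset.Ico n N) => Z i ω) μ := by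
  have h := hZind.indepFun_finset (Finset.range n) (Finset.Ico n N) (by
    rw [Finset.disjoint_left]; intro i; simp only [Finset.mem_range, Finset.mem_Ico]; omega) hZm
  have hm : Measurable fun (v : Finset.range n → Record p) (i : Fin n) =>
      observe (v ⟨i, Finset.mem_range.2 i.2⟩) :=
    measurable_pi_lambda _ fun i => measurable_observe.comp (measurable_pi_apply _)
  exact h.comp hm measurable_id

lemma indepFun_dataset_unit (hZm : ∀ i, Measurable (Z i)) (hZind : iIndepFun Z μ) {n i : ℕ}
    (hi : n ≤ i) : IndepFun (dataset Z n) (Z i) μ :=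
  (indepFun_dataset_Ico hZm hZind n (i + 1)).comp measurable_id
    (measurable_pi_apply (⟨i, Finset.mem_Ico.2 ⟨hi, by omega⟩⟩ : Finset.Ico n (i + 1)))

/-- The weight function `g` depends on the sample only through the first `n` observations. -/
def DependsOnData (Z : ℕ → Ω → Record p) (n : ℕ) (g : Ω → Covariate p → ℝ) : Prop :=
  ∃ g' : (Fin n → Obs p) → Covariate p → ℝ, Measurable (Function.uncurry g') ∧
    (∃ M, ∀ u x, |g' u x| ≤ M) ∧ ∀ ω, g ω = g' (dataset Z n ω)

omit [MeasurableSpace Ω] in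
lemma DependsOnData.bddMeas {n : ℕ} {g : Ω → Covariate p → ℝ} (hg : DependsOnData Z n g) (ω : Ω) :
    BddMeas (g ω) := by
  obtain ⟨g', hm, ⟨M, hM⟩, h⟩ := hg
  rw [h]
  exact ⟨hm.comp measurable_prodMk_left, M, hM _⟩

omit [MeasurableSpace Ω] in
lemma DependsOnData.mono {n k : ℕ} {g : Ω → Covariate p → ℝ} (hg : DependsOnData Z n g)
    (hnk : n ≤ k) : DependsOnData Z k g := by
  obtain ⟨g', hm, ⟨M, hM⟩, h⟩ := hg
  refine ⟨fun u => g' (dataset (unitsOf k) n u), hm.comp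
    (((measurable_dataset (measurable_unitsOf k) n).comp measurable_fst).prodMk measurable_snd),
    ⟨M, fun u => hM _⟩, fun ω => ?_⟩
  simp only [h, dataset_unitsOf hnk]

omit [MeasurableSpace Ω] in
lemma dependsOnData_const {g : Covariate p → ℝ} (hg : BddMeas g) (n : ℕ) :
    DependsOnData Z n fun _ => g := by
  obtain ⟨hg, M, hM⟩ := hg
  exact ⟨fun _ => g, hg.comp measurable_snd, ⟨M, fun _ => hM⟩, fun _ => rfl⟩

variable {P : Measure (Record p)} {e : Covariate p → ℝ}

/-- The centered weighted outcome of one unit. -/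
def centered (P : Measure (Record p)) (e : Covariate p → ℝ) (g : Covariate p → ℝ) (o : Obs p) : ℝ :=
  ipw e o * g o.1 - ipwMean P e g

lemma measurable_ipwMean [SFinite P] (he : Measurable e) {α : Type*} [MeasurableSpace α]
    {g : α → Covariate p → ℝ} (hg : Measurable (Function.uncurry g)) :
    Measurable fun u => ipwMean P e (g u) := by
  have h : StronglyMeasurable fun q : α × Record p => ipw e (observe q.2) * g q.1 q.2.1 :=
    ((((measurable_ipw he).comp measurable_observe).comp measurable_snd).mul
      (hg.comp (measurable_fst.prodMk (measurable_fst.comp measurable_snd)))).stronglyMeasurable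
  exact h.integral_prod_right'.measurable

lemma measurable_centered [SFinite P] (he : Measurable e) {α : Type*} [MeasurableSpace α]
    {g : α → Covariate p → ℝ} (hg : Measurable (Function.uncurry g)) :
    Measurable fun q : α × Obs p => centered P e (g q.1) q.2 := by
  unfold centered
  exact (((measurable_ipw he).comp measurable_snd).mul
    (hg.comp (measurable_fst.prodMk (measurable_fst.comp measurable_snd)))).sub
    ((measurable_ipwMean he hg).comp measurable_fst)

lemma measurable_centered_observe (he : Measurable e) {g : Covariate p → ℝ} (hg : Measurable g) :
    Measurable fun w => centered P e g (observe w) :=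
  ((((measurable_ipw he).comp measurable_observe)).mul (hg.comp measurable_fst)).sub_const _

lemma integral_centered_sq (g : Covariate p → ℝ) :
    ∫ w, centered P e g (observe w) ^ 2 ∂P = ipwVar P e g := rfl

lemma integral_comp_unit {i : ℕ} (hZm : ∀ i, Measurable (Z i)) (hZlaw : ∀ i, μ.map (Z i) = P)
    {f : Record p → ℝ} (hf : Measurable f) : ∫ ω, f (Z i ω) ∂μ = ∫ w, f w ∂P := by
  rw [← hZlaw i, integral_map (hZm i).aemeasurable hf.aestronglyMeasurable]

lemma memLp_ipw_unit (hZm : ∀ i, Measurable (Z i)) (hZlaw : ∀ i, μ.map (Z i) = P)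
    (hI : MemLp (fun w => ipw e (observe w)) 2 P) (i : ℕ) :
    MemLp (fun ω => ipw e (observe (Z i ω))) 2 μ := by
  rw [← hZlaw i] at hI
  exact hI.comp_of_map (hZm i).aemeasurable

variable [IsProbabilityMeasure P]

lemma integral_centered (hI : MemLp (fun w => ipw e (observe w)) 2 P) {g : Covariate p → ℝ}
    (hg : BddMeas g) : ∫ w, centered P e g (observe w) ∂P = 0 := by
  simp only [centered]
  rw [integral_sub (((hg.memLp_mul hI).integrable one_le_two).congr
    (ae_of_all _ fun w => by rfl)) (integrable_const _), integral_const]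
  simp [ipwMean, observe]

variable [IsProbabilityMeasure μ]

/-- The weight has a nonrandom bound, so square integrability needs no independence between the
weight and the unit. -/
lemma memLp_centered (he : Measurable e) (hZm : ∀ i, Measurable (Z i))
    (hZlaw : ∀ i, μ.map (Z i) = P)
    (hI : MemLp (fun w => ipw e (observe w)) 2 P) {n i : ℕ} {g : Ω → Covariate p → ℝ}
    (hg : DependsOnData Z n g) :
    MemLp (fun ω => centered P e (g ω) (observe (Z i ω))) 2 μ := by
  obtain ⟨g', hm, ⟨M, hM⟩, h⟩ := hg
  have hM0 : 0 ≤ M := (abs_nonneg _).trans (hM (fun _ => (0, true, 0)) 0)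
  have hmeas : Measurable fun ω => centered P e (g ω) (observe (Z i ω)) := by
    simp_rw [h]
    have h1 := (measurable_centered (P := P) (g := g') he hm).comp
      ((measurable_dataset hZm n).prodMk (measurable_observe.comp (hZm i)))
    exact h1
  refine (((memLp_ipw_unit hZm hZlaw hI i).norm.const_mul M).add
    (memLp_const (M * ∫ w, ‖ipw e (observe w)‖ ∂P))).of_le hmeas.aestronglyMeasurable
    (ae_of_all _ fun ω => ?_)
  have hb : ∀ x, |g ω x| ≤ M := fun x => by rw [h]; exact hM _ x
  refine le_trans ?_ (le_abs_self _)
  simp only [centered, Pi.add_apply]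
  refine (norm_sub_le _ _).trans (add_le_add ?_ ?_)
  · rw [norm_mul, mul_comm]
    gcongr
    exact hb _
  · exact abs_ipwMean_le_of_bound hI hb

/-- The centered weighted outcomes with predictable weights are orthogonal. -/
lemma integral_centered_mul (he : Measurable e) (hZm : ∀ i, Measurable (Z i))
    (hZind : iIndepFun Z μ) (hZlaw : ∀ i, μ.map (Z i) = P)
    (hI : MemLp (fun w => ipw e (observe w)) 2 P) {i k : ℕ} (hki : k < i)
    {g h : Ω → Covariate p → ℝ} (hg : DependsOnData Z i g) (hh : DependsOnData Z k h) :
    ∫ ω, centered P e (h ω) (observe (Z k ω)) * centered P e (g ω) (observe (Z i ω)) ∂μ = 0 := by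
  have h1 := memLp_centered (i := i) he hZm hZlaw hI hg
  have h2 := memLp_centered (i := k) he hZm hZlaw hI hh
  have h3 := h2.integrable_mul h1
  have hgb := hg.bddMeas
  obtain ⟨g', hm, ⟨M, hM⟩, hg⟩ := hg
  obtain ⟨h', hm', -, hh⟩ := hh
  -- The earlier term and the weight of the later one are functions of the first `i` observations.
  -- Integrating out the fresh unit `i` with these held fixed gives zero.
  let F : (Fin i → Obs p) × Record p → ℝ := fun q =>
    centered P e (h' (dataset (unitsOf i) k q.1)) (observe (unitsOf i k q.1))
      * centered P e (g' q.1) (observe q.2)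
  have hF : Measurable F := by
    have m1 := (measurable_centered (P := P) (g := h') he hm').comp
      ((measurable_dataset (measurable_unitsOf i) k).prodMk
        (measurable_observe.comp (measurable_unitsOf i k)))
    have m2 := (measurable_centered (P := P) (g := g') he hm).comp
      (measurable_fst.prodMk (measurable_observe.comp measurable_snd))
    exact (m1.comp measurable_fst).mul m2
  have hFe : ∀ ω, F (dataset Z i ω, Z i ω)
      = centered P e (h ω) (observe (Z k ω)) * centered P e (g ω) (observe (Z i ω)) := fun ω => by
    simp only [F]
    rw [dataset_unitsOf hki.le, observe_unitsOf hki, ← hh, ← hg]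
  simp_rw [← hFe]
  rw [integral_indepFun (measurable_dataset hZm i) (hZm i)
    (indepFun_dataset_unit hZm hZind le_rfl) hF.stronglyMeasurable
    (h3.congr (ae_of_all _ fun ω => (hFe ω).symm))]
  rw [integral_congr_ae (g := fun _ => (0 : ℝ)) (ae_of_all _ fun ω => ?_), integral_zero]
  simp only [F]
  rw [integral_const_mul, integral_comp_unit hZm hZlaw
    (f := fun w => centered P e (g' (dataset Z i ω)) (observe w)), integral_centered hI, mul_zero]
  · rw [← hg]; exact hgb ω
  · exact measurable_centered_observe he (hm.comp measurable_prodMk_left)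

/-- Unit `i` is independent of the data that determine its weight, so it is integrated out first
with the weight held fixed. -/
lemma integral_centered_unit_sq (he : Measurable e) (hZm : ∀ i, Measurable (Z i))
    (hZind : iIndepFun Z μ) (hZlaw : ∀ i, μ.map (Z i) = P)
    (hI : MemLp (fun w => ipw e (observe w)) 2 P) {i : ℕ}
    {g : Ω → Covariate p → ℝ} (hg : DependsOnData Z i g) :
    ∫ ω, centered P e (g ω) (observe (Z i ω)) ^ 2 ∂μ = ∫ ω, ipwVar P e (g ω) ∂μ := by
  have h1 := (memLp_centered (i := i) he hZm hZlaw hI hg).integrable_sq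
  obtain ⟨g', hm, -, hg⟩ := hg
  let F : (Fin i → Obs p) × Record p → ℝ := fun q => centered P e (g' q.1) (observe q.2) ^ 2
  have hF : Measurable F := by
    have m2 := (measurable_centered (P := P) (g := g') he hm).comp
      (measurable_fst.prodMk (measurable_observe.comp measurable_snd))
    exact m2.pow_const 2
  have hFe : ∀ ω, F (dataset Z i ω, Z i ω)
      = centered P e (g ω) (observe (Z i ω)) ^ 2 := fun ω => by
    simp only [F]
    rw [← hg]
  simp_rw [← hFe]
  rw [integral_indepFun (measurable_dataset hZm i) (hZm i)
    (indepFun_dataset_unit hZm hZind le_rfl) hF.stronglyMeasurable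
    (h1.congr (ae_of_all _ fun ω => (hFe ω).symm))]
  refine integral_congr_ae (ae_of_all _ fun ω => ?_)
  simp only [F]
  rw [integral_comp_unit hZm hZlaw
    (f := fun w => centered P e (g' (dataset Z i ω)) (observe w) ^ 2), integral_centered_sq, hg]
  exact (measurable_centered_observe he (hm.comp measurable_prodMk_left)).pow_const 2

/-- Pythagoras for martingale differences: the off-diagonal products integrate to zero by
`integral_centered_mul`, whichever of the two units comes later. -/
theorem integral_sum_centered_sq (he : Measurable e) (hZm : ∀ i, Measurable (Z i))
    (hZind : iIndepFun Z μ) (hZlaw : ∀ i, μ.map (Z i) = P)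
    (hI : MemLp (fun w => ipw e (observe w)) 2 P) (s : Finset ℕ)
    {g : ℕ → Ω → Covariate p → ℝ} (hg : ∀ i ∈ s, DependsOnData Z i (g i)) :
    ∫ ω, (∑ i ∈ s, centered P e (g i ω) (observe (Z i ω))) ^ 2 ∂μ
      = ∑ i ∈ s, ∫ ω, ipwVar P e (g i ω) ∂μ := by
  have hL : ∀ i ∈ s, MemLp (fun ω => centered P e (g i ω) (observe (Z i ω))) 2 μ := fun i hi =>
    memLp_centered he hZm hZlaw hI (hg i hi)
  have hM : ∀ i ∈ s, ∀ k ∈ s, Integrable (fun ω => centered P e (g i ω) (observe (Z i ω))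
      * centered P e (g k ω) (observe (Z k ω))) μ := fun i hi k hk =>
    (hL i hi).integrable_mul (hL k hk)
  simp_rw [sq, Finset.sum_mul_sum]
  rw [integral_finsetSum _ fun i hi => integrable_finsetSum _ fun k hk => hM i hi k hk]
  refine Finset.sum_congr rfl fun i hi => ?_
  rw [integral_finsetSum _ fun k hk => hM i hi k hk, Finset.sum_eq_single_of_mem i hi]
  · rw [← integral_centered_unit_sq he hZm hZind hZlaw hI (hg i hi)]
    simp_rw [sq]
  · intro k hk hki
    rcases lt_or_gt_of_ne hki with h | h
    · simp_rw [mul_comm (centered P e (g i _) (observe (Z i _)))]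
      exact integral_centered_mul he hZm hZind hZlaw hI h (hg i hi) (hg k hk)
    · exact integral_centered_mul he hZm hZind hZlaw hI h (hg k hk) (hg i hi)

end Data

end

end Cram

namespace Cram

noncomputable section

/-! ### Conditional variance, and the central limit theorem given past data. -/

section Conditional

variable {p : ℕ} {Ω : Type*} {Z : ℕ → Ω → Record p} [MeasurableSpace Ω] {μ : Measure Ω}
  [IsProbabilityMeasure μ] {P : Measure (Record p)} [IsProbabilityMeasure P]
  {e : Covariate p → ℝ}

lemma measurable_ipwVar (he : Measurable e) {α : Type*} [MeasurableSpace α]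
    {g : α → Covariate p → ℝ} (hg : Measurable (Function.uncurry g)) :
    Measurable fun u => ipwVar P e (g u) := by
  have h1 := (measurable_centered (P := P) (g := g) he hg).comp
    (measurable_fst.prodMk (measurable_observe.comp measurable_snd))
  exact (h1.pow_const 2).stronglyMeasurable.integral_prod_right'.measurable

/-- The σ-algebra generated by the first `n` observations. -/
abbrev dataSigma (Z : ℕ → Ω → Record p) (n : ℕ) : MeasurableSpace Ω :=
  MeasurableSpace.comap (dataset Z n) inferInstance

/-- The conditional variance, given the past, of a weighted sum over fresh units. -/
theorem condVar_sum_ipw (he : Measurable e) (hZm : ∀ i, Measurable (Z i))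
    (hZind : iIndepFun Z μ) (hZlaw : ∀ i, μ.map (Z i) = P)
    (hI : MemLp (fun w => ipw e (observe w)) 2 P) {n N : ℕ} (c : ℝ)
    {g : Ω → Covariate p → ℝ} (hg : DependsOnData Z n g) :
    condVar (dataSigma Z n)
      (fun ω => c * ∑ i ∈ Finset.Ico n N, ipw e (observe (Z i ω)) * g ω (Z i ω).1) μ
      =ᵐ[μ] fun ω => c ^ 2 * ((N - n : ℕ) * ipwVar P e (g ω)) := by
  have hU := measurable_dataset hZm n
  have hmle := hU.comap_le
  have hcen : ∀ i, MemLp (fun ω => centered P e (g ω) (observe (Z i ω))) 2 μ := fun i =>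
    memLp_centered he hZm hZlaw hI hg
  have hgb := hg.bddMeas
  obtain ⟨g', hm, ⟨M, hM⟩, hg⟩ := hg
  let F : (Fin n → Obs p) × (Finset.Ico n N → Record p) → ℝ := fun q =>
    c * ∑ i : Finset.Ico n N, centered P e (g' q.1) (observe (q.2 i))
  have hF : Measurable F := by
    refine (Finset.measurable_sum _ fun i _ => ?_).const_mul c
    have hev : Measurable fun v : Finset.Ico n N → Record p => v i := measurable_pi_apply i
    have h1 := (measurable_centered (P := P) (g := g') he hm).comp
      (measurable_fst.prodMk (measurable_observe.comp (hev.comp measurable_snd)))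
    exact h1
  -- The weighted sum is `Y` plus its conditional mean, a function of the data. So the conditional
  -- variance is the conditional second moment of `Y`, computed by freezing the data.
  let Y : Ω → ℝ := fun ω => c * ∑ i ∈ Finset.Ico n N, centered P e (g ω) (observe (Z i ω))
  have hFY : ∀ ω, F (dataset Z n ω, fun i => Z i ω) = Y ω := fun ω => by
    simp only [F, Y, hg]
    rw [Finset.sum_coe_sort (Finset.Ico n N)
      fun i => centered P e (g' (dataset Z n ω)) (observe (Z i ω))]
  have hFY' : ∀ ω ω', F (dataset Z n ω, fun i => Z i ω')
      = c * ∑ i ∈ Finset.Ico n N, centered P e (g ω) (observe (Z i ω')) := fun ω ω' => by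
    simp only [F, hg]
    rw [Finset.sum_coe_sort (Finset.Ico n N)
      fun i => centered P e (g' (dataset Z n ω)) (observe (Z i ω'))]
  have hY2 : MemLp Y 2 μ := (memLp_finsetSum _ fun i _ => hcen i).const_mul c
  have hW : Measurable fun ω (i : Finset.Ico n N) => Z i ω := measurable_pi_lambda _ fun i => hZm i
  have hind := indepFun_dataset_Ico hZm hZind n N
  have hc1 : μ[Y | dataSigma Z n] =ᵐ[μ] 0 := by
    have h1 := condExp_indepFun hU hW hind hF.stronglyMeasurable
      ((hY2.integrable one_le_two).congr (ae_of_all _ fun ω => (hFY ω).symm))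
    simp_rw [hFY, hFY'] at h1
    filter_upwards [h1] with ω hω
    rw [hω, integral_const_mul, integral_finsetSum]
    · rw [Finset.sum_eq_zero, mul_zero]
      · rfl
      intro i _
      rw [integral_comp_unit hZm hZlaw (measurable_centered_observe he (hgb ω).1),
        integral_centered hI (hgb ω)]
    · intro i _
      exact (memLp_centered he hZm hZlaw hI (dependsOnData_const (hgb ω) 0)).integrable one_le_two
  have hc2 : μ[fun ω => Y ω ^ 2 | dataSigma Z n]
      =ᵐ[μ] fun ω => c ^ 2 * ((N - n : ℕ) * ipwVar P e (g ω)) := by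
    have h1 := condExp_indepFun hU hW hind (hF.pow_const 2).stronglyMeasurable
      (hY2.integrable_sq.congr (ae_of_all _ fun ω => by simp only [hFY]))
    simp_rw [hFY, hFY'] at h1
    filter_upwards [h1] with ω hω
    rw [hω]
    simp_rw [mul_pow]
    rw [integral_const_mul, integral_sum_centered_sq he hZm hZind hZlaw hI (Finset.Ico n N)
      (g := fun _ _ => g ω) fun i _ => dependsOnData_const (hgb ω) i]
    simp
  have hR : StronglyMeasurable[dataSigma Z n] fun ω => c * ((N - n : ℕ) * ipwMean P e (g ω)) := by
    simp_rw [hg]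
    exact ((((measurable_ipwMean he hm).const_mul _).const_mul c).comp
      (comap_measurable (dataset Z n))).stronglyMeasurable
  have hRi : Integrable (fun ω => c * ((N - n : ℕ) * ipwMean P e (g ω))) μ := by
    refine Integrable.const_mul (Integrable.const_mul (Integrable.of_bound ?_
      (M * ∫ w, ‖ipw e (observe w)‖ ∂P) (ae_of_all _ fun ω => ?_)) _) c
    · simp_rw [hg]
      exact ((measurable_ipwMean he hm).comp hU).aestronglyMeasurable
    · exact abs_ipwMean_le_of_bound hI fun x => by rw [hg]; exact hM _ _
  have hX : (fun ω => c * ∑ i ∈ Finset.Ico n N, ipw e (observe (Z i ω)) * g ω (Z i ω).1)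
      = Y + fun ω => c * ((N - n : ℕ) * ipwMean P e (g ω)) := by
    ext ω
    simp only [Y, Pi.add_apply, centered, Finset.sum_sub_distrib, Finset.sum_const, Nat.card_Ico,
      nsmul_eq_mul]
    simp only [observe]
    ring
  rw [hX]
  have hcX := condExp_add (hY2.integrable one_le_two) hRi (dataSigma Z n)
  rw [condExp_of_stronglyMeasurable hmle hR hRi] at hcX
  refine (condExp_congr_ae ?_).trans hc2
  filter_upwards [hcX, hc1] with ω h1 h2
  simp only [Pi.pow_apply, Pi.sub_apply, h1, Pi.add_apply, h2, Pi.zero_apply]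
  ring

/-- The first `n` units are spent on learning, so the sum has `M - n` terms but is scaled by `√M`.
The missing factor is an `n`-th power of something tending to one. -/
lemma tendsto_charFun_pow_sub {φ : ℝ → ℂ} (hφ : Continuous φ) (hφ0 : φ 0 = 1) (u : ℝ) (n : ℕ)
    {L : ℂ} (h : Tendsto (fun M : ℕ => φ ((√M)⁻¹ * u) ^ M) atTop (𝓝 L)) :
    Tendsto (fun M : ℕ => φ ((√M)⁻¹ * u) ^ (M - n)) atTop (𝓝 L) := by
  have h0 : Tendsto (fun M : ℕ => (√(M : ℝ))⁻¹ * u) atTop (𝓝 0) := by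
    rw [← zero_mul u]
    exact .mul_const u (tendsto_inv_atTop_zero.comp <| Real.tendsto_sqrt_atTop.comp <|
      tendsto_natCast_atTop_atTop)
  have h1 : Tendsto (fun M : ℕ => φ ((√M)⁻¹ * u)) atTop (𝓝 1) := by
    rw [← hφ0]; exact (hφ.tendsto 0).comp h0
  have h2 := h.div (h1.pow n) (by simp)
  rw [one_pow, div_one] at h2
  refine h2.congr' ?_
  filter_upwards [eventually_ge_atTop n, h1.eventually_ne one_ne_zero] with M hM hne
  simp only [Pi.div_apply]
  rw [div_eq_iff (pow_ne_zero _ hne), ← pow_add, Nat.sub_add_cancel hM]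

/-- The standardized sum of the centered weighted outcomes of the units `n, …, M - 1`, with a weight
function that depends on the first `n` units. -/
def standardizedSum (P : Measure (Record p)) (e : Covariate p → ℝ) (Z : ℕ → Ω → Record p)
    (g : Ω → Covariate p → ℝ) (n M : ℕ) (ω : Ω) : ℝ :=
  (√M)⁻¹ * ∑ i ∈ Finset.Ico n M, centered P e (g ω) (observe (Z i ω)) / √(ipwVar P e (g ω))

lemma measurable_standardizedSum (he : Measurable e) (hZm : ∀ i, Measurable (Z i)) {n M : ℕ}
    {g : Ω → Covariate p → ℝ} (hg : DependsOnData Z n g) :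
    Measurable (standardizedSum P e Z g n M) := by
  obtain ⟨g', hm, -, hg⟩ := hg
  unfold standardizedSum
  simp_rw [hg]
  refine (Finset.measurable_sum _ fun i _ => ?_).const_mul _
  have h1 := (measurable_centered (P := P) (g := g') he hm).comp
    ((measurable_dataset hZm n).prodMk (measurable_observe.comp (hZm i)))
  have h2 := ((measurable_ipwVar (P := P) he hm).comp (measurable_dataset hZm n)).sqrt
  exact h1.div h2

omit [IsProbabilityMeasure μ] [IsProbabilityMeasure P] in
lemma charFun_map_sum_unit (hZm : ∀ i, Measurable (Z i))
    (hZind : iIndepFun Z μ) (hZlaw : ∀ i, μ.map (Z i) = P) {f : Record p → ℝ} (hf : Measurable f)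
    (s : Finset ℕ) (u : ℝ) :
    charFun (μ.map fun ω => ∑ i ∈ s, f (Z i ω)) u = charFun (P.map f) u ^ s.card := by
  have h1 := (hZind.comp (fun _ => f) fun _ => hf).restrict s
  rw [iIndepFun.charFun_map_fun_finsetSum_eq_prod (X := fun i ω => f (Z i ω))
    (fun i _ => (hf.comp (hZm i)).aemeasurable) h1, Finset.prod_apply]
  rw [Finset.prod_congr rfl (g := fun _ => charFun (P.map f) u), Finset.prod_const]
  intro i _
  rw [← hZlaw i, Measure.map_map hf (hZm i)]
  rfl

/-- The central limit theorem for a weight function that is learned from the first `n` units. -/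
theorem tendsto_charFun_standardizedSum (he : Measurable e) (hZm : ∀ i, Measurable (Z i))
    (hZind : iIndepFun Z μ) (hZlaw : ∀ i, μ.map (Z i) = P)
    (hI : MemLp (fun w => ipw e (observe w)) 2 P) {n : ℕ}
    {g : Ω → Covariate p → ℝ} (hg : DependsOnData Z n g)
    (hpos : ∀ᵐ ω ∂μ, 0 < ipwVar P e (g ω)) (u : ℝ) :
    Tendsto (fun M : ℕ => charFun (μ.map (standardizedSum P e Z g n M)) u) atTop
      (𝓝 (Complex.exp (-u ^ 2 / 2))) := by
  have hgm := hg
  have hgb := hg.bddMeas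
  obtain ⟨g', hm, -, hg⟩ := hg
  have hU := measurable_dataset hZm n
  let f : Ω → Record p → ℝ := fun ω w => centered P e (g ω) (observe w) / √(ipwVar P e (g ω))
  have hf : ∀ ω, Measurable (f ω) := fun ω =>
    (measurable_centered_observe he (hgb ω).1).div_const _
  -- With the first `n` units frozen, the summands are i.i.d. and the characteristic function is a
  -- power; Fubini averages it over the past.
  have hfix : ∀ M : ℕ, charFun (μ.map (standardizedSum P e Z g n M)) u
      = ∫ ω, charFun (P.map (f ω)) ((√M)⁻¹ * u) ^ (M - n) ∂μ := by
    intro M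
    have hW : Measurable fun ω (i : Finset.Ico n M) => Z i ω :=
      measurable_pi_lambda _ fun i => hZm i
    let F : (Fin n → Obs p) × (Finset.Ico n M → Record p) → ℝ := fun q =>
      (√M)⁻¹ * ∑ i : Finset.Ico n M, centered P e (g' q.1) (observe (q.2 i))
        / √(ipwVar P e (g' q.1))
    have hF : Measurable F := by
      refine (Finset.measurable_sum _ fun i _ => ?_).const_mul _
      have hfst : Measurable (Prod.fst : (Fin n → Obs p) × (Finset.Ico n M → Record p) → _) :=
        measurable_fst
      have hev : Measurable fun v : Finset.Ico n M → Record p => v i := measurable_pi_apply i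
      have h1 := (measurable_centered (P := P) (g := g') he hm).comp (measurable_fst.prodMk
        (measurable_observe.comp (hev.comp measurable_snd)))
      have h2 := ((measurable_ipwVar (P := P) he hm).comp hfst).sqrt
      exact h1.div h2
    have hG : Measurable fun q => Complex.exp (u * (F q : ℂ) * Complex.I) := by fun_prop
    have hFY : ∀ ω, F (dataset Z n ω, fun i => Z i ω) = standardizedSum P e Z g n M ω := fun ω => by
      simp only [F, standardizedSum, hg]
      rw [Finset.sum_coe_sort (Finset.Ico n M) fun i =>
        centered P e (g' (dataset Z n ω)) (observe (Z i ω)) / √(ipwVar P e (g' (dataset Z n ω)))]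
    have hFY' : ∀ ω ω', F (dataset Z n ω, fun i => Z i ω')
        = (√M)⁻¹ * ∑ i ∈ Finset.Ico n M, f ω (Z i ω') := fun ω ω' => by
      simp only [F, f, hg]
      rw [Finset.sum_coe_sort (Finset.Ico n M) fun i =>
        centered P e (g' (dataset Z n ω)) (observe (Z i ω')) / √(ipwVar P e (g' (dataset Z n ω)))]
    have hS := measurable_standardizedSum (P := P) (M := M) he hZm hgm
    rw [charFun_apply_real, integral_map hS.aemeasurable (by fun_prop)]
    have h1 := integral_indepFun (μ := μ) hU hW (indepFun_dataset_Ico hZm hZind n M)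
      hG.stronglyMeasurable (Integrable.of_bound
        ((hG.comp (hU.prodMk hW)).aestronglyMeasurable) 1 (ae_of_all _ fun ω => by
          rw [← Complex.ofReal_mul, Complex.norm_exp_ofReal_mul_I]))
    simp_rw [hFY, hFY'] at h1
    rw [h1]
    refine integral_congr_ae (ae_of_all _ fun ω => ?_)
    have hsum : Measurable fun ω' => ∑ i ∈ Finset.Ico n M, f ω (Z i ω') :=
      Finset.measurable_sum _ fun i _ => (hf ω).comp (hZm i)
    have h2 := charFun_map_sum_unit hZm hZind hZlaw (hf ω) (Finset.Ico n M) ((√M)⁻¹ * u)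
    rw [Nat.card_Ico, ← charFun_map_mul_comp hsum.aemeasurable, charFun_apply_real,
      integral_map (hsum.const_mul _).aemeasurable (by fun_prop)] at h2
    exact h2
  simp_rw [hfix]
  have hlim : Complex.exp (-u ^ 2 / 2) = ∫ _, Complex.exp (-(u : ℂ) ^ 2 / 2) ∂μ := by simp
  rw [hlim]
  have hprob : ∀ ω, IsProbabilityMeasure (P.map (f ω)) := fun ω =>
    Measure.isProbabilityMeasure_map (hf ω).aemeasurable
  -- The integrands are bounded by one and have the same limit for almost every past, by the i.i.d.
  -- theorem for the unit-variance variable `f ω`.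
  refine tendsto_integral_of_dominated_convergence (fun _ => (1 : ℝ)) (fun M => ?_)
    (integrable_const _) (fun M => ae_of_all _ fun ω => ?_) ?_
  · have hG : StronglyMeasurable fun q : Ω × Record p =>
        Complex.exp (((√M)⁻¹ * u : ℝ) * (f q.1 q.2 : ℂ) * Complex.I) := by
      have h1 := (measurable_centered (P := P) (g := g') he hm).comp
        ((hU.comp measurable_fst).prodMk (measurable_observe.comp measurable_snd))
      have hfst : Measurable (Prod.fst : Ω × Record p → Ω) := measurable_fst
      have h2 := (((measurable_ipwVar (P := P) he hm).comp hU).comp hfst).sqrt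
      have h3 : Measurable fun q : Ω × Record p => f q.1 q.2 := by
        simp only [f, hg]; exact h1.div h2
      exact Measurable.stronglyMeasurable (by fun_prop)
    refine AEStronglyMeasurable.pow ?_ _
    refine (hG.integral_prod_right' (ν := P)).aestronglyMeasurable.congr (ae_of_all _ fun ω => ?_)
    simp only
    rw [charFun_apply_real, integral_map (hf ω).aemeasurable (by fun_prop)]
  · rw [norm_pow]
    exact pow_le_one₀ (norm_nonneg _) (norm_charFun_le_one _)
  · filter_upwards [hpos] with ω hω
    refine tendsto_charFun_pow_sub continuous_charFun (by simp) u n ?_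
    refine tendsto_charFun_inv_sqrt_mul_pow (hf ω).aemeasurable ?_ ?_ u
    · simp only [f]
      rw [integral_div, integral_centered hI (hgb ω), zero_div]
    · simp only [f, Pi.pow_apply, div_pow, Real.sq_sqrt hω.le]
      rw [integral_div, integral_centered_sq, div_self hω.ne']

end Conditional

end

end Cram

namespace Cram

noncomputable section

/-! ### Closure properties of data-dependent weights. -/

section Closure

variable {p : ℕ} {Ω : Type*} {Z : ℕ → Ω → Record p} {n : ℕ}

lemma DependsOnData.sub {g h : Ω → Covariate p → ℝ} (hg : DependsOnData Z n g)
    (hh : DependsOnData Z n h) : DependsOnData Z n fun ω x => g ω x - h ω x := by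
  obtain ⟨g', hgm, ⟨M, hM⟩, hg⟩ := hg
  obtain ⟨h', hhm, ⟨N, hN⟩, hh⟩ := hh
  exact ⟨fun u x => g' u x - h' u x, hgm.sub hhm,
    ⟨M + N, fun u x => (abs_sub _ _).trans (add_le_add (hM u x) (hN u x))⟩,
    fun ω => by simp only [hg, hh]⟩

lemma DependsOnData.const_mul {g : Ω → Covariate p → ℝ} (hg : DependsOnData Z n g) (c : ℝ) :
    DependsOnData Z n fun ω x => c * g ω x := by
  obtain ⟨g', hgm, ⟨M, hM⟩, hg⟩ := hg
  exact ⟨fun u x => c * g' u x, hgm.const_mul c,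
    ⟨|c| * M, fun u x => by rw [abs_mul]; gcongr; exact hM u x⟩, fun ω => by simp only [hg]⟩

lemma DependsOnData.sum {ι : Type*} {s : Finset ι} {g : ι → Ω → Covariate p → ℝ}
    (hg : ∀ i ∈ s, DependsOnData Z n (g i)) : DependsOnData Z n fun ω x => ∑ i ∈ s, g i ω x := by
  classical
  induction s using Finset.induction_on with
  | empty =>
    simp only [Finset.sum_empty]
    exact dependsOnData_const ⟨measurable_const, 0, fun _ => by rw [abs_zero]⟩ n
  | insert a s ha ih =>
    have h1 := hg a (Finset.mem_insert_self a s)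
    have h2 := (ih fun i hi => hg i (Finset.mem_insert_of_mem hi)).const_mul (-1)
    have h3 : (fun ω x => ∑ i ∈ insert a s, g i ω x)
        = fun ω x => g a ω x - -1 * ∑ i ∈ s, g i ω x := by
      ext ω x
      rw [Finset.sum_insert ha]; ring
    rw [h3]
    exact h1.sub h2

end Closure

/-! ### The estimator as a weighted sum over units. -/

section Structure

variable {p : ℕ} {Ω : Type*} {Z : ℕ → Ω → Record p}
  {A : LearningAlgorithm p} {π0 : Policy p} {B : ℕ} {e : Covariate p → ℝ}

/-- The probability of treatment under the policy learned from `t` batches. -/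
def prob (A : LearningAlgorithm p) (π0 : Policy p) (B : ℕ) (Z : ℕ → Ω → Record p) (ω : Ω) (t : ℕ)
    (x : Covariate p) : ℝ := (learned A π0 B Z t ω x : ℝ)

lemma prob_mem (ω : Ω) (t : ℕ) (x : Covariate p) :
    prob A π0 B Z ω t x ∈ Set.Icc (0 : ℝ) 1 := (learned A π0 B Z t ω x).2

/-- The weight function of the batch `j` in the crammed estimator. -/
def batchWeight (A : LearningAlgorithm p) (π0 : Policy p) (B : ℕ) (Z : ℕ → Ω → Record p) (T j : ℕ)
    (ω : Ω) (x : Covariate p) : ℝ := weight (fun t => prob A π0 B Z ω t x) T j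

/-- The reference weight function of the batch `j`. -/
def batchRef (A : LearningAlgorithm p) (π0 : Policy p) (B : ℕ) (Z : ℕ → Ω → Record p) (J j : ℕ)
    (ω : Ω) (x : Covariate p) : ℝ := refWeight (fun t => prob A π0 B Z ω t x) J j

/-- The difference of the policy learned from `J` batches and of the baseline. -/
def policyGap (A : LearningAlgorithm p) (π0 : Policy p) (B : ℕ) (Z : ℕ → Ω → Record p) (J : ℕ)
    (ω : Ω) (x : Covariate p) : ℝ := prob A π0 B Z ω J x - prob A π0 B Z ω 0 x

lemma measurable_prob_apply (hπ0 : Measurable π0)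
    (hA : ∀ n, Measurable (fun q : (Fin n → Obs p) × Covariate p => A n q.1 q.2)) (ω : Ω) (t : ℕ) :
    Measurable (prob A π0 B Z ω t) := measurable_learned_apply hπ0 hA t ω

lemma dependsOnData_prob (hπ0 : Measurable π0)
    (hA : ∀ n, Measurable (fun q : (Fin n → Obs p) × Covariate p => A n q.1 q.2)) {t n : ℕ}
    (h : t * B ≤ n) : DependsOnData Z n fun ω x => prob A π0 B Z ω t x :=
  ⟨fun u x => prob A π0 B (unitsOf n) u t x, measurable_learned (measurable_unitsOf n) hπ0 hA t,
    ⟨1, fun u x => by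
      rw [abs_of_nonneg (prob_mem u t x).1]; exact (prob_mem u t x).2⟩,
    fun ω => by ext x; simp only [prob, learned_unitsOf h]⟩

lemma dependsOnData_policyGap (hπ0 : Measurable π0)
    (hA : ∀ n, Measurable (fun q : (Fin n → Obs p) × Covariate p => A n q.1 q.2)) {J n : ℕ}
    (h : J * B ≤ n) : DependsOnData Z n (policyGap A π0 B Z J) :=
  (dependsOnData_prob hπ0 hA h).sub (dependsOnData_prob hπ0 hA (by simp))

lemma dependsOnData_batchWeight (hπ0 : Measurable π0)
    (hA : ∀ n, Measurable (fun q : (Fin n → Obs p) × Covariate p => A n q.1 q.2)) (T : ℕ) {j n : ℕ}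
    (h : (j - 1) * B ≤ n) : DependsOnData Z n (batchWeight A π0 B Z T j) := by
  refine DependsOnData.sum (s := Finset.Icc 1 (j - 1))
    (g := fun t ω x => (1 / ((T : ℝ) - t)) * (prob A π0 B Z ω t x - prob A π0 B Z ω (t - 1) x))
    fun t ht => DependsOnData.const_mul (DependsOnData.sub
      (dependsOnData_prob hπ0 hA ?_) (dependsOnData_prob hπ0 hA ?_)) _
  · exact (Nat.mul_le_mul_right B (Finset.mem_Icc.1 ht).2).trans h
  · exact (Nat.mul_le_mul_right B ((Nat.sub_le t 1).trans (Finset.mem_Icc.1 ht).2)).trans h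

lemma dependsOnData_batchRef (hπ0 : Measurable π0)
    (hA : ∀ n, Measurable (fun q : (Fin n → Obs p) × Covariate p => A n q.1 q.2)) (J : ℕ) {j n : ℕ}
    (h : (j - 1) * B ≤ n) : DependsOnData Z n (batchRef A π0 B Z J j) := by
  by_cases hj : J < j
  · have : batchRef A π0 B Z J j = policyGap A π0 B Z J := by
      ext ω x; simp [batchRef, refWeight, policyGap, hj]
    rw [this]
    exact dependsOnData_policyGap hπ0 hA ((Nat.mul_le_mul_right B (by omega)).trans h)
  · have : batchRef A π0 B Z J j = fun _ _ => 0 := by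
      ext ω x; simp [batchRef, refWeight, hj]
    rw [this]
    exact dependsOnData_const ⟨measurable_const, 0, by simp⟩ n

lemma gammaJ_eq (T j : ℕ) (ω : Ω) :
    gammaJ e A π0 B Z T j ω
      = (1 / (B : ℝ)) * ∑ i ∈ Finset.Ico ((j - 1) * B) (j * B),
        ipw e (observe (Z i ω)) * batchWeight A π0 B Z T j ω (Z i ω).1 := by
  simp only [gammaJ, gammaTJ, batchWeight, weight, prob, batch, Finset.mul_sum]
  rw [Finset.sum_comm]
  refine Finset.sum_congr rfl fun i _ => Finset.sum_congr rfl fun t _ => ?_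
  ring

lemma deltaHat_eq_sum_gammaJ (T : ℕ) (ω : Ω) :
    deltaHat e A π0 B Z T ω = ∑ j ∈ Finset.Icc 1 T, gammaJ e A π0 B Z T j ω := by
  simp only [deltaHat, deltaHatStep, gammaJ, Finset.mul_sum]
  refine (Finset.sum_comm' fun j t => ?_).symm
  simp only [Finset.mem_Icc]; omega

/-- Units are numbered from zero and batches from one, so unit `i` lies in batch `i / B + 1`. -/
lemma sum_batches (T : ℕ) (f : ℕ → ℕ → ℝ) :
    ∑ j ∈ Finset.Icc 1 T, ∑ i ∈ Finset.Ico ((j - 1) * B) (j * B), f j i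
      = ∑ i ∈ Finset.range (T * B), f (i / B + 1) i := by
  induction T with
  | zero => simp
  | succ T ih =>
    rw [Finset.sum_Icc_succ_top (by omega), ih, Finset.range_eq_Ico, Finset.range_eq_Ico,
      ← Finset.sum_Ico_consecutive _ (Nat.zero_le (T * B)) (Nat.mul_le_mul_right B (Nat.le_succ T)),
      Nat.add_sub_cancel]
    congr 1
    refine Finset.sum_congr rfl fun i hi => ?_
    rw [Finset.mem_Ico] at hi
    have : i / B = T := Nat.div_eq_of_lt_le hi.1 hi.2
    rw [this]

/-- The batches before that of unit `i` end no later than `i`, so its weight is known before the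
unit is drawn. -/
lemma batch_index_le (i : ℕ) : (i / B + 1 - 1) * B ≤ i := by
  rw [Nat.add_sub_cancel]; exact Nat.div_mul_le_self i B

end Structure

/-! ### Decomposition of the studentized estimator. -/

/-- The standing assumptions, with explicit constants. -/
structure Design {p : ℕ} {Ω : Type*} [MeasurableSpace Ω] (P : Measure (Record p)) (μ : Measure Ω)
    (e : Covariate p → ℝ) (Z : ℕ → Ω → Record p) (A : LearningAlgorithm p) (π0 : Policy p) (B : ℕ)
    (C s K δ : ℝ) : Prop where
  meas_e : Measurable e
  memLp_ipw : MemLp (fun w => ipw e (observe w)) 2 P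
  C_nonneg : 0 ≤ C
  ipw_sq_le : ∀ g : Covariate p → ℝ, BddMeas g →
    ∫ w, (ipw e (observe w) * g w.1) ^ 2 ∂P ≤ C * ∫ x, g x ^ 2 ∂(covLaw P)
  s_pos : 0 < s
  le_ipwVar : ∀ g : Covariate p → ℝ, BddMeas g → s * ∫ x, g x ^ 2 ∂(covLaw P) ≤ ipwVar P e g
  valueDiff_eq : ∀ π π' : Policy p, Measurable π → Measurable π' →
    valueDiff P π π' = ipwMean P e fun x => (π x : ℝ) - π' x
  meas_unit : ∀ i, Measurable (Z i)
  indep : iIndepFun Z μ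
  law : ∀ i, μ.map (Z i) = P
  meas_base : Measurable π0
  B_pos : 0 < B
  meas_alg : ∀ n, Measurable (fun q : (Fin n → Obs p) × Covariate p => A n q.1 q.2)
  K_nonneg : 0 ≤ K
  δ_pos : 0 < δ
  δ_le : δ ≤ 1
  stab : ∀ᵐ ω ∂μ, ∀ t, 1 ≤ t →
    ∫ x, |prob A π0 B Z ω t x - prob A π0 B Z ω (t - 1) x| ∂(covLaw P) ≤ K * (t : ℝ) ^ (-(1 + δ))

namespace Design

variable {p : ℕ} {Ω : Type*} [MeasurableSpace Ω] {P : Measure (Record p)} {μ : Measure Ω}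
  {e : Covariate p → ℝ} {Z : ℕ → Ω → Record p} {A : LearningAlgorithm p} {π0 : Policy p} {B : ℕ}
  {C s K δ : ℝ}

lemma ipwVar_le [IsProbabilityMeasure P] (D : Design P μ e Z A π0 B C s K δ) {g : Covariate p → ℝ}
    (hg : BddMeas g) :
    ipwVar P e g ≤ C * ∫ x, g x ^ 2 ∂(covLaw P) :=
  (Cram.ipwVar_le hg D.memLp_ipw).trans (D.ipw_sq_le g hg)

lemma integral_sq_le_one [IsProbabilityMeasure P] {g : Covariate p → ℝ} (hg : Measurable g)
    (h1 : ∀ x, |g x| ≤ 1) :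
    ∫ x, g x ^ 2 ∂(covLaw P) ≤ 1 := by
  have h2 : ∀ x, g x ^ 2 ≤ 1 := fun x => by
    rw [← sq_abs]; exact pow_le_one₀ (abs_nonneg _) (h1 x)
  have h3 := integral_mono (μ := covLaw P) (integrable_of_bounded (hg.pow_const 2) 1 fun x => by
    rw [abs_of_nonneg (sq_nonneg _)]; exact h2 x) (integrable_const 1) h2
  simpa using h3

omit [MeasurableSpace Ω] in
lemma abs_policyGap_le (J : ℕ) (ω : Ω) (x : Covariate p) : |policyGap A π0 B Z J ω x| ≤ 1 :=
  abs_sub_le_one (prob_mem _ _ _) (prob_mem _ _ _)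

lemma dependsOnData_weight (D : Design P μ e Z A π0 B C s K δ) (T i : ℕ) :
    DependsOnData Z i fun ω x => T * batchWeight A π0 B Z T (i / B + 1) ω x :=
  (dependsOnData_batchWeight D.meas_base D.meas_alg T (batch_index_le i)).const_mul T

lemma dependsOnData_ref (D : Design P μ e Z A π0 B C s K δ) (J i : ℕ) :
    DependsOnData Z i (batchRef A π0 B Z J (i / B + 1)) :=
  dependsOnData_batchRef D.meas_base D.meas_alg J (batch_index_le i)

/-- The rescaled conditional variance is the mean of the variances of the batches. -/
lemma asympSD_sq [IsProbabilityMeasure P] [IsProbabilityMeasure μ]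
    (D : Design P μ e Z A π0 B C s K δ) (T : ℕ) :
    ∀ᵐ ω ∂μ, asympSD μ e A π0 B Z T ω
      = √((1 / (T : ℝ)) * ((1 / (B : ℝ)) * ∑ j ∈ Finset.Icc 1 T,
        ipwVar P e fun x => T * batchWeight A π0 B Z T j ω x)) := by
  have hB : (B : ℝ) ≠ 0 := by exact_mod_cast D.B_pos.ne'
  have h1 : ∀ j, condVar (history B Z (j - 1)) (gammaJ e A π0 B Z T j) μ
      =ᵐ[μ] fun ω => (1 / (B : ℝ)) ^ 2 * ((j * B - (j - 1) * B : ℕ)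
        * ipwVar P e (batchWeight A π0 B Z T j ω)) := fun j => by
    have h2 := condVar_sum_ipw (N := j * B) D.meas_e D.meas_unit D.indep D.law D.memLp_ipw
      (1 / (B : ℝ)) (dependsOnData_batchWeight (B := B) (Z := Z) D.meas_base D.meas_alg T
        (le_refl ((j - 1) * B)))
    simp_rw [← gammaJ_eq] at h2
    exact h2
  have h2 := ae_all_iff.2 h1
  filter_upwards [h2] with ω hω
  have h3 : ∑ j ∈ Finset.Icc 2 T, condVar (history B Z (j - 1)) (gammaJ e A π0 B Z T j) μ ω
      = ∑ j ∈ Finset.Icc 1 T, (1 / (B : ℝ)) * ipwVar P e (batchWeight A π0 B Z T j ω) := by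
    -- A batch has `B` units, which cancels one of the two factors `1/B`.
    have h4 : ∀ j ∈ Finset.Icc 1 T, (1 / (B : ℝ)) ^ 2 * ((j * B - (j - 1) * B : ℕ)
        * ipwVar P e (batchWeight A π0 B Z T j ω))
        = (1 / (B : ℝ)) * ipwVar P e (batchWeight A π0 B Z T j ω) := fun j hj => by
      rw [Finset.mem_Icc] at hj
      rw [← Nat.sub_mul, Nat.sub_sub_self hj.1, one_mul]
      field_simp
    rw [← Finset.sum_congr rfl h4]
    -- The range may start at `1`: the weight of the first batch is an empty sum.
    refine (Finset.sum_congr rfl fun j _ => hω j).trans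
      (Finset.sum_subset (Finset.Icc_subset_Icc_left one_le_two) fun j hj hj2 => ?_)
    have : j = 1 := by
      rw [Finset.mem_Icc] at hj hj2; omega
    subst this
    have h0 : batchWeight A π0 B Z T 1 ω = fun _ => 0 := by
      ext x; simp [batchWeight, weight]
    simp [h0, ipwVar, ipwMean]
  unfold asympSD
  rw [h3]
  congr 1
  simp_rw [ipwVar_const_mul]
  rw [← Finset.mul_sum, ← Finset.mul_sum]
  rcases Nat.eq_zero_or_pos T with rfl | hT
  · simp
  · have : (T : ℝ) ≠ 0 := by exact_mod_cast hT.ne'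
    field_simp

/-- The main term of the comparison: the weights are replaced by their reference. -/
def remainder (P : Measure (Record p)) (e : Covariate p → ℝ) (A : LearningAlgorithm p)
    (π0 : Policy p) (B : ℕ) (Z : ℕ → Ω → Record p) (J T : ℕ) (ω : Ω) : ℝ :=
  (√T)⁻¹ * ((1 / (B : ℝ)) * ∑ i ∈ Finset.range (T * B),
    centered P e (fun x => T * batchWeight A π0 B Z T (i / B + 1) ω x
      - batchRef A π0 B Z J (i / B + 1) ω x) (observe (Z i ω)))

/-- The sum over the batches after `J`, with the weight function learned from `J` batches. -/
def mainSum (P : Measure (Record p)) (e : Covariate p → ℝ) (A : LearningAlgorithm p)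
    (π0 : Policy p) (B : ℕ) (Z : ℕ → Ω → Record p) (J T : ℕ) (ω : Ω) : ℝ :=
  (√T)⁻¹ * ((1 / (B : ℝ)) * ∑ i ∈ Finset.range (T * B),
    centered P e (batchRef A π0 B Z J (i / B + 1) ω) (observe (Z i ω)))

omit [MeasurableSpace Ω] in
lemma centered_sub [IsProbabilityMeasure P] {g h : Covariate p → ℝ} (hg : BddMeas g)
    (hh : BddMeas h) (hI : MemLp (fun w => ipw e (observe w)) 2 P) (o : Obs p) :
    centered P e (fun x => g x - h x) o = centered P e g o - centered P e h o := by
  simp only [centered, ipwMean_sub hg hh hI]; ring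

/-- The estimand splits into the last step, on which no batch is evaluated, and the sum of the means
of the batch weights. The latter centres every `Γ̂_j(T)`. The identity holds for every sample and
every `J`, which only decides how the weight is split into reference and rest. -/
lemma numerator_eq [IsProbabilityMeasure P]
    (D : Design P μ e Z A π0 B C s K δ) {T : ℕ} (hT : 1 ≤ T) (J : ℕ) (ω : Ω) :
    √T * (deltaHat e A π0 B Z T ω - valueDiff P (learned A π0 B Z T ω) π0)
      = mainSum P e A π0 B Z J T ω + remainder P e A π0 B Z J T ω
        - √T * ipwMean P e fun x => prob A π0 B Z ω T x - prob A π0 B Z ω (T - 1) x := by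
  have hB : (B : ℝ) ≠ 0 := by exact_mod_cast D.B_pos.ne'
  have hT0 : (0 : ℝ) < T := by exact_mod_cast hT
  have hprob : ∀ t, BddMeas (prob A π0 B Z ω t) := fun t =>
    (dependsOnData_prob D.meas_base D.meas_alg (le_refl (t * B))).bddMeas ω
  have hw : ∀ j, BddMeas (batchWeight A π0 B Z T j ω) := fun j =>
    (dependsOnData_batchWeight D.meas_base D.meas_alg T (le_refl ((j - 1) * B))).bddMeas ω
  have hlm : ∀ t, Measurable (learned A π0 B Z t ω) := fun t => by
    unfold learned
    split_ifs
    · exact D.meas_base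
    · exact (D.meas_alg (t * B)).comp measurable_prodMk_left
  have hv : valueDiff P (learned A π0 B Z T ω) π0
      = ipwMean P e (fun x => prob A π0 B Z ω T x - prob A π0 B Z ω (T - 1) x)
        + ∑ j ∈ Finset.Icc 1 T, ipwMean P e (batchWeight A π0 B Z T j ω) := by
    rw [D.valueDiff_eq _ _ (hlm T) D.meas_base, ← ipwMean_sum _ (fun j _ => hw j) D.memLp_ipw]
    have h1 : (fun x => ∑ j ∈ Finset.Icc 1 T, batchWeight A π0 B Z T j ω x)
        = fun x => prob A π0 B Z ω (T - 1) x - prob A π0 B Z ω 0 x := by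
      ext x; exact sum_weight _ T
    rw [h1, ipwMean_sub (hprob _) (hprob _) D.memLp_ipw,
      ipwMean_sub (hprob _) (hprob _) D.memLp_ipw]
    have h2 : (fun x => (learned A π0 B Z T ω x : ℝ) - (π0 x : ℝ))
        = fun x => prob A π0 B Z ω T x - prob A π0 B Z ω 0 x := by
      ext x; simp [prob, learned]
    rw [h2, ipwMean_sub (hprob _) (hprob _) D.memLp_ipw]
    ring
  have hsum : mainSum P e A π0 B Z J T ω + remainder P e A π0 B Z J T ω
      = (√T)⁻¹ * ((1 / (B : ℝ)) * ∑ i ∈ Finset.range (T * B),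
          centered P e (fun x => T * batchWeight A π0 B Z T (i / B + 1) ω x)
            (observe (Z i ω))) := by
    rw [mainSum, remainder, ← mul_add, ← mul_add, ← Finset.sum_add_distrib]
    congr 2
    refine Finset.sum_congr rfl fun i _ => ?_
    rw [centered_sub ((D.dependsOnData_weight T i).bddMeas ω) ((D.dependsOnData_ref J i).bddMeas ω)
      D.memLp_ipw]
    ring
  rw [hsum, hv, ← sum_batches T fun j i =>
    centered P e (fun x => T * batchWeight A π0 B Z T j ω x) (observe (Z i ω)),
    deltaHat_eq_sum_gammaJ]
  have hj : ∀ j ∈ Finset.Icc 1 T, (1 / (B : ℝ)) * ∑ i ∈ Finset.Ico ((j - 1) * B) (j * B),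
      centered P e (fun x => T * batchWeight A π0 B Z T j ω x) (observe (Z i ω))
      = T * (gammaJ e A π0 B Z T j ω - ipwMean P e (batchWeight A π0 B Z T j ω)) := by
    intro j hj
    rw [Finset.mem_Icc] at hj
    rw [gammaJ_eq]
    simp only [centered, ipwMean_const_mul, Finset.sum_sub_distrib, Finset.sum_const, Nat.card_Ico]
    rw [← Nat.sub_mul, Nat.sub_sub_self hj.1, one_mul, nsmul_eq_mul, mul_sub, mul_sub,
      ← mul_assoc (1 / (B : ℝ)) (B : ℝ), one_div_mul_cancel hB, one_mul,
      ← mul_assoc (T : ℝ), mul_comm (T : ℝ) (1 / (B : ℝ)), mul_assoc, Finset.mul_sum _ _ (T : ℝ)]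
    congr 2
    refine Finset.sum_congr rfl fun i _ => ?_
    simp only [observe]; ring
  rw [Finset.mul_sum (Finset.Icc 1 T), Finset.sum_congr rfl hj, ← Finset.mul_sum,
    Finset.sum_sub_distrib, ← mul_assoc, inv_mul_eq_div, Real.div_sqrt]
  ring

/-- The main sum, divided by the limit of the standard deviations, is a standardized sum. -/
lemma mainSum_div (D : Design P μ e Z A π0 B C s K δ) (J T : ℕ) (ω : Ω) :
    mainSum P e A π0 B Z J T ω / √((1 / (B : ℝ)) * ipwVar P e (policyGap A π0 B Z J ω))
      = standardizedSum P e Z (policyGap A π0 B Z J) (J * B) (T * B) ω := by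
  have hB0 : (0 : ℝ) < B := by exact_mod_cast D.B_pos
  have h1 : ∑ i ∈ Finset.range (T * B),
      centered P e (batchRef A π0 B Z J (i / B + 1) ω) (observe (Z i ω))
      = ∑ i ∈ Finset.Ico (J * B) (T * B),
        centered P e (policyGap A π0 B Z J ω) (observe (Z i ω)) := by
    have h2 : Finset.Ico (J * B) (T * B) = (Finset.range (T * B)).filter (J * B ≤ ·) := by
      ext i; simp only [Finset.mem_Ico, Finset.mem_filter, Finset.mem_range]; tauto
    rw [h2, Finset.sum_filter]
    refine Finset.sum_congr rfl fun i _ => ?_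
    -- The reference weight switches on exactly at the first unit after the first `J` batches.
    have h3 : J < i / B + 1 ↔ J * B ≤ i := by
      rw [Nat.lt_succ_iff, Nat.le_div_iff_mul_le D.B_pos]
    split_ifs with h
    · have : batchRef A π0 B Z J (i / B + 1) ω = policyGap A π0 B Z J ω := by
        ext x; simp only [batchRef, refWeight, if_pos (h3.2 h), policyGap]
      rw [this]
    · have : batchRef A π0 B Z J (i / B + 1) ω = fun _ => 0 := by
        ext x; simp only [batchRef, refWeight, if_neg (mt h3.1 h)]
      simp [this, centered, ipwMean]
  rw [mainSum, h1, standardizedSum, ← Finset.sum_div, Real.sqrt_mul (by positivity),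
    Nat.cast_mul, Real.sqrt_mul (by positivity), one_div, Real.sqrt_inv]
  have hs : √(B : ℝ) * √(B : ℝ) = B := Real.mul_self_sqrt hB0.le
  have hs0 : √(B : ℝ) ≠ 0 := (Real.sqrt_pos.2 hB0).ne'
  -- Dividing by `√(1/B)` turns the batch average `1/B` into `1/√B`; with `1/√T` this is the scaling
  -- for `T * B` units.
  have h4 : (B : ℝ)⁻¹ * √(B : ℝ) = (√(B : ℝ))⁻¹ := by
    rw [← hs, mul_inv]
    simp [hs0]
  set S := ∑ i ∈ Finset.Ico (J * B) (T * B),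
    centered P e (policyGap A π0 B Z J ω) (observe (Z i ω))
  have h5 : (√(T : ℝ))⁻¹ * ((B : ℝ)⁻¹ * S)
        / ((√(B : ℝ))⁻¹ * √(ipwVar P e (policyGap A π0 B Z J ω)))
      = (√(T : ℝ))⁻¹ * (((B : ℝ)⁻¹ * √(B : ℝ))
        * (S / √(ipwVar P e (policyGap A π0 B Z J ω)))) := by
    simp only [div_eq_mul_inv, mul_inv, inv_inv]; ring
  rw [h5, h4, mul_inv, mul_assoc]

end Design

end

end Cram

namespace Cram

noncomputable section

/-! ### Error bounds: pathwise along stable samples, and in mean square. -/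

namespace Design

variable {p : ℕ} {Ω : Type*} [MeasurableSpace Ω] {P : Measure (Record p)} {μ : Measure Ω}
  {e : Covariate p → ℝ} {Z : ℕ → Ω → Record p} {A : LearningAlgorithm p} {π0 : Policy p} {B : ℕ}
  {C s K δ : ℝ}

lemma bddMeas_gap (D : Design P μ e Z A π0 B C s K δ) (J : ℕ) (ω : Ω) :
    BddMeas (policyGap A π0 B Z J ω) :=
  (dependsOnData_policyGap D.meas_base D.meas_alg (le_refl (J * B))).bddMeas ω

lemma bddMeas_weight (D : Design P μ e Z A π0 B C s K δ) (T j : ℕ) (ω : Ω) :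
    BddMeas fun x => T * batchWeight A π0 B Z T j ω x :=
  ((dependsOnData_batchWeight D.meas_base D.meas_alg T (le_refl ((j - 1) * B))).const_mul T
    ).bddMeas ω

lemma bddMeas_ref (D : Design P μ e Z A π0 B C s K δ) (J j : ℕ) (ω : Ω) :
    BddMeas (batchRef A π0 B Z J j ω) :=
  (dependsOnData_batchRef D.meas_base D.meas_alg J (le_refl ((j - 1) * B))).bddMeas ω

lemma meas_prob (D : Design P μ e Z A π0 B C s K δ) (ω : Ω) (t : ℕ) :
    Measurable (prob A π0 B Z ω t) := measurable_prob_apply D.meas_base D.meas_alg ω t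

variable [IsProbabilityMeasure P]

lemma ipwVar_gap_le (D : Design P μ e Z A π0 B C s K δ) (J : ℕ) (ω : Ω) :
    ipwVar P e (policyGap A π0 B Z J ω) ≤ C :=
  (D.ipwVar_le (D.bddMeas_gap J ω)).trans (mul_le_of_le_one_right D.C_nonneg
    (integral_sq_le_one (D.bddMeas_gap J ω).1 (abs_policyGap_le J ω)))

omit [IsProbabilityMeasure P] in
lemma one_div_B_le (D : Design P μ e Z A π0 B C s K δ) : 1 / (B : ℝ) ≤ 1 := by
  have : (1 : ℝ) ≤ B := by exact_mod_cast D.B_pos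
  rw [div_le_one (by linarith)]; exact this

/-- The stabilization of the policies along one sample. -/
def Stable (P : Measure (Record p)) (A : LearningAlgorithm p) (π0 : Policy p) (B : ℕ)
    (Z : ℕ → Ω → Record p) (K δ : ℝ) (ω : Ω) : Prop := ∀ t, 1 ≤ t →
    ∫ x, |prob A π0 B Z ω t x - prob A π0 B Z ω (t - 1) x| ∂(covLaw P) ≤ K * (t : ℝ) ^ (-(1 + δ))

lemma mean_dist_le (D : Design P μ e Z A π0 B C s K δ) {ω : Ω} (hω : Stable P A π0 B Z K δ ω)
    {T : ℕ} (hT : 1 ≤ T) (J : ℕ) :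
    (1 / (T : ℝ)) * ∑ j ∈ Finset.Icc 1 T, ∫ x, (T * batchWeight A π0 B Z T j ω x
      - batchRef A π0 B Z J j ω x) ^ 2 ∂(covLaw P) ≤ distBound K δ J T :=
  sum_integral_sq_le_distBound (D.meas_prob ω) (prob_mem ω) D.K_nonneg D.δ_pos D.δ_le hω hT J

/-- The conditional variance is close to the variance for the policy learned from `J` batches. -/
lemma abs_variance_sub_le (D : Design P μ e Z A π0 B C s K δ) {ω : Ω}
    (hω : Stable P A π0 B Z K δ ω) {T : ℕ} (hT : 1 ≤ T) (J : ℕ) {θ : ℝ} (hθ : 0 < θ) :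
    |(1 / (T : ℝ)) * ((1 / (B : ℝ)) * ∑ j ∈ Finset.Icc 1 T,
        ipwVar P e fun x => T * batchWeight A π0 B Z T j ω x)
      - (1 / (B : ℝ)) * ipwVar P e (policyGap A π0 B Z J ω)|
      ≤ C * ((1 + 1 / θ) * distBound K δ J T + θ + J / T) := by
  have hT0 : (0 : ℝ) < T := by exact_mod_cast hT
  have hC := D.C_nonneg
  set V := ipwVar P e (policyGap A π0 B Z J ω) with hV
  let I : ℕ → ℝ := fun j => ∫ x, (T * batchWeight A π0 B Z T j ω x
      - batchRef A π0 B Z J j ω x) ^ 2 ∂(covLaw P)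
  -- Compare through the variance at the reference weight. Up to `J` the reference weight vanishes,
  -- which costs all of `V ≤ C`; after `J` it is the gap itself and costs nothing.
  have hj : ∀ j, |ipwVar P e (fun x => T * batchWeight A π0 B Z T j ω x) - V|
      ≤ C * ((1 + 1 / θ) * I j + θ + if j ≤ J then 1 else 0) := by
    intro j
    have h1 := abs_ipwVar_sub_le hθ (D.bddMeas_weight T j ω) (D.bddMeas_ref J j ω) D.memLp_ipw
      D.ipw_sq_le
    have h2 : ∫ x, batchRef A π0 B Z J j ω x ^ 2 ∂(covLaw P) ≤ 1 :=
      integral_sq_le_one (D.bddMeas_ref J j ω).1 fun x => abs_refWeight_le (fun t => prob_mem ω t x) J j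
    have h3 : |ipwVar P e (batchRef A π0 B Z J j ω) - V| ≤ C * if j ≤ J then 1 else 0 := by
      split_ifs with h
      · have : batchRef A π0 B Z J j ω = fun _ => 0 := by
          ext x; simp only [batchRef, refWeight, if_neg (not_lt.2 h)]
        have h0 : ipwVar P e (batchRef A π0 B Z J j ω) = 0 := by simp [this, ipwVar, ipwMean]
        rw [h0, zero_sub, abs_neg, abs_of_nonneg (ipwVar_nonneg _), mul_one]
        exact D.ipwVar_gap_le J ω
      · have : batchRef A π0 B Z J j ω = policyGap A π0 B Z J ω := by
          ext x; simp only [batchRef, refWeight, if_pos (not_le.1 h), policyGap]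
        rw [this, sub_self, abs_zero, mul_zero]
    calc _ ≤ |ipwVar P e (fun x => T * batchWeight A π0 B Z T j ω x)
              - ipwVar P e (batchRef A π0 B Z J j ω)|
            + |ipwVar P e (batchRef A π0 B Z J j ω) - V| := abs_sub_le _ _ _
      _ ≤ ((1 + 1 / θ) * (C * I j) + θ * (C * 1)) + C * (if j ≤ J then 1 else 0) := by
          refine add_le_add (h1.trans ?_) h3
          gcongr
      _ = _ := by ring
  have hcount := sum_ite_le_le T J
  have hd : (1 / (T : ℝ)) * ∑ j ∈ Finset.Icc 1 T, I j ≤ distBound K δ J T :=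
    D.mean_dist_le hω hT J
  have heq : (1 / (T : ℝ)) * ((1 / (B : ℝ)) * ∑ j ∈ Finset.Icc 1 T,
        ipwVar P e fun x => T * batchWeight A π0 B Z T j ω x) - (1 / (B : ℝ)) * V
      = (1 / (B : ℝ)) * ((1 / (T : ℝ)) * ∑ j ∈ Finset.Icc 1 T,
        (ipwVar P e (fun x => T * batchWeight A π0 B Z T j ω x) - V)) := by
    rw [Finset.sum_sub_distrib, Finset.sum_const, Nat.card_Icc, Nat.add_sub_cancel, nsmul_eq_mul,
      mul_sub (1 / (T : ℝ)), ← mul_assoc (1 / (T : ℝ)) (T : ℝ), one_div_mul_cancel hT0.ne']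
    ring
  rw [heq, abs_mul, abs_mul, abs_of_nonneg (by positivity : (0 : ℝ) ≤ 1 / B),
    abs_of_nonneg (by positivity : (0 : ℝ) ≤ 1 / T)]
  calc _ ≤ 1 * ((1 / (T : ℝ)) * ∑ j ∈ Finset.Icc 1 T,
          C * ((1 + 1 / θ) * I j + θ + if j ≤ J then 1 else 0)) := by
        gcongr
        · exact D.one_div_B_le
        · exact (Finset.abs_sum_le_sum_abs _ _).trans (Finset.sum_le_sum fun j _ => hj j)
    _ = C * ((1 + 1 / θ) * ((1 / (T : ℝ)) * ∑ j ∈ Finset.Icc 1 T, I j) + θ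
          + (1 / (T : ℝ)) * ∑ j ∈ Finset.Icc 1 T, (if j ≤ J then (1 : ℝ) else 0)) := by
        rw [← Finset.mul_sum, Finset.sum_add_distrib, Finset.sum_add_distrib, ← Finset.mul_sum,
          Finset.sum_const, Nat.card_Icc, Nat.add_sub_cancel, nsmul_eq_mul]
        field_simp
    _ ≤ C * ((1 + 1 / θ) * distBound K δ J T + θ + (1 / (T : ℝ)) * J) := by gcongr
    _ = _ := by ring

/-- The variance for the policy learned from `J` batches is bounded away from zero. -/
lemma le_ipwVar_gap (D : Design P μ e Z A π0 B C s K δ) {ω : Ω} (hω : Stable P A π0 B Z K δ ω)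
    {M : ℝ} (hlim : ∀ πlim : Policy p,
      IsLimitPolicy P (fun t => learned A π0 B Z t ω) πlim → M < policyDist P π0 πlim) {J : ℕ}
    (hJ : tailRate K δ J ≤ M / 2) (hM : 0 < M) :
    s * (M / 2) ^ 2 ≤ ipwVar P e (policyGap A π0 B Z J ω) := by
  have hm := D.meas_prob ω
  -- The assumption speaks of any limit policy there may be, so it only bites once one has been
  -- constructed.
  obtain ⟨f, hf, hf01, hft⟩ := exists_limit hm (prob_mem ω) D.δ_pos hω
  let πlim : Policy p := fun x => ⟨f x, hf01 x⟩
  have h1 : M < policyDist P π0 πlim :=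
    hlim πlim ⟨hf.subtype_mk, hft⟩
  have hpi0 : ∀ x, prob A π0 B Z ω 0 x = (π0 x : ℝ) := fun x => by simp [prob, learned]
  have hif : ∀ t, Integrable (fun x => |f x - prob A π0 B Z ω t x|) (covLaw P) := fun t =>
    integrable_of_bounded (by have := hm t; fun_prop) 1 fun x => by
      rw [abs_abs]; exact abs_sub_le_one (hf01 x) (prob_mem ω t x)
  -- The triangle inequality through the policy at time `n`, then `n → ∞`.
  have h2 : ∫ x, |f x - prob A π0 B Z ω J x| ∂(covLaw P) ≤ tailRate K δ J := by
    refine ge_of_tendsto (by simpa using hft.add_const (tailRate K δ J)) ?_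
    filter_upwards [eventually_ge_atTop J] with n hn
    refine le_trans ?_ (add_le_add_right (integral_abs_sub_le_tailRate hm (prob_mem ω)
      D.K_nonneg D.δ_pos hω hn) _)
    rw [← integral_add (hif n) (integrable_abs_sub hm (prob_mem ω) _ _)]
    exact integral_mono (hif J) ((hif n).add (integrable_abs_sub hm (prob_mem ω) _ _))
      fun x => abs_sub_le _ _ _
  have hgap := D.bddMeas_gap J ω
  have hig : Integrable (fun x => |policyGap A π0 B Z J ω x|) (covLaw P) :=
    integrable_abs_sub hm (prob_mem ω) _ _
  have h3 : M / 2 ≤ ∫ x, |policyGap A π0 B Z J ω x| ∂(covLaw P) := by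
    have h4 : policyDist P π0 πlim ≤ ∫ x, |policyGap A π0 B Z J ω x| ∂(covLaw P)
        + ∫ x, |f x - prob A π0 B Z ω J x| ∂(covLaw P) := by
      rw [policyDist, ← integral_add hig (hif J)]
      refine integral_mono_of_nonneg (ae_of_all _ fun x => abs_nonneg _) (hig.add (hif J))
        (ae_of_all _ fun x => ?_)
      simp only [policyGap, ← hpi0, πlim]
      rw [abs_sub_comm (prob A π0 B Z ω J x), abs_sub_comm (f x)]
      exact abs_sub_le _ _ _
    linarith
  -- The `L¹` distance bounds the `L²` distance from below, as the variance of the absolute gap is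
  -- nonnegative.
  have h5 : (∫ x, |policyGap A π0 B Z J ω x| ∂(covLaw P)) ^ 2
      ≤ ∫ x, policyGap A π0 B Z J ω x ^ 2 ∂(covLaw P) := by
    have h6 := variance_nonneg (fun x => |policyGap A π0 B Z J ω x|) (covLaw P)
    rw [variance_eq_sub (MemLp.of_bound (by have := hgap.1; fun_prop) 1
      (ae_of_all _ fun x => by
        rw [Real.norm_eq_abs, abs_abs]; exact abs_policyGap_le J ω x))] at h6
    simp only [Pi.pow_apply, sq_abs] at h6
    linarith
  refine le_trans ?_ (D.le_ipwVar _ hgap)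
  have := D.s_pos
  gcongr
  exact (pow_le_pow_left₀ (by positivity) h3 2).trans h5

/-- Differences of policies lie in `[-1, 1]`, so the mean square of the last step is at most its
`L¹` norm `K T^{-(1+δ)}`. Its root beats `√T` by `T^{-δ/2}`. -/
lemma abs_last_step_le (D : Design P μ e Z A π0 B C s K δ) {ω : Ω} (hω : Stable P A π0 B Z K δ ω)
    {T : ℕ} (hT : 1 ≤ T) :
    |√T * ipwMean P e fun x => prob A π0 B Z ω T x - prob A π0 B Z ω (T - 1) x|
      ≤ √(C * K * (T : ℝ) ^ (-δ)) := by
  have hT0 : (0 : ℝ) < T := by exact_mod_cast hT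
  have hprob : ∀ t, BddMeas (prob A π0 B Z ω t) := fun t =>
    (dependsOnData_prob D.meas_base D.meas_alg (le_refl (t * B))).bddMeas ω
  have hg := (hprob T).sub (hprob (T - 1))
  have hC := D.C_nonneg
  rw [abs_mul, abs_of_nonneg (Real.sqrt_nonneg _)]
  have h1 : ∫ x, (prob A π0 B Z ω T x - prob A π0 B Z ω (T - 1) x) ^ 2 ∂(covLaw P)
      ≤ K * (T : ℝ) ^ (-(1 + δ)) := by
    refine (integral_mono_of_nonneg (ae_of_all _ fun x => sq_nonneg _)
      (integrable_abs_sub (D.meas_prob ω) (prob_mem ω) T (T - 1))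
      (ae_of_all _ fun x => ?_)).trans (hω T hT)
    simp only
    rw [← sq_abs, sq]
    exact mul_le_of_le_one_left (abs_nonneg _) (abs_sub_le_one (prob_mem _ _ _) (prob_mem _ _ _))
  calc _ ≤ √T * √(C * (K * (T : ℝ) ^ (-(1 + δ)))) := by
        gcongr
        exact (abs_ipwMean_le hg D.memLp_ipw).trans
          (Real.sqrt_le_sqrt ((D.ipw_sq_le _ hg).trans (by gcongr)))
    _ = _ := by
        rw [← Real.sqrt_mul hT0.le]
        congr 1
        rw [show -(1 + δ) = -δ - 1 by ring, Real.rpow_sub_one hT0.ne']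
        field_simp

variable [IsProbabilityMeasure μ]

lemma integrable_ipwVar (D : Design P μ e Z A π0 B C s K δ) {n : ℕ} {g : Ω → Covariate p → ℝ}
    (hg : DependsOnData Z n g) : Integrable (fun ω => ipwVar P e (g ω)) μ := by
  have hgb := hg.bddMeas
  obtain ⟨g', hm, ⟨M, hM⟩, hg⟩ := hg
  have hb : ∀ ω x, |g ω x| ≤ M := fun ω x => by rw [hg]; exact hM _ x
  refine Integrable.of_bound ?_ (C * M ^ 2) (ae_of_all _ fun ω => ?_)
  · simp_rw [hg]
    exact ((measurable_ipwVar D.meas_e hm).comp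
      (measurable_dataset D.meas_unit n)).aestronglyMeasurable
  · rw [Real.norm_of_nonneg (ipwVar_nonneg _)]
    refine (D.ipwVar_le (hgb ω)).trans (mul_le_mul_of_nonneg_left ?_ D.C_nonneg)
    have h1 : ∀ x, g ω x ^ 2 ≤ M ^ 2 := fun x => by
      rw [← sq_abs]; exact pow_le_pow_left₀ (abs_nonneg _) (hb ω x) 2
    have h2 := integral_mono (μ := covLaw P) (integrable_of_bounded ((hgb ω).1.pow_const 2) (M ^ 2)
      fun x => by rw [abs_of_nonneg (sq_nonneg _)]; exact h1 x) (integrable_const (M ^ 2)) h1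
    simpa using h2

/-- The second moment of a normalized sum of centered outcomes with predictable weights. -/
lemma memLp_normalized (D : Design P μ e Z A π0 B C s K δ) (T : ℕ)
    {g : ℕ → Ω → Covariate p → ℝ} (hg : ∀ j, DependsOnData Z ((j - 1) * B) (g j)) :
    MemLp (fun ω => (√T)⁻¹ * ((1 / (B : ℝ)) * ∑ i ∈ Finset.range (T * B),
      centered P e (g (i / B + 1) ω) (observe (Z i ω)))) 2 μ :=
  ((memLp_finsetSum _ fun i _ => memLp_centered D.meas_e D.meas_unit D.law D.memLp_ipw
    (hg (i / B + 1))).const_mul _).const_mul _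

/-- By orthogonality the second moment is a sum of expected variances. The `B` units of a batch
share one weight, which leaves a factor `1/B ≤ 1` that is dropped. -/
lemma integral_normalized_sq_le (D : Design P μ e Z A π0 B C s K δ) {T : ℕ}
    {g : ℕ → Ω → Covariate p → ℝ} (hg : ∀ j, DependsOnData Z ((j - 1) * B) (g j)) {R : ℝ}
    (hR : ∀ᵐ ω ∂μ, (1 / (T : ℝ)) * ∑ j ∈ Finset.Icc 1 T, ∫ x, g j ω x ^ 2 ∂(covLaw P) ≤ R) :
    ∫ ω, ((√T)⁻¹ * ((1 / (B : ℝ)) * ∑ i ∈ Finset.range (T * B),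
      centered P e (g (i / B + 1) ω) (observe (Z i ω)))) ^ 2 ∂μ ≤ C * R := by
  have hB0 : (0 : ℝ) < B := by exact_mod_cast D.B_pos
  have hC := D.C_nonneg
  have h1 := integral_sum_centered_sq (g := fun i => g (i / B + 1)) D.meas_e D.meas_unit D.indep
    D.law D.memLp_ipw (Finset.range (T * B))
    fun i _ => (hg (i / B + 1)).mono (batch_index_le i)
  have hint := fun j => D.integrable_ipwVar (hg j)
  have hint2 : Integrable (fun ω => ∑ j ∈ Finset.Icc 1 T, ipwVar P e (g j ω)) μ :=
    integrable_finsetSum _ fun j _ => hint j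
  have h2 : ∑ i ∈ Finset.range (T * B), ∫ ω, ipwVar P e (g (i / B + 1) ω) ∂μ
      = B * ∫ ω, ∑ j ∈ Finset.Icc 1 T, ipwVar P e (g j ω) ∂μ := by
    rw [← sum_batches T fun j _ => ∫ ω, ipwVar P e (g j ω) ∂μ, integral_finsetSum _ fun j _ => hint j,
      Finset.mul_sum]
    refine Finset.sum_congr rfl fun j hj => ?_
    rw [Finset.mem_Icc] at hj
    rw [Finset.sum_const, Nat.card_Ico, ← Nat.sub_mul, Nat.sub_sub_self hj.1, one_mul, nsmul_eq_mul]
  simp_rw [mul_pow]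
  rw [integral_const_mul, integral_const_mul, h1, h2, inv_pow, Real.sq_sqrt (by positivity)]
  have h3 : (T : ℝ)⁻¹ * ((1 / (B : ℝ)) ^ 2 * (B * ∫ ω, ∑ j ∈ Finset.Icc 1 T, ipwVar P e (g j ω) ∂μ))
      = (1 / (B : ℝ)) * ∫ ω, (1 / (T : ℝ)) * ∑ j ∈ Finset.Icc 1 T, ipwVar P e (g j ω) ∂μ := by
    rw [integral_const_mul]; field_simp
  rw [h3]
  calc _ ≤ 1 * ∫ ω, (1 / (T : ℝ)) * ∑ j ∈ Finset.Icc 1 T, ipwVar P e (g j ω) ∂μ := by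
        gcongr
        · exact integral_nonneg fun ω => mul_nonneg (by positivity)
            (Finset.sum_nonneg fun j _ => ipwVar_nonneg _)
        · exact D.one_div_B_le
    _ ≤ ∫ _, C * R ∂μ := by
        rw [one_mul]
        refine integral_mono_ae (hint2.const_mul _) (integrable_const _) ?_
        filter_upwards [hR] with ω hω
        calc (1 / (T : ℝ)) * ∑ j ∈ Finset.Icc 1 T, ipwVar P e (g j ω)
            ≤ (1 / (T : ℝ)) * ∑ j ∈ Finset.Icc 1 T, C * ∫ x, g j ω x ^ 2 ∂(covLaw P) := by
              gcongr with j _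
              exact D.ipwVar_le ((hg j).bddMeas ω)
          _ = C * ((1 / (T : ℝ)) * ∑ j ∈ Finset.Icc 1 T, ∫ x, g j ω x ^ 2 ∂(covLaw P)) := by
              rw [← Finset.mul_sum]; ring
          _ ≤ C * R := by gcongr
    _ = C * R := by simp

lemma integral_abs_le_sqrt {f : Ω → ℝ} (hf : MemLp f 2 μ) : ∫ ω, |f ω| ∂μ ≤ √(∫ ω, f ω ^ 2 ∂μ) := by
  apply Real.le_sqrt_of_sq_le
  have h6 := variance_nonneg |f| μ
  rw [variance_eq_sub hf.abs] at h6
  simp only [Pi.pow_apply, Pi.abs_apply, sq_abs] at h6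
  linarith

lemma memLp_remainder (D : Design P μ e Z A π0 B C s K δ) (J T : ℕ) :
    MemLp (remainder P e A π0 B Z J T) 2 μ :=
  D.memLp_normalized T (g := fun j ω x => T * batchWeight A π0 B Z T j ω x
    - batchRef A π0 B Z J j ω x) fun _ => ((dependsOnData_batchWeight D.meas_base D.meas_alg T
    le_rfl).const_mul T).sub (dependsOnData_batchRef D.meas_base D.meas_alg J le_rfl)

lemma memLp_mainSum (D : Design P μ e Z A π0 B C s K δ) (J T : ℕ) :
    MemLp (mainSum P e A π0 B Z J T) 2 μ :=
  D.memLp_normalized T (g := batchRef A π0 B Z J) fun _ =>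
    dependsOnData_batchRef D.meas_base D.meas_alg J le_rfl

lemma integral_abs_remainder_le (D : Design P μ e Z A π0 B C s K δ) (J : ℕ) {T : ℕ} (hT : 1 ≤ T) :
    ∫ ω, |remainder P e A π0 B Z J T ω| ∂μ ≤ √(C * distBound K δ J T) := by
  refine (integral_abs_le_sqrt (D.memLp_remainder J T)).trans (Real.sqrt_le_sqrt ?_)
  refine D.integral_normalized_sq_le (g := fun j ω x => T * batchWeight A π0 B Z T j ω x
      - batchRef A π0 B Z J j ω x) (fun _ => ((dependsOnData_batchWeight D.meas_base D.meas_alg T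
    le_rfl).const_mul T).sub (dependsOnData_batchRef D.meas_base D.meas_alg J le_rfl)) ?_
  filter_upwards [D.stab] with ω hω
  exact D.mean_dist_le hω hT J

/-- Reference weights are at most one, so the bound is uniform in `J` and `T`; it multiplies the
error of replacing `v_T` by `σ_J`. -/
lemma integral_abs_mainSum_le (D : Design P μ e Z A π0 B C s K δ) (J : ℕ) {T : ℕ} (hT : 1 ≤ T) :
    ∫ ω, |mainSum P e A π0 B Z J T ω| ∂μ ≤ √C := by
  have hT0 : (0 : ℝ) < T := by exact_mod_cast hT
  refine (integral_abs_le_sqrt (D.memLp_mainSum J T)).trans (Real.sqrt_le_sqrt ?_)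
  rw [← mul_one C]
  refine D.integral_normalized_sq_le (g := batchRef A π0 B Z J)
    (fun _ => dependsOnData_batchRef D.meas_base D.meas_alg J le_rfl) (ae_of_all _ fun ω => ?_)
  calc (1 / (T : ℝ)) * ∑ j ∈ Finset.Icc 1 T, ∫ x, batchRef A π0 B Z J j ω x ^ 2 ∂(covLaw P)
      ≤ (1 / (T : ℝ)) * ∑ j ∈ Finset.Icc 1 T, 1 := by
        gcongr with j _
        exact integral_sq_le_one (D.bddMeas_ref J j ω).1
          fun x => abs_refWeight_le (fun t => prob_mem ω t x) J j
    _ = 1 := by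
        simp only [Finset.sum_const, Nat.card_Icc, Nat.add_sub_cancel, nsmul_eq_mul, mul_one]
        exact one_div_mul_cancel hT0.ne'

end Design

end

end Cram

/-! ### Comparison of characteristic functions. -/

namespace Cram

noncomputable section

/-- From `1/v - 1/σ = -(v² - σ²)/(v σ (v + σ))`; the hypothesis is on squares because it is
variances that are compared. -/
lemma abs_div_sub_div_le {a N N' v σ β : ℝ} (ha : 0 < a) (hv : a ≤ v) (hσ : a ≤ σ)
    (hβ : |v ^ 2 - σ ^ 2| ≤ β) :
    |N / v - N' / σ| ≤ a⁻¹ * |N - N'| + |N'| * (β / a ^ 3) := by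
  have hv0 : 0 < v := ha.trans_le hv
  have hσ0 : 0 < σ := ha.trans_le hσ
  have h1 : N / v - N' / σ = (N - N') / v - N' * ((v ^ 2 - σ ^ 2) / (v * σ * (v + σ))) := by
    field_simp; ring
  have h2 : a ^ 3 ≤ v * σ * (v + σ) := by
    calc a ^ 3 = a * a * a := by ring
      _ ≤ v * σ * (v + σ) := by gcongr; linarith
  rw [h1]
  refine (abs_sub _ _).trans (add_le_add ?_ ?_)
  · rw [abs_div, abs_of_pos hv0, div_eq_inv_mul]
    gcongr
  · rw [abs_mul, abs_div, abs_of_pos (by positivity : 0 < v * σ * (v + σ))]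
    gcongr
    exact (abs_nonneg _).trans hβ

/-- The map `x ↦ exp(iux)` is `|u|`-Lipschitz. This takes the place of Slutsky's theorem, with an
explicit error for each `J` and `T`. -/
lemma norm_charFun_map_sub_le {Ω : Type*} [MeasurableSpace Ω] {μ : Measure Ω}
    [IsProbabilityMeasure μ] {X Y R : Ω → ℝ} (hX : AEMeasurable X μ) (hY : AEMeasurable Y μ)
    (hR : Integrable R μ) (h : ∀ᵐ ω ∂μ, |X ω - Y ω| ≤ R ω) (u : ℝ) :
    ‖charFun (μ.map X) u - charFun (μ.map Y) u‖ ≤ |u| * ∫ ω, R ω ∂μ := by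
  have hexp : ∀ x y : ℝ, ‖Complex.exp (u * x * Complex.I) - Complex.exp (u * y * Complex.I)‖
      ≤ |u| * |x - y| := fun x y => by
    have h1 : Complex.exp (u * x * Complex.I) - Complex.exp (u * y * Complex.I)
        = Complex.exp ((u * y : ℝ) * Complex.I)
          * (Complex.exp (Complex.I * (u * (x - y) : ℝ)) - 1) := by
      rw [mul_sub, ← Complex.exp_add]
      push_cast
      ring_nf
    rw [h1, norm_mul, Complex.norm_exp_ofReal_mul_I, one_mul, ← abs_mul]
    exact Real.norm_exp_I_mul_ofReal_sub_one_le
  have hint : ∀ W : Ω → ℝ, AEMeasurable W μ →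
      Integrable (fun ω => Complex.exp (u * W ω * Complex.I)) μ := fun W hW =>
    Integrable.of_bound (AEMeasurable.aestronglyMeasurable (by fun_prop)) 1
      (ae_of_all _ fun ω => by rw [← Complex.ofReal_mul, Complex.norm_exp_ofReal_mul_I])
  rw [charFun_apply_real, charFun_apply_real, integral_map hX (by fun_prop),
    integral_map hY (by fun_prop), ← integral_sub (hint X hX) (hint Y hY), ← integral_const_mul]
  refine norm_integral_le_of_norm_le (hR.const_mul _) ?_
  filter_upwards [h] with ω hω
  exact (hexp _ _).trans (by gcongr)

namespace Design

variable {p : ℕ} {Ω : Type*} [MeasurableSpace Ω] {P : Measure (Record p)} {μ : Measure Ω}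
  [IsProbabilityMeasure P] [IsProbabilityMeasure μ]
  {e : Covariate p → ℝ} {Z : ℕ → Ω → Record p} {A : LearningAlgorithm p} {π0 : Policy p} {B : ℕ}
  {C s K δ : ℝ}

omit [IsProbabilityMeasure P] [IsProbabilityMeasure μ] in
lemma measurable_asympSD (D : Design P μ e Z A π0 B C s K δ) (T : ℕ) :
    Measurable (asympSD μ e A π0 B Z T) := by
  unfold asympSD
  refine (Measurable.const_mul (Finset.measurable_sum _ fun j _ => ?_) _).sqrt
  exact (stronglyMeasurable_condVar.mono (measurable_dataset D.meas_unit _).comap_le).measurable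

/-- The studentized estimator. -/
def studentized (P : Measure (Record p)) (μ : Measure Ω) (e : Covariate p → ℝ)
    (A : LearningAlgorithm p) (π0 : Policy p) (B : ℕ) (Z : ℕ → Ω → Record p) (T : ℕ) (ω : Ω) : ℝ :=
  √T * ((deltaHat e A π0 B Z T ω - valueDiff P (learned A π0 B Z T ω) π0) / asympSD μ e A π0 B Z T ω)

/-- The decomposition of the numerator, with an arbitrary `J` (here `0`), displays it through
measurable functions of the data. For `T = 0` the factor `√T` vanishes. -/
lemma aemeasurable_studentized (D : Design P μ e Z A π0 B C s K δ) (T : ℕ) :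
    AEMeasurable (studentized P μ e A π0 B Z T) μ := by
  unfold studentized
  simp_rw [← mul_div_assoc]
  refine AEMeasurable.div ?_ (D.measurable_asympSD T).aemeasurable
  rcases Nat.eq_zero_or_pos T with rfl | hT
  · simp
  simp_rw [D.numerator_eq hT 0]
  refine (((D.memLp_mainSum 0 T).1.aemeasurable).add (D.memLp_remainder 0 T).1.aemeasurable).sub
    (AEMeasurable.const_mul ?_ _)
  obtain ⟨g', hm, -, hg⟩ := (dependsOnData_prob (Z := Z) D.meas_base D.meas_alg
    (le_refl (T * B))).sub (dependsOnData_prob (Z := Z) (t := T - 1) D.meas_base D.meas_alg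
      (Nat.mul_le_mul_right B (Nat.sub_le T 1)))
  have h1 := (measurable_ipwMean (P := P) (g := g') D.meas_e hm).comp
    (measurable_dataset D.meas_unit (T * B))
  refine h1.aemeasurable.congr (ae_of_all _ fun ω => ?_)
  simp only [Function.comp, ← hg]

/-- The distance of the studentized estimator to the standardized sum over the batches after `J`. -/
lemma norm_charFun_studentized_sub_le (D : Design P μ e Z A π0 B C s K δ) {M : ℝ} (hM : 0 < M)
    (hlim : ∀ᵐ ω ∂μ, ∀ πlim : Policy p,
      IsLimitPolicy P (fun t => learned A π0 B Z t ω) πlim → M < policyDist P π0 πlim)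
    {a θ : ℝ} (ha : 0 < a) (hθ : 0 < θ) (haM : 2 * a ^ 2 ≤ 1 / (B : ℝ) * (s * (M / 2) ^ 2))
    {J T : ℕ} (hT : 1 ≤ T) (hJ : tailRate K δ J ≤ M / 2)
    (hβ : C * ((1 + 1 / θ) * distBound K δ J T + θ + J / T) ≤ a ^ 2) (u : ℝ) :
    ‖charFun (μ.map (studentized P μ e A π0 B Z T)) u
      - charFun (μ.map (standardizedSum P e Z (policyGap A π0 B Z J) (J * B) (T * B))) u‖
      ≤ |u| * (a⁻¹ * (√(C * distBound K δ J T) + √(C * K * (T : ℝ) ^ (-δ)))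
        + √C * (C * ((1 + 1 / θ) * distBound K δ J T + θ + J / T) / a ^ 3)) := by
  set β := C * ((1 + 1 / θ) * distBound K δ J T + θ + J / T) with hβdef
  set ρ := √(C * K * (T : ℝ) ^ (-δ)) with hρ
  have hβ0 : 0 ≤ β := by
    have := D.C_nonneg
    have := distBound_nonneg (δ := δ) D.K_nonneg J T
    positivity
  have hrem := (D.memLp_remainder J T).integrable one_le_two
  have hmain := (D.memLp_mainSum J T).integrable one_le_two
  have hint : Integrable (fun ω => a⁻¹ * (|remainder P e A π0 B Z J T ω| + ρ)
      + |mainSum P e A π0 B Z J T ω| * (β / a ^ 3)) μ :=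
    ((hrem.abs.add (integrable_const ρ)).const_mul _).add (hmain.abs.mul_const _)
  refine (norm_charFun_map_sub_le (R := fun ω => a⁻¹ * (|remainder P e A π0 B Z J T ω| + ρ)
      + |mainSum P e A π0 B Z J T ω| * (β / a ^ 3)) (D.aemeasurable_studentized T)
    (measurable_standardizedSum D.meas_e D.meas_unit
      (dependsOnData_policyGap D.meas_base D.meas_alg le_rfl)).aemeasurable hint ?_ u).trans ?_
  · filter_upwards [D.stab, hlim, D.asympSD_sq T] with ω hω hlω hsd
    have h1 := D.abs_variance_sub_le hω hT J hθ
    have h2 := D.le_ipwVar_gap hω hlω hJ hM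
    rw [← hβdef] at h1
    set v2 := (1 / (T : ℝ)) * ((1 / (B : ℝ)) * ∑ j ∈ Finset.Icc 1 T,
        ipwVar P e fun x => T * batchWeight A π0 B Z T j ω x) with hv2
    set σ2 := (1 / (B : ℝ)) * ipwVar P e (policyGap A π0 B Z J ω) with hσ2
    have h3 : 2 * a ^ 2 ≤ σ2 := haM.trans (by rw [hσ2]; gcongr)
    -- The factor two in `2 * a ^ 2 ≤ σ2` leaves room for the variance error, which is at most `a ^
    -- 2`.
    have h4 : a ^ 2 ≤ v2 := by linarith [(abs_le.1 (h1.trans hβ)).1]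
    have h5 : a ^ 2 ≤ σ2 := by nlinarith [sq_nonneg a]
    rw [← D.mainSum_div J T ω, studentized, ← mul_div_assoc, D.numerator_eq hT J, hsd]
    refine (abs_div_sub_div_le (β := β) ha (Real.le_sqrt_of_sq_le h4)
      (Real.le_sqrt_of_sq_le h5) ?_).trans ?_
    · rw [Real.sq_sqrt ((sq_nonneg a).trans h4), Real.sq_sqrt ((sq_nonneg a).trans h5)]
      exact h1
    · gcongr
      rw [add_sub_assoc, add_sub_cancel_left]
      exact (abs_sub _ _).trans (add_le_add_right (D.abs_last_step_le hω hT) _)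
  · have e1 : ∫ ω, (a⁻¹ * (|remainder P e A π0 B Z J T ω| + ρ)
        + |mainSum P e A π0 B Z J T ω| * (β / a ^ 3)) ∂μ
        = a⁻¹ * (∫ ω, |remainder P e A π0 B Z J T ω| ∂μ + ρ)
          + (∫ ω, |mainSum P e A π0 B Z J T ω| ∂μ) * (β / a ^ 3) := by
      have hi : Integrable (fun ω => |remainder P e A π0 B Z J T ω| + ρ) μ :=
        hrem.abs.add (integrable_const ρ)
      rw [integral_add (hi.const_mul _) (hmain.abs.mul_const _), integral_const_mul,
        integral_mul_const, integral_add hrem.abs (integrable_const ρ)]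
      simp
    rw [e1]
    gcongr
    · exact D.integral_abs_remainder_le J hT
    · exact D.integral_abs_mainSum_le J hT

/-- The order of choice is `θ`, then `J`, then `T`: the error converges as `T → ∞`, its limit as `J
→ ∞`, and what remains is proportional to `θ`. -/
theorem tendsto_charFun_studentized (D : Design P μ e Z A π0 B C s K δ) {M : ℝ} (hM : 0 < M)
    (hlim : ∀ᵐ ω ∂μ, ∀ πlim : Policy p,
      IsLimitPolicy P (fun t => learned A π0 B Z t ω) πlim → M < policyDist P π0 πlim) (u : ℝ) :
    Tendsto (fun T => charFun (μ.map (studentized P μ e A π0 B Z T)) u) atTop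
      (𝓝 (Complex.exp (-u ^ 2 / 2))) := by
  have hB0 : (0 : ℝ) < B := by exact_mod_cast D.B_pos
  have hs := D.s_pos
  set a : ℝ := √(1 / (B : ℝ) * (s * (M / 2) ^ 2) / 2) with ha_def
  have ha : 0 < a := Real.sqrt_pos.2 (by positivity)
  have haM : 2 * a ^ 2 ≤ 1 / (B : ℝ) * (s * (M / 2) ^ 2) := by
    rw [ha_def, Real.sq_sqrt (by positivity)]; linarith
  let β : ℝ → ℝ → ℝ → ℝ := fun θ d x => C * ((1 + 1 / θ) * d + θ + x)
  -- The error of `norm_charFun_studentized_sub_le` with `d = distBound K δ J T`, `x = J/T`, `r =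
  -- T^{-δ}`. For fixed `θ` it is continuous in these, so every limit is an evaluation.
  let E : ℝ → ℝ → ℝ → ℝ → ℝ := fun θ d x r =>
    |u| * (a⁻¹ * (√(C * d) + √(C * K * r)) + √C * (β θ d x / a ^ 3))
  rw [Metric.tendsto_atTop']
  intro ε hε
  obtain ⟨θ, hθ, hθβ, hθE⟩ : ∃ θ : ℝ, 0 < θ ∧ β θ 0 0 < a ^ 2 ∧ E θ 0 0 0 < ε / 2 := by
    have h1 : Tendsto (fun θ => C * θ) (𝓝[>] 0) (𝓝 0) := by
      have : Continuous fun θ => C * θ := by fun_prop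
      simpa using (this.tendsto 0).mono_left nhdsWithin_le_nhds
    have h2 : Tendsto (fun θ => |u| * (√C * (C * θ / a ^ 3))) (𝓝[>] 0) (𝓝 0) := by
      simpa using ((h1.div_const (a ^ 3)).const_mul √C).const_mul |u|
    obtain ⟨θ, ⟨hθ1, hθ2⟩, hθ3⟩ := (((h1.eventually_lt_const (pow_pos ha 2)).and
      (h2.eventually_lt_const (half_pos hε))).and self_mem_nhdsWithin).exists
    exact ⟨θ, hθ3, by simpa [β] using hθ1, by simpa [E, β] using hθ2⟩
  have hβc : Continuous fun q : ℝ × ℝ => β θ q.1 q.2 := by simp only [β]; fun_prop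
  have hEc : Continuous fun q : ℝ × ℝ × ℝ => E θ q.1 q.2.1 q.2.2 := by
    simp only [E, β]; fun_prop
  have hτ : Tendsto (fun J => 2 * tailRate K δ J) atTop (𝓝 0) := by
    simpa using (tendsto_tailRate K (δ := δ)).const_mul 2
  -- The argument `2 * tailRate K δ J` is the limit of `distBound` as `T → ∞`; strict inequalities
  -- there persist for large `T`.
  obtain ⟨J, ⟨hJβ, hJE⟩, hJM⟩ : ∃ J, (β θ (2 * tailRate K δ J) 0 < a ^ 2 ∧
      E θ (2 * tailRate K δ J) 0 0 < ε / 2) ∧ tailRate K δ J < M / 2 := by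
    have h1 := (hβc.tendsto (0, 0)).comp (hτ.prodMk_nhds tendsto_const_nhds)
    have h2 := (hEc.tendsto (0, 0, 0)).comp
      (hτ.prodMk_nhds (tendsto_const_nhds (x := ((0 : ℝ), (0 : ℝ)))))
    exact (((h1.eventually_lt_const hθβ).and (h2.eventually_lt_const hθE)).and
      ((tendsto_tailRate K).eventually_lt_const (half_pos hM))).exists
  have hd := tendsto_distBound K D.δ_pos J
  have hx := tendsto_const_div_atTop_nhds_zero_nat (J : ℝ)
  have hr : Tendsto (fun T : ℕ => (T : ℝ) ^ (-δ)) atTop (𝓝 0) :=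
    (tendsto_rpow_neg_atTop D.δ_pos).comp tendsto_natCast_atTop_atTop
  have h1 := (hβc.tendsto (2 * tailRate K δ J, 0)).comp (hd.prodMk_nhds hx)
  have h2 := (hEc.tendsto (2 * tailRate K δ J, 0, 0)).comp
    (hd.prodMk_nhds (hx.prodMk_nhds hr))
  have hpos : ∀ᵐ ω ∂μ, 0 < ipwVar P e (policyGap A π0 B Z J ω) := by
    filter_upwards [D.stab, hlim] with ω hω hlω
    exact lt_of_lt_of_le (by positivity) (D.le_ipwVar_gap hω hlω hJM.le hM)
  have h3 := (tendsto_charFun_standardizedSum D.meas_e D.meas_unit D.indep D.law D.memLp_ipw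
    (dependsOnData_policyGap D.meas_base D.meas_alg (le_refl (J * B))) hpos u).comp
    (tendsto_id.atTop_mul_const' D.B_pos)
  obtain ⟨N, hN⟩ := eventually_atTop.1 ((((h1.eventually_lt_const hJβ).and
    (h2.eventually_lt_const hJE)).and (eventually_ge_atTop 1)).and
    (Metric.tendsto_nhds.1 h3 (ε / 2) (half_pos hε)))
  refine ⟨N, fun T hT => ?_⟩
  obtain ⟨⟨⟨hT1, hT2⟩, hT3⟩, hT4⟩ := hN T hT.le
  have h4 := D.norm_charFun_studentized_sub_le hM hlim ha hθ haM hT3 hJM.le hT1.le u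
  rw [← dist_eq_norm] at h4
  calc _ ≤ _ := dist_triangle _ _ _
    _ < ε / 2 + ε / 2 := add_lt_add (h4.trans_lt hT2) hT4
    _ = ε := add_halves ε

end Design

/-! ### From the stated assumptions to the explicit constants, and the theorem. -/

/-- A stabilization rate that holds from the first batch on. -/
lemma Stabilizes.exists_rate {p : ℕ} {Ω : Type*} [MeasurableSpace Ω] {P : Measure (Record p)}
    [IsProbabilityMeasure P] {μ : Measure Ω} {A : LearningAlgorithm p} {π0 : Policy p} {B : ℕ}
    {Z : ℕ → Ω → Record p} (hπ0 : Measurable π0)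
    (hA : ∀ n, Measurable (fun q : (Fin n → Obs p) × Covariate p => A n q.1 q.2))
    (h : Stabilizes P μ (learned A π0 B Z)) :
    ∃ K δ : ℝ, 0 ≤ K ∧ 0 < δ ∧ δ ≤ 1 ∧ ∀ᵐ ω ∂μ, ∀ t, 1 ≤ t →
      ∫ x, |prob A π0 B Z ω t x - prob A π0 B Z ω (t - 1) x| ∂(covLaw P)
        ≤ K * (t : ℝ) ^ (-(1 + δ)) := by
  obtain ⟨δ, hδ, R, hR, K, hK, h⟩ := h
  -- Lowering the exponent only weakens the rate, as `t ≥ 1`, and provides `δ ≤ 1`.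
  set η := min δ 1 with hη
  have hη0 : 0 < η := lt_min hδ one_pos
  refine ⟨K + (R : ℝ) ^ (1 + η), η, by positivity, hη0, min_le_right _ _, ?_⟩
  have h' : ∀ᵐ ω ∂μ, ∀ t, R ≤ t →
      (t : ℝ) ^ (1 + δ) * policyDist P (learned A π0 B Z t ω) (learned A π0 B Z (t - 1) ω) ≤ K :=
    ae_all_iff.2 fun t => by
      by_cases ht : R ≤ t
      · filter_upwards [h t ht] with ω hω _ using hω
      · exact ae_of_all _ fun ω h => absurd h ht
  filter_upwards [h'] with ω hω t ht
  have ht1 : (1 : ℝ) ≤ t := by exact_mod_cast ht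
  have ht0 : (0 : ℝ) < t := by linarith
  have hRη : 0 ≤ (R : ℝ) ^ (1 + η) := by positivity
  set q := ∫ x, |prob A π0 B Z ω t x - prob A π0 B Z ω (t - 1) x| ∂(covLaw P) with hq
  have hq0 : 0 ≤ q := integral_nonneg fun x => abs_nonneg _
  rw [Real.rpow_neg ht0.le, ← div_eq_mul_inv, le_div_iff₀ (by positivity)]
  by_cases htR : R ≤ t
  · calc q * (t : ℝ) ^ (1 + η) ≤ q * (t : ℝ) ^ (1 + δ) := by
          gcongr
          exact min_le_left _ _
      _ ≤ K := by rw [mul_comm]; exact hω t htR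
      _ ≤ _ := by linarith
  -- The steps before `R` are at most one in `L¹`, and `t^{1+η} ≤ R^{1+η}`; this is the extra term
  -- in the constant.
  · have hq1 : q ≤ 1 := by
      have h1 := integral_mono (μ := covLaw P) (integrable_abs_sub
        (fun t => measurable_prob_apply (B := B) (Z := Z) hπ0 hA ω t) (prob_mem ω) t (t - 1))
        (integrable_const (1 : ℝ)) fun x => abs_sub_le_one (prob_mem ω t x) (prob_mem ω (t - 1) x)
      simpa using h1
    calc q * (t : ℝ) ^ (1 + η) ≤ 1 * (R : ℝ) ^ (1 + η) := by
          gcongr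
          omega
      _ ≤ _ := by linarith

end

end Cram

theorem theorem2 {p : ℕ}
    -- the population: law of `(X, D, (Y(0), Y(1)))` and the known propensity score
    (P : Measure (Cram.Record p)) [IsProbabilityMeasure P]
    (e : Cram.Covariate p → ℝ) (he : Cram.IsPropensityScore P e)
    (hign : Cram.StrongIgnorability P e)
    (hbdd : Cram.BoundedConditionalMoments P)
    (hmom : Cram.FiniteFourthMoments P)
    -- i.i.d. units
    {Ω : Type*} [MeasurableSpace Ω] (μ : Measure Ω) [IsProbabilityMeasure μ]
    (Z : ℕ → Ω → Cram.Record p) (hZm : ∀ i, Measurable (Z i))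
    (hZind : iIndepFun Z μ) (hZlaw : ∀ i, μ.map (Z i) = P)
    -- baseline policy, batch size, learning algorithm
    (π0 : Cram.Policy p) (hπ0 : Measurable π0) (B : ℕ) (hB : 0 < B)
    (A : Cram.LearningAlgorithm p)
    (hA : ∀ n, Measurable (fun q : (Fin n → Cram.Obs p) × Cram.Covariate p => A n q.1 q.2))
    (hstab : Cram.Stabilizes P μ (Cram.learned A π0 B Z))
    (hlim : Cram.LimitDiffers P μ π0 (Cram.learned A π0 B Z)) :
    TendstoInDistribution
      (fun (T : ℕ) (ω : Ω) => Real.sqrt (T : ℝ) *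
        ((Cram.deltaHat e A π0 B Z T ω - Cram.valueDiff P (Cram.learned A π0 B Z T ω) π0) /
          Cram.asympSD μ e A π0 B Z T ω))
      atTop (id : ℝ → ℝ) (fun _ => μ) (gaussianReal 0 1) := by
  obtain ⟨C, hC, hle⟩ := Cram.exists_integral_ipw_sq_le hign hbdd hmom
  obtain ⟨s, hs, hge⟩ := Cram.exists_le_ipwVar he hign hbdd hmom
  obtain ⟨K, δ, hK, hδ, hδ1, hrate⟩ := hstab.exists_rate hπ0 hA
  obtain ⟨M, hM, hdiff⟩ := hlim
  have D : Cram.Design P μ e Z A π0 B C s K δ :=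
    { meas_e := he.1
      memLp_ipw := Cram.memLp_ipw he hign hmom
      C_nonneg := hC
      ipw_sq_le := hle
      s_pos := hs
      le_ipwVar := hge
      valueDiff_eq := fun _ _ hπ hπ' => Cram.valueDiff_eq_ipwMean he hign hmom hπ hπ'
      meas_unit := hZm
      indep := hZind
      law := hZlaw
      meas_base := hπ0
      B_pos := hB
      meas_alg := hA
      K_nonneg := hK
      δ_pos := hδ
      δ_le := hδ1
      stab := hrate }
  refine ⟨D.aemeasurable_studentized, aemeasurable_id, ?_⟩
  refine ProbabilityMeasure.tendsto_iff_tendsto_charFun.2 fun u => ?_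
  have h1 : charFun ((gaussianReal 0 1).map id) u = Complex.exp (-u ^ 2 / 2) := by
    rw [Measure.map_id, charFun_gaussianReal]
    congr 1
    simp [neg_div]
  simp only [ProbabilityMeasure.coe_mk]
  rw [h1]
  exact D.tendsto_charFun_studentized hM hdiff u
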